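/- Let $q\in\mathbb C$ with $0<|q|<1$. Write $(a)_\infty=\prod_{j\ge 0}(1-aq^j)$, $\theta(x)=(x)_\infty(q/x)_\infty$, and for $k\in\mathbb Z$ let $(a)_k=\prod_{i=0}^{k-1}(1-aq^i)$ if $k\ge 0$ and $(a)_k=\prod_{i=1}^{-k}(1-aq^{-i})^{-1}$ if $k<0$; let $\binom n2=n(n-1)/2$ for $n\in\mathbb Z$. Let $a_1,a_2,a_3,b_1,b_2,b_3\in\mathbb C$ satisfy $a_1a_2a_3b_1b_2b_3=q$ and be generic in the sense that $a_i/a_j\notin q^{\mathbb Z}$ and $b_i/b_j\notin q^{\mathbb Z}$ for $i\neq j$, and $a_ib_j\notin q^{\mathbb Z}$ for all $i,j$. Put $t=a_1a_2a_3$. Let $W$ be the space of rational functions in $z$ that are regular everywhere, including at infinity, except for possible single poles at the points of $a_j^{-1}q^{\mathbb Z_{>0}}$ and $b_jq^{\mathbb Z_{<0}}$, $1\le j\le 3$. For integers $k_j,l_j,T$ with $k_1+k_2+k_3=-l_1-l_2-l_3=T$, the function $$g_{k,l}(z)=z^{-T}\prod_{j=1}^3(a_jz)_{k_j}(b_j/z)_{l_j}$$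 is in $W$, and there is a unique linear functional $\mathbf K$ on $W$ (the Al-Salam--Ismail functional) such that, for all such $k,l,T$, $$\mathbf K(g_{k,l})=\frac{(-t)^Tq^{\binom T2}\prod_{i,j=1}^3(a_ib_j)_{k_i+l_j}}{\prod_{j=1}^3q^{\binom{k_j}2+\binom{l_j}2}a_j^{k_j}b_j^{l_j}}.$$ For nonzero $\lambda_1,\lambda_2$ let $$D(\lambda_1,\lambda_2)=\prod_{j=1}^3\theta(\lambda_1/a_j)\theta(\lambda_2b_j)-\frac{\lambda_1}{\lambda_2}\prod_{j=1}^3\theta(\lambda_1b_j)\theta(\lambda_2/a_j).$$ Then $\{(\lambda_1,\lambda_2)\in(\mathbb C\setminus\{0\})^2: D(\lambda_1,\lambda_2)\neq 0\}$ is open and dense in $\mathbb C^2$. For all $\lambda_1,\lambda_2,\lambda_3$ such that $$\lambda_1\lambda_2\lambda_3=qa_1a_2a_3=\frac{q^2}{b_1b_2b_3}\qquad\text{and}\qquad D(\lambda_1,\lambda_2)\neq 0,$$ and for every $g\in W$, $$\mathbf K(g)=\frac{(q)_\infty\,\theta(\lambda_1/\lambda_2)\prod_{i,j=1}^3(a_ib_j)_\infty}{D(\lambda_1,\lambda_2)}\oint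 g(z)\prod_{j=1}^3\frac{\theta(\lambda_jz)}{(a_jz)_\infty(b_j/z)_\infty}\,\frac{dz}{2\pi\mathrm i z}.$$ Here the integral is over any closed piecewise $C^1$ curve in $\mathbb C\setminus\{0\}$ that passes through no pole of the integrand, has winding number $1$ around the origin and around all poles of the integrand of the form $z\in b_jq^{\mathbb Z}$, and has winding number $0$ around all poles of the form $z\in a_j^{-1}q^{\mathbb Z}$. Such a curve exists for every $g\in W$ (it may depend on $g$), and the integral converges absolutely on every such curve. -/

import Mathlib

open Polynomial

noncomputable section

namespace AlSalamIsmail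

/-- The `q`-shifted factorial `(a)_k` with integer index `k`, over any field. -/
def qFactorial {F : Type*} [Field F] (q a : F) : ℤ → F
  | Int.ofNat n => ∏ i ∈ Finset.range n, (1 - a * q ^ i)
  | Int.negSucc n => (∏ i ∈ Finset.range (n + 1), (1 - a * q⁻¹ ^ (i + 1)))⁻¹

/-- The infinite `q`-shifted factorial `(a)_∞`. -/
def qInf (q a : ℂ) : ℂ := ∏' i : ℕ, (1 - a * q ^ i)

/-- The theta function `θ(x) = (x)_∞ (q/x)_∞`. -/
def theta (q x : ℂ) : ℂ := qInf q x * qInf q (q / x)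

/-- The binomial coefficient `n (n - 1) / 2` for an integer `n` (the division is exact). -/
def binomTwo (n : ℤ) : ℤ := n * (n - 1) / 2

/-- The points `a_j⁻¹ q^n` and `b_j q^(-n)`, `n ≥ 1`, where elements of `W` may have poles. -/
def poleSet (q : ℂ) (a b : Fin 3 → ℂ) : Set ℂ :=
  {z | ∃ (j : Fin 3) (n : ℕ), 1 ≤ n ∧ (z = (a j)⁻¹ * q ^ n ∨ z = b j * q⁻¹ ^ n)}

/-- A common denominator with simple roots only. -/
theorem exists_squarefree_denom (f g : RatFunc ℂ)
    (hf : Squarefree f.denom) (hg : Squarefree g.denom) :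
    ∃ d : ℂ[X], Squarefree d ∧ d ∣ f.denom * g.denom ∧ (f + g).denom ∣ d := by
  classical
  have h0 : f.denom * g.denom ≠ 0 := mul_ne_zero f.denom_ne_zero g.denom_ne_zero
  set d := UniqueFactorizationMonoid.radical (f.denom * g.denom) with hd
  have hds : Squarefree d := UniqueFactorizationMonoid.squarefree_radical
  have hdd : d ∣ f.denom * g.denom := UniqueFactorizationMonoid.radical_dvd_self
  have hfd : f.denom ∣ d := by
    refine (UniqueFactorizationMonoid.dvd_radical_iff hf.isRadical h0).2 (dvd_mul_right _ _)
  have hgd : g.denom ∣ d := by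
    refine (UniqueFactorizationMonoid.dvd_radical_iff hg.isRadical h0).2 (dvd_mul_left _ _)
  refine ⟨d, hds, hdd, ?_⟩
  have hd0 : d ≠ 0 := hds.ne_zero
  obtain ⟨p, hp⟩ := (RatFunc.denom_dvd hd0).1 hfd
  obtain ⟨r, hr⟩ := (RatFunc.denom_dvd hd0).1 hgd
  refine (RatFunc.denom_dvd hd0).2 ⟨p + r, ?_⟩
  rw [map_add, add_div, ← hp, ← hr]

/-- The space `W` of rational functions that are regular everywhere, including at infinity,
except for possible single poles at the points of `poleSet`. -/
def W (q : ℂ) (a b : Fin 3 → ℂ) : Submodule ℂ (RatFunc ℂ) where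
  carrier := {f | f.intDegree ≤ 0 ∧ Squarefree f.denom ∧
    ∀ z : ℂ, f.denom.IsRoot z → z ∈ poleSet q a b}
  zero_mem' := by
    refine ⟨by simp, by simp, fun z hz => ?_⟩
    simp [Polynomial.IsRoot] at hz
  add_mem' := by
    rintro f g ⟨hf1, hf2, hf3⟩ ⟨hg1, hg2, hg3⟩
    obtain ⟨d, hd, hdd, hs⟩ := exists_squarefree_denom f g hf2 hg2
    refine ⟨?_, hd.squarefree_of_dvd hs, fun z hz => ?_⟩
    · by_cases hg : g = 0
      · simpa [hg] using hf1
      by_cases hfg : f + g = 0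
      · simp [hfg]
      exact (RatFunc.intDegree_add_le hg hfg).trans (max_le hf1 hg1)
    · have h := hz.dvd (hs.trans hdd)
      rcases Polynomial.root_mul.1 h with h | h
      · exact hf3 z h
      · exact hg3 z h
  smul_mem' := by
    rintro c f ⟨hf1, hf2, hf3⟩
    by_cases hc : c = 0
    · subst hc
      refine ⟨by simp, by simp, fun z hz => ?_⟩
      simp [Polynomial.IsRoot] at hz
    have hden : (c • f).denom ∣ f.denom := by
      refine (RatFunc.denom_dvd f.denom_ne_zero).2 ⟨Polynomial.C c * f.num, ?_⟩
      rw [map_mul, mul_div_assoc, RatFunc.num_div_denom, RatFunc.algebraMap_C,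
        RatFunc.smul_eq_C_mul]
    refine ⟨?_, hf2.squarefree_of_dvd hden, fun z hz => hf3 z (hz.dvd hden)⟩
    by_cases hf : f = 0
    · simp [hf]
    rw [RatFunc.smul_eq_C_mul, RatFunc.intDegree_mul (by simpa using hc) hf, RatFunc.intDegree_C]
    simpa using hf1

/-- The rational function `z^(-T) ∏_j (a_j z)_{k_j} (b_j / z)_{l_j}`. -/
def spanningFunction (q : ℂ) (a b : Fin 3 → ℂ) (k l : Fin 3 → ℤ) (T : ℤ) : RatFunc ℂ :=
  (RatFunc.X : RatFunc ℂ) ^ (-T) * ∏ j : Fin 3,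
    (qFactorial (RatFunc.C q) (RatFunc.C (a j) * RatFunc.X) (k j) *
      qFactorial (RatFunc.C q) (RatFunc.C (b j) / RatFunc.X) (l j))

/-- The value of the Al-Salam--Ismail functional on a spanning function, where `t = a₁a₂a₃`. -/
def spanningValue (q : ℂ) (a b : Fin 3 → ℂ) (k l : Fin 3 → ℤ) (T : ℤ) : ℂ :=
  (-(∏ j, a j)) ^ T * q ^ binomTwo T *
      (∏ i : Fin 3, ∏ j : Fin 3, qFactorial q (a i * b j) (k i + l j)) /
    ∏ j : Fin 3, (q ^ (binomTwo (k j) + binomTwo (l j)) * a j ^ k j * b j ^ l j)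

/-- `K` is the Al-Salam--Ismail functional: a linear functional on `W` with the prescribed values
on all spanning functions, which moreover belong to `W`. -/
def IsFunctional (q : ℂ) (a b : Fin 3 → ℂ) (K : W q a b →ₗ[ℂ] ℂ) : Prop :=
  ∀ (k l : Fin 3 → ℤ) (T : ℤ), ∑ j, k j = T → ∑ j, l j = -T →
    ∃ h : spanningFunction q a b k l T ∈ W q a b,
      K ⟨spanningFunction q a b k l T, h⟩ = spanningValue q a b k l T

/-- The expression
`∏_j θ(λ₁/a_j) θ(λ₂ b_j) - (λ₁/λ₂) ∏_j θ(λ₁ b_j) θ(λ₂/a_j)`. -/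
def normDenom (q : ℂ) (a b : Fin 3 → ℂ) (lam₁ lam₂ : ℂ) : ℂ :=
  (∏ j, (theta q (lam₁ / a j) * theta q (lam₂ * b j))) -
    lam₁ / lam₂ * ∏ j, (theta q (lam₁ * b j) * theta q (lam₂ / a j))

/-- The normalizing factor in front of the integral. -/
def normFactor (q : ℂ) (a b : Fin 3 → ℂ) (lam₁ lam₂ : ℂ) : ℂ :=
  qInf q q * theta q (lam₁ / lam₂) * (∏ i : Fin 3, ∏ j : Fin 3, qInf q (a i * b j)) /
    normDenom q a b lam₁ lam₂

/-- The weight `∏_j θ(λ_j z) / ((a_j z)_∞ (b_j / z)_∞)`. -/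
def weight (q : ℂ) (a b lam : Fin 3 → ℂ) (z : ℂ) : ℂ :=
  ∏ j, (theta q (lam j * z) / (qInf q (a j * z) * qInf q (b j / z)))

/-- The integrand, with respect to `dz`, for `g = f`: the function `f(z) weight(z) / z`. -/
def integrand (q : ℂ) (a b lam : Fin 3 → ℂ) (f : RatFunc ℂ) (z : ℂ) : ℂ :=
  f.eval (RingHom.id ℂ) z * weight q a b lam z / z

/-- The complex one-form `F(z) dz`. -/
def oneForm (F : ℂ → ℂ) (z : ℂ) : ℂ →L[ℂ] ℂ := ContinuousLinearMap.toSpanSingleton ℂ (F z)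

/-- The complex line integral of `F(z) dz` along `γ`, divided by `2πi`. -/
def lineIntegral (F : ℂ → ℂ) {z₀ : ℂ} (γ : Path z₀ z₀) : ℂ :=
  (2 * (Real.pi : ℂ) * Complex.I)⁻¹ * curveIntegral (oneForm F) γ

/-- The winding number of the closed curve `γ` around a point `w` not on `γ`. -/
def winding {z₀ : ℂ} (γ : Path z₀ z₀) (w : ℂ) : ℂ := lineIntegral (fun z => (z - w)⁻¹) γ

/-- A closed curve is piecewise continuously differentiable: it is continuously differentiable,
with bounded derivative, off finitely many parameter values. -/
def IsPiecewiseC1 {z₀ : ℂ} (γ : Path z₀ z₀) : Prop :=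
  ∃ (s : Finset ℝ) (M : ℝ), ∀ t ∈ Set.Ioo (0 : ℝ) 1, t ∉ s →
    ContDiffAt ℝ 1 γ.extend t ∧ ‖deriv γ.extend t‖ ≤ M

/-- Contours of integration: closed piecewise `C¹` curves in `ℂ \ {0}` through no pole of the
integrand `F`, positively oriented around the origin, that encircle once the poles of `F` of the
form `b_j q^m` and do not encircle the poles of `F` of the form `a_j⁻¹ q^m`, `m ∈ ℤ`. -/
structure IsContour (q : ℂ) (a b : Fin 3 → ℂ) (F : ℂ → ℂ) {z₀ : ℂ} (γ : Path z₀ z₀) : Prop where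
  piecewiseC1 : IsPiecewiseC1 γ
  ne_zero : ∀ t, γ t ≠ 0
  avoids : ∀ t, ¬ meromorphicOrderAt F (γ t) < 0
  winding_zero : winding γ 0 = 1
  inside : ∀ (j : Fin 3) (m : ℤ), meromorphicOrderAt F (b j * q ^ m) < 0 →
    winding γ (b j * q ^ m) = 1
  outside : ∀ (j : Fin 3) (m : ℤ), meromorphicOrderAt F ((a j)⁻¹ * q ^ m) < 0 →
    winding γ ((a j)⁻¹ * q ^ m) = 0

end AlSalamIsmail

end

/-! # The Al-Salam--Ismail functional as a contour integral -/

noncomputable section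

namespace AlSalamIsmail

open Filter Topology Set MeasureTheory
open scoped Interval

/-! The functional is constructed as the integral itself, and the proof is the evaluation of one
integral. Write `w` for the weight. Its poles in the punctured plane lie among the points `b_j q^n`
and `a_j⁻¹ q^(-n)` with `n ≥ 0`, whereas elements of `W` have theirs at the remaining points of the
same orbits; hence all poles of the integrand away from the origin are simple. A residue theorem on
an annulus (`lineIntegral_eq_sum_residues`, `Generic.lineIntegral_eq`) shows that the integral does
not depend on the contour. Contours exist because the winding numbers of a circle can be corrected
at finitely many points by small loops (`exists_winding_add_finset`, `Generic.exists_contour`).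

Multiplying `w` by a spanning function `g_{k,l}` gives, up to a constant, the weight with parameters
`a_j q^(k_j)`, `b_j q^(l_j)`, `q^T λ₁` (`Generic.weight_shift`), and these are again balanced. So
only the case `g = 1` has to be evaluated. Near the origin `w (q z) / w z` tends to `q`, so the
integrals over shrinking circles tend to zero, and the integral is the sum of the residues at `b_j
q^n` (`Generic.lineIntegral_one`): a combination `residueSum` of three nonterminating basic
hypergeometric series.

This combination equals `normDenom`, up to the factor `(q)_∞ θ(λ₁/λ₂)` (`residueSum_eq`). To see it,
deform `a` to `(a₁ s, a₂ / s, a₃)` and regard both sides as functions of `s`. Both satisfy `s² E(q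
s) = κ E(s)` with the same `κ`: for `normDenom` this is quasi-periodicity of theta, for `residueSum`
it is a contiguity relation proved by telescoping (`residueSum_shift`), whose boundary terms cancel
by the three-term theta identity `sum_theta_eq_zero`. At the three points `s = 1 / (a₁ b_j)` the
series collapse to a single term and the claim becomes Weierstrass' addition formula
`theta_addition`. A theta function of degree two with three inequivalent zeros is zero
(`eq_zero_of_three_zeros`), which proves equality, in particular at `s = 1`. Comparing `normDenom`
before and after the shift (`normDenom_shift`) gives the prescribed values.

Uniqueness holds because the spanning functions span `W`: by partial fractions and a triangular
elimination they yield all functions `1 / (z - p)` with an allowed pole `p` (`Generic.W_le_span`).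
The function `normDenom` is analytic on the punctured bidisc of all nonzero pairs and is nonzero at
`(a₁, y)` for generic `y`, so its nonvanishing set is open and dense; in particular some admissible
`λ` exists, which gives existence of the functional. -/

/-- The function `F` has at most a simple pole at `p`, with residue `c`. -/
def HasSimplePole (F : ℂ → ℂ) (p c : ℂ) : Prop :=
  ∃ G : ℂ → ℂ, AnalyticAt ℂ G p ∧ G p = c ∧ ∀ᶠ z in 𝓝[≠] p, F z = (z - p)⁻¹ * G z

/-! ### Calculus of simple poles and residues. -/

namespace HasSimplePole

variable {F F' : ℂ → ℂ} {p c c' : ℂ}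

theorem congr (h : HasSimplePole F p c) (hF : ∀ᶠ z in 𝓝[≠] p, F z = F' z) :
    HasSimplePole F' p c := by
  obtain ⟨G, hG, hc, hFG⟩ := h
  refine ⟨G, hG, hc, ?_⟩
  filter_upwards [hFG, hF] with z h1 h2
  rw [← h2, h1]

theorem add (h : HasSimplePole F p c) (h' : HasSimplePole F' p c') :
    HasSimplePole (fun z => F z + F' z) p (c + c') := by
  obtain ⟨G, hG, hc, hFG⟩ := h
  obtain ⟨G', hG', hc', hFG'⟩ := h'
  refine ⟨fun z => G z + G' z, hG.add hG', by simp [hc, hc'], ?_⟩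
  filter_upwards [hFG, hFG'] with z h1 h2
  rw [h1, h2, mul_add]

theorem mul_analyticAt (h : HasSimplePole F p c) {g : ℂ → ℂ} (hg : AnalyticAt ℂ g p) :
    HasSimplePole (fun z => F z * g z) p (c * g p) := by
  obtain ⟨G, hG, hc, hFG⟩ := h
  refine ⟨fun z => G z * g z, hG.mul hg, by simp [hc], ?_⟩
  filter_upwards [hFG] with z h1
  rw [h1, mul_assoc]

theorem const_mul (h : HasSimplePole F p c) (k : ℂ) :
    HasSimplePole (fun z => k * F z) p (k * c) := by
  have := h.mul_analyticAt (g := fun _ => k) analyticAt_const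
  simpa only [mul_comm] using this

theorem neg (h : HasSimplePole F p c) : HasSimplePole (fun z => - F z) p (-c) := by
  simpa using h.const_mul (-1)

theorem sub (h : HasSimplePole F p c) (h' : HasSimplePole F' p c') :
    HasSimplePole (fun z => F z - F' z) p (c - c') := by
  simpa [sub_eq_add_neg] using h.add h'.neg

theorem of_analyticAt (h : AnalyticAt ℂ F p) : HasSimplePole F p 0 := by
  refine ⟨fun z => (z - p) * F z, by fun_prop, by simp, ?_⟩
  filter_upwards [self_mem_nhdsWithin] with z hz
  rw [inv_mul_cancel_left₀ (sub_ne_zero.2 hz)]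

/-- Since `G p = 0`, the singularity is removable: `G z / (z - p)` continues analytically as `dslope
G p`. -/
theorem exists_analyticAt (h : HasSimplePole F p 0) :
    ∃ G : ℂ → ℂ, AnalyticAt ℂ G p ∧ ∀ᶠ z in 𝓝[≠] p, F z = G z := by
  obtain ⟨G, hG, hc, hFG⟩ := h
  obtain ⟨f, hf⟩ := hG
  refine ⟨dslope G p, ⟨_, hf.has_fpower_series_dslope_fslope⟩, ?_⟩
  filter_upwards [hFG, self_mem_nhdsWithin] with z h1 hz
  rw [h1, dslope_of_ne _ hz, slope_def_field, hc, sub_zero]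
  ring

theorem sum {ι : Type*} {s : Finset ι} {F : ι → ℂ → ℂ} {c : ι → ℂ}
    (h : ∀ i ∈ s, HasSimplePole (F i) p (c i)) :
    HasSimplePole (fun z => ∑ i ∈ s, F i z) p (∑ i ∈ s, c i) := by
  classical
  induction s using Finset.induction_on with
  | empty => simpa using of_analyticAt (analyticAt_const (v := (0 : ℂ)))
  | insert i s hi ih =>
    simp only [Finset.sum_insert hi]
    exact (h i (by simp)).add (ih fun j hj => h j (by simp [hj]))

theorem inv_sub_self (p c : ℂ) : HasSimplePole (fun z => c * (z - p)⁻¹) p c :=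
  ⟨fun _ => c, analyticAt_const, rfl, Eventually.of_forall fun _ => mul_comm _ _⟩

theorem inv_sub_of_ne {p p' : ℂ} (c : ℂ) (h : p ≠ p') :
    HasSimplePole (fun z => c * (z - p')⁻¹) p 0 :=
  of_analyticAt (analyticAt_const.mul ((by fun_prop : AnalyticAt ℂ (fun z => z - p') p).inv
    (sub_ne_zero.2 h)))

theorem meromorphicAt (h : HasSimplePole F p c) : MeromorphicAt F p := by
  obtain ⟨G, hG, hc, hFG⟩ := h
  have : MeromorphicAt (fun z => (z - p)⁻¹ * G z) p := by
    have h1 : MeromorphicAt (fun z : ℂ => z - p) p :=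
      (by fun_prop : AnalyticAt ℂ (fun z : ℂ => z - p) p).meromorphicAt
    exact h1.inv.mul hG.meromorphicAt
  exact this.congr (hFG.mono fun z hz => hz.symm)

theorem not_order_neg (h : HasSimplePole F p 0) : ¬ meromorphicOrderAt F p < 0 := by
  obtain ⟨G, hG, hFG⟩ := h.exists_analyticAt
  rw [not_lt, meromorphicOrderAt_congr hFG]
  exact hG.meromorphicOrderAt_nonneg

/-- Together with `not_order_neg` this links residues to negative `meromorphicOrderAt`, the form in
which `IsContour` refers to poles. -/
theorem order_neg (h : HasSimplePole F p c) (hc : c ≠ 0) : meromorphicOrderAt F p < 0 := by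
  have hm := h.meromorphicAt
  obtain ⟨G, hG, hGc, hFG⟩ := h
  have : meromorphicOrderAt F p = ((-1 : ℤ) : WithTop ℤ) := by
    rw [meromorphicOrderAt_eq_int_iff hm]
    refine ⟨G, hG, hGc ▸ hc, ?_⟩
    filter_upwards [hFG] with z hz
    rw [hz]; simp
  rw [this]
  exact WithTop.coe_lt_coe.2 (by norm_num)

theorem eq_zero_of_not_order_neg (h : HasSimplePole F p c)
    (hp : ¬ meromorphicOrderAt F p < 0) : c = 0 := by
  by_contra hc
  exact hp (h.order_neg hc)

theorem inv_of_simple_zero {f : ℂ → ℂ} {d : ℂ} (hf : AnalyticAt ℂ f p) (h0 : f p = 0)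
    (hd : HasDerivAt f d p) (hd0 : d ≠ 0) : HasSimplePole (fun z => (f z)⁻¹) p d⁻¹ := by
  obtain ⟨P, hP⟩ := hf
  have hs : AnalyticAt ℂ (dslope f p) p := ⟨_, hP.has_fpower_series_dslope_fslope⟩
  have hsp : dslope f p p = d := by rw [dslope_same, hd.deriv]
  refine ⟨fun z => (dslope f p z)⁻¹, hs.inv (by rwa [hsp]), congrArg _ hsp, ?_⟩
  filter_upwards [self_mem_nhdsWithin] with z hz
  rw [dslope_of_ne _ hz, slope_def_field, h0, sub_zero, inv_div]
  field_simp [sub_ne_zero.2 hz]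

end HasSimplePole

/-! ### Removable singularities. -/

/-- The regularization of a function at its removable singularities. -/
def regularize (F : ℂ → ℂ) (z : ℂ) : ℂ := limUnder (𝓝[≠] z) F

theorem regularize_eq {F : ℂ → ℂ} {p : ℂ} {G : ℂ → ℂ} (hG : ContinuousAt G p)
    (h : ∀ᶠ z in 𝓝[≠] p, F z = G z) : regularize F p = G p :=
  Tendsto.limUnder_eq ((hG.tendsto.mono_left nhdsWithin_le_nhds).congr'
    (h.mono fun _ hz => hz.symm))

/-- A point `z ≠ p` close to `p` has a neighbourhood missing `p` on which `F` and `G` agree away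
from `z`, so the limit defining `regularize F z` is `G z` there too. -/
theorem regularize_eventuallyEq {F : ℂ → ℂ} {p : ℂ} {G : ℂ → ℂ} (hG : AnalyticAt ℂ G p)
    (h : ∀ᶠ z in 𝓝[≠] p, F z = G z) : regularize F =ᶠ[𝓝 p] G := by
  have h' := eventually_eventually_nhdsWithin.2 h
  have hGa := hG.eventually_analyticAt
  rw [eventually_nhdsWithin_iff] at h h'
  filter_upwards [h', hGa] with z hz1 hz2
  by_cases hzp : z = p
  · subst hzp
    exact regularize_eq hG.continuousAt (eventually_nhdsWithin_iff.2 h)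
  · refine regularize_eq hz2.continuousAt ?_
    have := hz1 hzp
    have hne : ∀ᶠ y in 𝓝 z, y ≠ p := isOpen_ne.mem_nhds hzp
    rw [eventually_nhdsWithin_iff] at this ⊢
    filter_upwards [this, hne] with y hy hyp _
    exact hy hyp

theorem HasSimplePole.analyticAt_regularize {F : ℂ → ℂ} {p : ℂ} (h : HasSimplePole F p 0) :
    AnalyticAt ℂ (regularize F) p := by
  obtain ⟨G, hG, hFG⟩ := h.exists_analyticAt
  exact hG.congr (regularize_eventuallyEq hG hFG).symm

theorem HasSimplePole.eventually_eq_regularize {F : ℂ → ℂ} {p : ℂ} (h : HasSimplePole F p 0) :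
    ∀ᶠ z in 𝓝[≠] p, F z = regularize F z := by
  obtain ⟨G, hG, hFG⟩ := h.exists_analyticAt
  filter_upwards [hFG, (regularize_eventuallyEq hG hFG).filter_mono nhdsWithin_le_nhds]
    with z h1 h2
  rw [h1, h2]

/-- A set without accumulation points in `U` meets `U` in a countable set. -/
theorem countable_of_eventually_notMem {X : Type*} [TopologicalSpace X]
    [SecondCountableTopology X] {B U : Set X}
    (h : ∀ z ∈ U, ∀ᶠ y in 𝓝[≠] z, y ∉ B) : (B ∩ U).Countable := by
  -- The intersection is discrete in the subspace topology, and a discrete Lindelöf space is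
  -- countable.
  refine (HereditarilyLindelofSpace.isLindelof (B ∩ U)).countable ?_
  rw [discreteTopology_subtype_iff]
  rintro z ⟨hzB, hzU⟩
  rw [← disjoint_iff, Filter.disjoint_principal_right]
  filter_upwards [h z hzU] with y hy
  exact fun hy' => hy hy'.1

/-! ### Line integrals along piecewise `C¹` paths. -/

/-- Piecewise continuous differentiability for curves that need not be closed. -/
def PiecewiseC1 {a b : ℂ} (γ : Path a b) : Prop :=
  ∃ (s : Finset ℝ) (M : ℝ), ∀ t ∈ Set.Ioo (0 : ℝ) 1, t ∉ s →
    ContDiffAt ℝ 1 γ.extend t ∧ ‖deriv γ.extend t‖ ≤ M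

section CurveIntegral

variable {a b : ℂ} {γ : Path a b} {F F' : ℂ → ℂ}

theorem curveIntegralFun_oneForm_ae (F : ℂ → ℂ) (γ : Path a b) :
    curveIntegralFun (oneForm F) γ =ᵐ[volume.restrict (Ι (0 : ℝ) 1)]
      fun t => deriv γ.extend t * F (γ.extend t) := by
  rw [uIoc_of_le zero_le_one, ← restrict_Ioo_eq_restrict_Ioc]
  filter_upwards [ae_restrict_mem measurableSet_Ioo] with x hx
  rw [curveIntegralFun_def, derivWithin_of_mem_nhds (by simpa using hx)]
  simp [oneForm]

theorem curveIntegrable_oneForm_iff : CurveIntegrable (oneForm F) γ ↔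
    IntervalIntegrable (fun t => deriv γ.extend t * F (γ.extend t)) volume 0 1 :=
  intervalIntegrable_congr_ae (curveIntegralFun_oneForm_ae F γ)

theorem curveIntegral_oneForm (F : ℂ → ℂ) (γ : Path a b) : curveIntegral (oneForm F) γ =
    ∫ t in (0 : ℝ)..1, deriv γ.extend t * F (γ.extend t) := by
  rw [curveIntegral_def]
  exact intervalIntegral.integral_congr_ae_restrict (curveIntegralFun_oneForm_ae F γ)

/-- A curve passes through a given point with nonzero velocity only countably often. -/
theorem countable_deriv_ne_zero (f : ℝ → ℂ) {N : Set ℂ} (hN : N.Countable) :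
    {t : ℝ | f t ∈ N ∧ deriv f t ≠ 0}.Countable := by
  have : {t : ℝ | f t ∈ N ∧ deriv f t ≠ 0} = ⋃ z ∈ N, {t : ℝ | f t = z ∧ deriv f t ≠ 0} := by
    ext t; simp
  rw [this]
  refine hN.biUnion fun z _ => ?_
  -- Where the derivative is nonzero the curve leaves the value `z` at once, so these times do not
  -- accumulate at one another.
  have h := countable_of_eventually_notMem (B := {t : ℝ | f t = z}) (U := {t | deriv f t ≠ 0})
    (fun t ht => (differentiableAt_of_deriv_ne_zero ht).hasDerivAt.eventually_ne ht)
  exact h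

/-- Changing `F` on a countable set of the plane does not affect the integrand almost everywhere:
the curve may stay at such a point for a long time, but then its derivative is zero. This disposes
of the arbitrary values that functions take at removable singularities and of `RatFunc.eval` at
poles. -/
theorem deriv_mul_ae_eq (hF : ∃ N : Set ℂ, N.Countable ∧ ∀ t, γ t ∉ N → F (γ t) = F' (γ t)) :
    (fun t => deriv γ.extend t * F (γ.extend t)) =ᵐ[volume.restrict (Ι (0 : ℝ) 1)]
      fun t => deriv γ.extend t * F' (γ.extend t) := by
  obtain ⟨N, hN, hFF⟩ := hF
  have h0 := (countable_deriv_ne_zero γ.extend hN).ae_notMem (volume.restrict (Ι (0 : ℝ) 1))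
  rw [uIoc_of_le zero_le_one] at *
  filter_upwards [h0, ae_restrict_mem measurableSet_Ioc] with t ht ht'
  by_cases hd : deriv γ.extend t = 0
  · simp [hd]
  have : γ.extend t ∉ N := fun h => ht ⟨h, hd⟩
  have hx : γ.extend t = γ ⟨t, ⟨ht'.1.le, ht'.2⟩⟩ := by
    rw [Path.extend_apply γ ⟨ht'.1.le, ht'.2⟩]
  rw [hx] at this ⊢
  rw [hFF _ this]

theorem curveIntegrable_congr (hF : ∃ N : Set ℂ, N.Countable ∧ ∀ t, γ t ∉ N →
    F (γ t) = F' (γ t)) :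
    CurveIntegrable (oneForm F) γ ↔ CurveIntegrable (oneForm F') γ := by
  rw [curveIntegrable_oneForm_iff, curveIntegrable_oneForm_iff]
  exact intervalIntegrable_congr_ae (deriv_mul_ae_eq hF)

theorem curveIntegral_congr (hF : ∃ N : Set ℂ, N.Countable ∧ ∀ t, γ t ∉ N →
    F (γ t) = F' (γ t)) :
    curveIntegral (oneForm F) γ = curveIntegral (oneForm F') γ := by
  rw [curveIntegral_oneForm, curveIntegral_oneForm]
  exact intervalIntegral.integral_congr_ae_restrict (deriv_mul_ae_eq hF)

theorem continuous_comp_extend (hF : ∀ t, ContinuousAt F (γ t)) :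
    Continuous fun t => F (γ.extend t) := by
  rw [continuous_iff_continuousAt]
  intro t
  exact ContinuousAt.comp (f := γ.extend) (by simpa [Path.extend, IccExtend] using hF _)
    γ.continuous_extend.continuousAt

/-- The bound on the derivative in the definition is used here; measurability of `deriv` is
automatic. -/
theorem PiecewiseC1.intervalIntegrable (hγ : PiecewiseC1 γ) {f : ℝ → ℂ} (hf : Continuous f) :
    IntervalIntegrable (fun t => deriv γ.extend t * f t) volume 0 1 := by
  obtain ⟨s, M, hs⟩ := hγ
  obtain ⟨C, hC⟩ := isCompact_Icc.exists_bound_of_continuousOn (s := Icc (0 : ℝ) 1) hf.continuousOn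
  rw [intervalIntegrable_iff, uIoc_of_le zero_le_one]
  refine Measure.integrableOn_of_bounded (M := M * C) (by simp)
    (((measurable_deriv _).mul hf.measurable).aestronglyMeasurable) ?_
  rw [← restrict_Ioo_eq_restrict_Ioc]
  have h0 := s.countable_toSet.ae_notMem (volume.restrict (Ioo (0 : ℝ) 1))
  filter_upwards [h0, ae_restrict_mem measurableSet_Ioo] with t ht ht'
  rw [norm_mul]
  have h1 := (hs t ht' ht).2
  exact mul_le_mul h1 (hC t (Ioo_subset_Icc_self ht')) (norm_nonneg _)
    ((norm_nonneg _).trans h1)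

theorem PiecewiseC1.curveIntegrable (hγ : PiecewiseC1 γ) (hF : ∀ t, ContinuousAt F (γ t)) :
    CurveIntegrable (oneForm F) γ :=
  curveIntegrable_oneForm_iff.2 (hγ.intervalIntegrable (continuous_comp_extend hF))

theorem oneForm_add (F F' : ℂ → ℂ) :
    oneForm (fun z => F z + F' z) = fun z => oneForm F z + oneForm F' z := by
  ext z; simp [oneForm]

theorem oneForm_const_mul (k : ℂ) (F : ℂ → ℂ) :
    oneForm (fun z => k * F z) = fun z => k • oneForm F z := by
  ext z; simp [oneForm]

theorem curveIntegrable_oneForm_add (h : CurveIntegrable (oneForm F) γ)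
    (h' : CurveIntegrable (oneForm F') γ) :
    CurveIntegrable (oneForm fun z => F z + F' z) γ := by
  rw [oneForm_add]; exact h.add h'

theorem curveIntegral_oneForm_add (h : CurveIntegrable (oneForm F) γ)
    (h' : CurveIntegrable (oneForm F') γ) :
    curveIntegral (oneForm fun z => F z + F' z) γ =
      curveIntegral (oneForm F) γ + curveIntegral (oneForm F') γ := by
  rw [oneForm_add]; exact curveIntegral_add h h'

theorem curveIntegral_oneForm_const_mul (k : ℂ) :
    curveIntegral (oneForm fun z => k * F z) γ = k * curveIntegral (oneForm F) γ := by
  rw [oneForm_const_mul]; exact curveIntegral_smul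

theorem curveIntegrable_oneForm_sum {ι : Type*} {s : Finset ι} {F : ι → ℂ → ℂ}
    (h : ∀ i ∈ s, CurveIntegrable (oneForm (F i)) γ) :
    CurveIntegrable (oneForm fun z => ∑ i ∈ s, F i z) γ ∧
      curveIntegral (oneForm fun z => ∑ i ∈ s, F i z) γ =
        ∑ i ∈ s, curveIntegral (oneForm (F i)) γ := by
  classical
  induction s using Finset.induction_on with
  | empty =>
    have : oneForm (fun _ => (0 : ℂ)) = 0 := by ext; simp [oneForm]
    simp only [Finset.sum_empty, this]
    exact ⟨CurveIntegrable.zero, curveIntegral_zero⟩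
  | insert i s hi ih =>
    simp only [Finset.sum_insert hi]
    have h1 := h i (by simp)
    obtain ⟨h2, h3⟩ := ih fun j hj => h j (by simp [hj])
    exact ⟨curveIntegrable_oneForm_add h1 h2, by rw [curveIntegral_oneForm_add h1 h2, h3]⟩

theorem PiecewiseC1.hasDerivAt (hγ : PiecewiseC1 γ) : ∃ s : Finset ℝ, ∀ t ∈ Set.Ioo (0 : ℝ) 1,
    t ∉ s → HasDerivAt γ.extend (deriv γ.extend t) t ∧ ContinuousAt (deriv γ.extend) t := by
  obtain ⟨s, M, hs⟩ := hγ
  refine ⟨s, fun t ht hts => ⟨((hs t ht hts).1.differentiableAt (by simp)).hasDerivAt, ?_⟩⟩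
  have h := (hs t ht hts).1
  exact (h.derivWithin (m := 0) (by simp)).continuousAt

/-- The fundamental theorem of calculus for integrals along the image of a lifted curve. -/
theorem integral_eq_sub_of_lift {w v f : ℝ → ℂ} (hw : ContinuousOn w (Icc 0 1)) (s : Finset ℝ)
    {P u : ℂ → ℂ} (hd : ∀ t ∈ Ioo (0 : ℝ) 1, t ∉ s → HasDerivAt w (v t) t)
    (hP : ∀ t ∈ Icc (0 : ℝ) 1, HasDerivAt P (u (w t)) (w t))
    (hi : IntervalIntegrable f volume 0 1)
    (hf : ∀ t ∈ Ioo (0 : ℝ) 1, t ∉ s → f t = u (w t) * v t) :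
    ∫ t in (0 : ℝ)..1, f t = P (w 1) - P (w 0) := by
  classical
  -- The product formula for `f` is known only at interior times off `s`; elsewhere the integrand is
  -- taken to be `f t` itself, so that the integral is unchanged.
  have h := integral_eq_of_hasDerivAt_off_countable_of_le (fun t => P (w t))
    (fun t => if t ∈ Ioo (0 : ℝ) 1 ∧ t ∉ s then u (w t) * v t else f t) zero_le_one
    s.countable_toSet ?_ ?_ ?_
  · rw [← h]
    refine intervalIntegral.integral_congr fun t ht => ?_
    by_cases h' : t ∈ Ioo (0 : ℝ) 1 ∧ t ∉ s
    · simp only [h', not_false_eq_true, and_self, if_true]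
      exact hf t h'.1 h'.2
    · simp only [h', if_false]
  · exact fun t ht => ContinuousAt.comp_continuousWithinAt (hP t ht).continuousAt (hw t ht)
  · rintro t ⟨ht, hts⟩
    simp only [ht, show t ∉ s from hts, not_false_eq_true, and_self, if_true]
    exact (hP t (Ioo_subset_Icc_self ht)).comp t (hd t ht hts)
  · refine hi.congr ?_
    intro t ht
    by_cases h' : t ∈ Ioo (0 : ℝ) 1 ∧ t ∉ s
    · simp only [h', not_false_eq_true, and_self, if_true]
      exact hf t h'.1 h'.2
    · simp only [h', if_false]

/-- A curve of winding number one around the origin lifts to a curve of logarithms. -/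
theorem exists_log_lift {z₀ : ℂ} {γ : Path z₀ z₀} (hγ : PiecewiseC1 γ) (h0 : ∀ t, γ t ≠ 0)
    (hw : winding γ 0 = 1) : ∃ (w : ℝ → ℂ) (s : Finset ℝ), ContinuousOn w (Icc 0 1) ∧
      (∀ t ∈ Icc (0 : ℝ) 1, Complex.exp (w t) = γ.extend t) ∧
      (∀ t ∈ Ioo (0 : ℝ) 1, t ∉ s → HasDerivAt w (deriv γ.extend t * (γ.extend t)⁻¹) t) ∧
      w 1 = w 0 + 2 * Real.pi * Complex.I := by
  have hc : ∀ t, ContinuousAt (fun z : ℂ => z⁻¹) (γ t) := fun t => continuousAt_inv₀ (h0 t)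
  have hcont := continuous_comp_extend hc
  have hint := hγ.intervalIntegrable hcont
  obtain ⟨s, hs⟩ := hγ.hasDerivAt
  set v : ℝ → ℂ := fun t => deriv γ.extend t * (γ.extend t)⁻¹ with hv
  have hne : ∀ t, γ.extend t ≠ 0 := fun t => by
    have := h0 (projIcc 0 1 zero_le_one t)
    simpa [Path.extend, IccExtend] using this
  -- A logarithm along the curve is a primitive of `γ' / γ`. Its total increment is `2πi` times the
  -- winding number around the origin.
  set w : ℝ → ℂ := fun t => Complex.log z₀ + ∫ x in (0 : ℝ)..t, v x with hwdef
  have hz₀ : z₀ ≠ 0 := by simpa using h0 0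
  have hwc : ContinuousOn w (Icc 0 1) := by
    refine continuousOn_const.add ?_
    have := intervalIntegral.continuousOn_primitive_interval' (b₁ := 0) (b₂ := 1) (a := 0) hint
      (by simp)
    simpa [uIcc_of_le] using this
  have hwd : ∀ t ∈ Ioo (0 : ℝ) 1, t ∉ s → HasDerivAt w (v t) t := by
    intro t ht hts
    refine HasDerivAt.const_add _ ?_
    refine intervalIntegral.integral_hasDerivAt_right ?_ ?_ ?_
    · refine hint.mono_set ?_
      rw [uIcc_of_le ht.1.le, uIcc_of_le zero_le_one]
      exact Icc_subset_Icc_right ht.2.le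
    · exact ((measurable_deriv _).mul hcont.measurable).stronglyMeasurable.stronglyMeasurableAtFilter
    · exact (hs t ht hts).2.mul hcont.continuousAt
  refine ⟨w, s, hwc, ?_, hwd, ?_⟩
  -- The product `γ exp(-w)` is continuous with zero derivative off a finite set, hence keeps its
  -- initial value `1`.
  · set f : ℝ → ℂ := fun t => γ.extend t * Complex.exp (-w t) with hf
    have key : ∀ x ∈ Icc (0 : ℝ) 1, f x = f 0 := by
      intro x hx
      have h := integral_eq_of_hasDerivAt_off_countable_of_le f (fun _ => 0) hx.1
        s.countable_toSet ?_ ?_ ?_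
      · simp only [intervalIntegral.integral_zero] at h
        exact (sub_eq_zero.1 h.symm)
      · exact γ.continuous_extend.continuousOn.mul
          (Complex.continuous_exp.comp_continuousOn (hwc.mono (Icc_subset_Icc_right hx.2)).neg)
      · rintro t ⟨ht, hts⟩
        have ht1 : t ∈ Ioo (0 : ℝ) 1 := ⟨ht.1, ht.2.trans_le hx.2⟩
        have h1 := (hs t ht1 hts).1.mul ((hwd t ht1 hts).neg.cexp)
        have h3 : deriv γ.extend t * Complex.exp ((-w) t) +
            γ.extend t * (Complex.exp ((-w) t) * -v t) = 0 := by
          have h2 := hne t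
          simp only [hv]
          field_simp
          ring
        rw [h3] at h1
        exact h1
      · exact intervalIntegrable_const
    intro t ht
    have h1 := key t ht
    have h2 : f 0 = 1 := by
      simp only [hf, hwdef, intervalIntegral.integral_same, add_zero, Path.extend_zero,
        Complex.exp_neg, Complex.exp_log hz₀]
      exact mul_inv_cancel₀ hz₀
    rw [h2] at h1
    simp only [hf, Complex.exp_neg] at h1
    field_simp [Complex.exp_ne_zero] at h1
    exact h1.symm
  · simp only [hwdef, intervalIntegral.integral_same, add_zero]
    congr 1
    have : winding γ 0 = (2 * (Real.pi : ℂ) * Complex.I)⁻¹ * ∫ x in (0 : ℝ)..1, v x := by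
      rw [winding, lineIntegral, curveIntegral_oneForm]
      simp [hv]
    rw [hw] at this
    have hpi : (2 * (Real.pi : ℂ) * Complex.I) ≠ 0 := Complex.two_pi_I_ne_zero
    rw [eq_inv_mul_iff_mul_eq₀ hpi, mul_one] at this
    exact this.symm

/-- Complex linearity of the derivative of `u` makes the derivative of the one-form `u dw`
symmetric, so the form is closed and the Poincaré lemma on a convex open set applies. -/
theorem exists_primitive_of_convex {S : Set ℂ} (hS : Convex ℝ S) (hSo : IsOpen S) {u : ℂ → ℂ}
    (hu : DifferentiableOn ℂ u S) : ∃ P : ℂ → ℂ, ∀ w ∈ S, HasDerivAt P (u w) w := by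
  have h1 : ∀ w ∈ S, HasFDerivAt (𝕜 := ℝ) (fun w => (1 : ℂ →L[ℂ] ℂ).smulRight (u w))
      ((((ContinuousLinearMap.smulRightL ℂ ℂ ℂ 1).restrictScalars ℝ)).comp
        (((1 : ℂ →L[ℂ] ℂ).smulRight (deriv u w)).restrictScalars ℝ)) w := by
    intro w hw
    have h2 := (hu.differentiableAt (hSo.mem_nhds hw)).hasDerivAt.hasFDerivAt.restrictScalars ℝ
    exact (((ContinuousLinearMap.smulRightL ℂ ℂ ℂ 1).restrictScalars ℝ).hasFDerivAt).comp w h2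
  obtain ⟨P, hP⟩ := hS.exists_forall_hasFDerivAt_of_fderiv_symmetric hSo
    (ω := fun w => (1 : ℂ →L[ℂ] ℂ).smulRight (u w))
    (fun w hw => (h1 w hw).differentiableAt.differentiableWithinAt) (by
      intro w hw x y
      rw [(h1 w hw).fderiv]
      simp
      ring)
  exact ⟨P, fun w hw => by simpa using (hP w hw).hasDerivAt⟩

end CurveIntegral

/-! ### The residue theorem on an annulus. -/

/-- The integral of a function holomorphic on an annulus along a curve winding once around the
origin is its integral along a circle. -/
theorem curveIntegral_eq_circleIntegral {H : ℂ → ℂ} {r R ρ : ℝ} (hr : 0 < r) (hρ : r < ρ)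
    (hρR : ρ < R) (hH : ∀ z : ℂ, r < ‖z‖ → ‖z‖ < R → AnalyticAt ℂ H z) {z₀ : ℂ} {γ : Path z₀ z₀}
    (hγ : PiecewiseC1 γ) (hγr : ∀ t, r < ‖γ t‖ ∧ ‖γ t‖ < R) (hw : winding γ 0 = 1) :
    curveIntegral (oneForm H) γ = ∮ z in C(0, ρ), H z := by
  -- This strip is the preimage of the annulus under `exp`. It is convex, so the pullback `u dw` of
  -- `H dz` has a primitive `P` on it.
  set S : Set ℂ := {w | Real.log r < w.re ∧ w.re < Real.log R} with hS
  have hρ0 : 0 < ρ := hr.trans hρ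
  have hR0 : 0 < R := hρ0.trans hρR
  have hSc : Convex ℝ S := (convex_halfSpace_re_gt _).inter (convex_halfSpace_re_lt _)
  have hSo : IsOpen S := (isOpen_lt continuous_const Complex.continuous_re).inter
    (isOpen_lt Complex.continuous_re continuous_const)
  have hexp : ∀ w, w ∈ S ↔ r < ‖Complex.exp w‖ ∧ ‖Complex.exp w‖ < R := by
    intro w
    rw [Complex.norm_exp, ← Real.log_lt_iff_lt_exp hr, ← Real.lt_log_iff_exp_lt hR0]
    simp only [hS, mem_ofPred_eq]
  set u : ℂ → ℂ := fun w => H (Complex.exp w) * Complex.exp w with hu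
  have hud : DifferentiableOn ℂ u S := by
    intro w hw
    have h := (hexp w).1 hw
    exact (((hH _ h.1 h.2).differentiableAt.comp w Complex.differentiableAt_exp).mul
      Complex.differentiableAt_exp).differentiableWithinAt
  obtain ⟨P, hP⟩ := exists_primitive_of_convex hSc hSo hud
  have hSp : ∀ w ∈ S, w + 2 * Real.pi * Complex.I ∈ S := by
    intro w hw
    rw [hexp, Complex.exp_periodic, ← hexp]
    exact hw
  -- Because `u` has period `2πi`, the increment of `P` over one period does not depend on the
  -- starting point. Both the curve and the circle lift to paths that advance by exactly one period.
  have hconst : ∀ w ∈ S, ∀ w' ∈ S, P (w + 2 * Real.pi * Complex.I) - P w =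
      P (w' + 2 * Real.pi * Complex.I) - P w' := by
    intro w hw w' hw'
    have hd : ∀ x ∈ S, HasDerivAt (fun x => P (x + 2 * Real.pi * Complex.I) - P x) 0 x := by
      intro x hx
      have h1 := (hP _ (hSp x hx)).comp_add_const x (2 * Real.pi * Complex.I)
      have h2 := h1.sub (hP x hx)
      have h3 : u (x + 2 * Real.pi * Complex.I) - u x = 0 := by
        simp only [hu]
        rw [Complex.exp_periodic]
        exact sub_self _
      rw [h3] at h2
      exact h2
    refine hSo.is_const_of_deriv_eq_zero hSc.isPreconnected (fun x hx =>
      (hd x hx).differentiableAt.differentiableWithinAt) (fun x hx => (hd x hx).deriv) hw hw'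
  have h0 : ∀ t, γ t ≠ 0 := fun t h => by
    have := (hγr t).1
    rw [h, norm_zero] at this
    exact lt_asymm hr this
  obtain ⟨w, s, hwc, hwe, hwd, hw1⟩ := exists_log_lift hγ h0 hw
  have hext : ∀ t, r < ‖γ.extend t‖ ∧ ‖γ.extend t‖ < R := fun t => by
    simpa [Path.extend, IccExtend] using hγr (projIcc 0 1 zero_le_one t)
  have hwS : ∀ t ∈ Icc (0 : ℝ) 1, w t ∈ S := fun t ht => by
    rw [hexp, hwe t ht]; exact hext t
  have hmain : curveIntegral (oneForm H) γ = P (w 1) - P (w 0) := by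
    rw [curveIntegral_oneForm]
    refine integral_eq_sub_of_lift hwc s hwd (fun t ht => hP _ (hwS t ht)) ?_ ?_
    · exact hγ.intervalIntegrable (continuous_comp_extend fun t =>
        (hH _ (hγr t).1 (hγr t).2).continuousAt)
    · intro t ht hts
      simp only [hu]
      rw [hwe t (Ioo_subset_Icc_self ht)]
      have : γ.extend t ≠ 0 := fun h => by
        have := (hext t).1
        rw [h, norm_zero] at this
        exact lt_asymm hr this
      field_simp
  have hL : ∀ θ : ℝ, Complex.exp (Real.log ρ + θ * Complex.I) = circleMap 0 ρ θ := by
    intro θ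
    rw [Complex.exp_add, ← Complex.ofReal_exp, Real.exp_log hρ0, circleMap, zero_add]
  have hLS : ∀ θ : ℝ, (Real.log ρ + θ * Complex.I : ℂ) ∈ S := by
    intro θ
    rw [hexp, hL]
    simp [abs_of_pos hρ0, hρ, hρR]
  have hcirc : (∮ z in C(0, ρ), H z) = P (Real.log ρ + 2 * Real.pi * Complex.I) -
      P (Real.log ρ) := by
    rw [circleIntegral]
    have h1 := intervalIntegral.integral_eq_sub_of_hasDerivAt (a := 0) (b := 2 * Real.pi)
      (f := fun θ : ℝ => P (Real.log ρ + θ * Complex.I))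
      (f' := fun θ : ℝ => deriv (circleMap 0 ρ) θ • H (circleMap 0 ρ θ)) ?_ ?_
    · rw [h1]; simp
    · intro θ _
      have h2 : HasDerivAt (fun θ : ℝ => (Real.log ρ + θ * Complex.I : ℂ)) (1 * Complex.I) θ :=
        ((Complex.ofRealCLM.hasDerivAt (x := θ)).mul_const Complex.I).const_add _
      have h3 := (hP _ (hLS θ)).comp θ h2
      refine h3.congr_deriv ?_
      simp only [hu, hL, deriv_circleMap, smul_eq_mul]
      ring
    · refine Continuous.intervalIntegrable ?_ _ _
      have hdc : Continuous (deriv (circleMap 0 ρ)) := by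
        rw [show deriv (circleMap 0 ρ) = fun θ => circleMap 0 ρ θ * Complex.I from
          funext fun θ => deriv_circleMap 0 ρ θ]
        fun_prop
      refine hdc.smul ?_
      rw [continuous_iff_continuousAt]
      intro θ
      have := (hexp _).1 (hLS θ)
      rw [hL] at this
      exact (hH _ this.1 this.2).continuousAt.comp (continuous_circleMap 0 ρ).continuousAt
  rw [hmain, hcirc, hw1]
  have := hLS 0
  simp only [Complex.ofReal_zero, zero_mul, add_zero] at this
  exact hconst _ (hwS 0 (by simp)) _ this

/-- The residue theorem for functions with simple poles on an annulus and a curve winding once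
around the origin, relative to a circle around the origin. -/
theorem lineIntegral_eq_sum_residues {F : ℂ → ℂ} {r R ρ : ℝ} (hr : 0 < r) (hρ : r < ρ)
    (hρR : ρ < R) {P : Finset ℂ} {c : ℂ → ℂ} (hP : ∀ p ∈ P, ρ < ‖p‖)
    (hF : ∀ z : ℂ, r < ‖z‖ → ‖z‖ < R → HasSimplePole F z (if z ∈ P then c z else 0))
    (hFρ : ∀ z : ℂ, ‖z‖ = ρ → AnalyticAt ℂ F z) {z₀ : ℂ} {γ : Path z₀ z₀}
    (hγ : PiecewiseC1 γ) (hγr : ∀ t, r < ‖γ t‖ ∧ ‖γ t‖ < R) (hw : winding γ 0 = 1)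
    (hγP : ∀ t, γ t ∈ P → c (γ t) = 0) :
    CurveIntegrable (oneForm F) γ ∧ lineIntegral F γ = ∑ p ∈ P, c p * winding γ p +
      (2 * (Real.pi : ℂ) * Complex.I)⁻¹ * ∮ z in C(0, ρ), F z := by
  classical
  have hρ0 : 0 < ρ := hr.trans hρ
  -- The sum of the principal parts. The difference `F - Q` has only removable singularities in the
  -- annulus, and its regularization `K` is holomorphic there.
  set Q : ℂ → ℂ := fun z => ∑ p ∈ P, c p * (z - p)⁻¹ with hQ
  set H : ℂ → ℂ := fun z => F z - Q z with hH
  have hQs : ∀ z, HasSimplePole Q z (if z ∈ P then c z else 0) := by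
    intro z
    have : (if z ∈ P then c z else 0) = ∑ p ∈ P, if z = p then c p else 0 := by
      rw [Finset.sum_ite_eq]
    rw [this]
    refine HasSimplePole.sum fun p _ => ?_
    split_ifs with h
    · subst h; exact HasSimplePole.inv_sub_self _ _
    · exact HasSimplePole.inv_sub_of_ne _ h
  have hHs : ∀ z : ℂ, r < ‖z‖ → ‖z‖ < R → HasSimplePole H z 0 := fun z h1 h2 => by
    simpa using (hF z h1 h2).sub (hQs z)
  set K := regularize H with hK
  have hKa : ∀ z : ℂ, r < ‖z‖ → ‖z‖ < R → AnalyticAt ℂ K z := fun z h1 h2 =>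
    (hHs z h1 h2).analyticAt_regularize
  have hQi : ∀ p ∈ P, CurveIntegrable (oneForm fun z => c p * (z - p)⁻¹) γ := by
    intro p hp
    -- The curve may run through a point of `P`, but only where the coefficient is zero and the term
    -- is absent.
    by_cases hcp : c p = 0
    · simp only [hcp, zero_mul]
      exact hγ.curveIntegrable fun t => continuousAt_const
    · refine hγ.curveIntegrable fun t => ?_
      have : γ t ≠ p := fun h => hcp (by rw [← h]; exact hγP t (h ▸ hp))
      exact continuousAt_const.mul
        ((continuousAt_id.sub continuousAt_const).inv₀ (sub_ne_zero.2 this))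
  obtain ⟨hQint, hQsum⟩ := curveIntegrable_oneForm_sum hQi
  have hKint : CurveIntegrable (oneForm K) γ :=
    hγ.curveIntegrable fun t => (hKa _ (hγr t).1 (hγr t).2).continuousAt
  have hcongr : ∃ N : Set ℂ, N.Countable ∧ ∀ t, γ t ∉ N → F (γ t) = K (γ t) + Q (γ t) := by
    refine ⟨{z | ¬ H z = K z} ∩ {z | r < ‖z‖ ∧ ‖z‖ < R}, ?_, ?_⟩
    · refine countable_of_eventually_notMem fun z hz => ?_
      filter_upwards [(hHs z hz.1 hz.2).eventually_eq_regularize] with y hy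
      exact fun h => h hy
    · intro t ht
      by_contra hne
      refine ht ⟨fun h => hne ?_, hγr t⟩
      rw [← h, hH]; ring
  have hcircle : (∮ z in C(0, ρ), F z) = ∮ z in C(0, ρ), K z := by
    -- All points of `P` lie outside the circle.
    have hQρ : (∮ z in C(0, ρ), Q z) = 0 := by
      refine Complex.circleIntegral_eq_zero_of_differentiable_on_off_countable hρ0.le
        (s := ∅) countable_empty ?_ ?_
      · intro z hz
        refine tendsto_finsetSum _ fun p hp => ?_
        have : z - p ≠ 0 := fun h => by
          rw [mem_closedBall_zero_iff] at hz
          rw [sub_eq_zero.1 h] at hz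
          exact absurd (hP p hp) (not_lt.2 hz)
        have hc : ContinuousWithinAt (fun z => c p * (z - p)⁻¹) (Metric.closedBall 0 ρ) z :=
          (continuousAt_const.mul
            ((continuousAt_id.sub continuousAt_const).inv₀ this)).continuousWithinAt
        exact hc
      · rintro z ⟨hz, -⟩
        refine DifferentiableAt.fun_sum fun p hp => ?_
        have : z - p ≠ 0 := fun h => by
          rw [mem_ball_zero_iff] at hz
          rw [sub_eq_zero.1 h] at hz
          exact absurd (hP p hp) (not_lt.2 hz.le)
        exact (differentiableAt_const _).mul ((differentiableAt_id.sub_const p).inv this)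
    have hQcont : ∀ z : ℂ, ‖z‖ = ρ → AnalyticAt ℂ Q z := by
      intro z hz
      refine Finset.analyticAt_fun_sum _ fun p hp => ?_
      have : z - p ≠ 0 := fun h => by
        have := hP p hp
        rw [← sub_eq_zero.1 h, hz] at this
        exact lt_irrefl _ this
      exact analyticAt_const.mul ((analyticAt_id.sub analyticAt_const).inv this)
    have hHK : ∀ z : ℂ, ‖z‖ = ρ → K z = F z - Q z := fun z hz =>
      regularize_eq ((hFρ z hz).sub (hQcont z hz)).continuousAt
        (Eventually.of_forall fun _ => rfl)
    have hci : ∀ {f : ℂ → ℂ}, (∀ z : ℂ, ‖z‖ = ρ → AnalyticAt ℂ f z) →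
        CircleIntegrable f 0 ρ := fun {f} hf =>
      ContinuousOn.circleIntegrable hρ0.le fun z hz =>
        (hf z (by simpa using hz)).continuousAt.continuousWithinAt
    rw [circleIntegral.integral_congr hρ0.le (g := fun z => F z - Q z)
      (fun z hz => hHK z (by simpa using hz)),
      circleIntegral.integral_sub (hci hFρ) (hci hQcont), hQρ, sub_zero]
  refine ⟨(curveIntegrable_congr (F' := fun z => K z + Q z) hcongr).2 (curveIntegrable_oneForm_add hKint hQint), ?_⟩
  rw [lineIntegral, curveIntegral_congr (F' := fun z => K z + Q z) hcongr, curveIntegral_oneForm_add hKint hQint, hQsum,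
    hcircle, ← curveIntegral_eq_circleIntegral hr hρ hρR hKa hγ hγr hw, mul_add, add_comm,
    Finset.mul_sum]
  congr 1
  refine Finset.sum_congr rfl fun p _ => ?_
  rw [curveIntegral_oneForm_const_mul, winding, lineIntegral]
  ring

/-! ### Construction of closed curves with prescribed winding numbers. -/

theorem PiecewiseC1.of_contDiff {a b : ℂ} {γ : Path a b} {f : ℝ → ℂ} (hf : ContDiff ℝ 1 f)
    (h : ∀ (t : ℝ) (ht : t ∈ Icc (0 : ℝ) 1), γ ⟨t, ht⟩ = f t) : PiecewiseC1 γ := by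
  have hd : Continuous (deriv f) := hf.continuous_deriv le_rfl
  obtain ⟨M, hM⟩ := isCompact_Icc.exists_bound_of_continuousOn (s := Icc (0 : ℝ) 1) hd.continuousOn
  refine ⟨∅, M, fun t ht _ => ?_⟩
  have he : γ.extend =ᶠ[𝓝 t] f := by
    filter_upwards [Icc_mem_nhds ht.1 ht.2] with x hx
    rw [← h x hx, Path.extend_apply γ hx]
  exact ⟨hf.contDiffAt.congr_of_eventuallyEq he, he.deriv_eq ▸ hM t (Ioo_subset_Icc_self ht)⟩

theorem PiecewiseC1.segment (a b : ℂ) : PiecewiseC1 (Path.segment a b) :=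
  .of_contDiff (f := fun t => a + t * (b - a)) (by
    have : ContDiff ℝ 1 (fun t : ℝ => (t : ℂ)) := Complex.ofRealCLM.contDiff
    fun_prop) fun t ht => by
    simp [AffineMap.lineMap_apply, add_comm]

theorem PiecewiseC1.symm {a b : ℂ} {γ : Path a b} (h : PiecewiseC1 γ) : PiecewiseC1 γ.symm := by
  classical
  obtain ⟨s, M, hs⟩ := h
  refine ⟨s.image (fun t => 1 - t), M, fun t ht hts => ?_⟩
  have h1 := hs (1 - t) ⟨by linarith [ht.2], by linarith [ht.1]⟩ fun h =>
    hts (Finset.mem_image.2 ⟨1 - t, h, by ring⟩)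
  rw [Path.extend_symm]
  refine ⟨ContDiffAt.comp t h1.1 (by fun_prop), ?_⟩
  have := deriv_comp_const_sub (f := γ.extend) 1 t
  rw [this, norm_neg]
  exact h1.2

theorem PiecewiseC1.trans {a b c : ℂ} {γ : Path a b} {δ : Path b c} (h : PiecewiseC1 γ)
    (h' : PiecewiseC1 δ) : PiecewiseC1 (γ.trans δ) := by
  classical
  obtain ⟨s, M, hs⟩ := h
  obtain ⟨s', M', hs'⟩ := h'
  refine ⟨s.image (fun t => t / 2) ∪ s'.image (fun t => (t + 1) / 2) ∪ {1 / 2},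
    2 * max M M', fun t ht hts => ?_⟩
  simp only [Finset.mem_union, Finset.mem_image, Finset.mem_singleton, not_or, not_exists,
    not_and] at hts
  rcases lt_or_gt_of_ne hts.2 with hlt | hgt
  · have h1 := hs (2 * t) ⟨by linarith [ht.1], by linarith⟩ fun h => hts.1.1 _ h (by ring)
    have he : (γ.trans δ).extend =ᶠ[𝓝 t] fun x => γ.extend (2 * x) :=
      (eventually_le_nhds hlt).mono fun x hx => Path.extend_trans_of_le_half _ _ hx
    refine ⟨ContDiffAt.congr_of_eventuallyEq
      (ContDiffAt.comp (f := fun x => 2 * x) t h1.1 (by fun_prop)) he, ?_⟩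
    rw [he.deriv_eq]
    have := deriv_comp_mul_left (2 : ℝ) γ.extend t
    rw [this, norm_smul]
    norm_num
    exact Or.inl h1.2
  · have h1 := hs' (2 * t - 1) ⟨by linarith, by linarith [ht.2]⟩ fun h => hts.1.2 _ h (by ring)
    have he : (γ.trans δ).extend =ᶠ[𝓝 t] fun x => δ.extend (2 * x - 1) :=
      (eventually_ge_nhds hgt).mono fun x hx => Path.extend_trans_of_half_le _ _ hx
    refine ⟨ContDiffAt.congr_of_eventuallyEq
      (ContDiffAt.comp (f := fun x => 2 * x - 1) t h1.1 (by fun_prop)) he, ?_⟩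
    rw [he.deriv_eq]
    have := deriv_comp_mul_left (2 : ℝ) (fun x => δ.extend (x - 1)) t
    rw [this, norm_smul, deriv_comp_sub_const]
    norm_num
    exact Or.inr h1.2

/-- The positively oriented circle as a path. -/
def circlePath (c : ℂ) (ρ : ℝ) : Path (c + ρ) (c + ρ) where
  toFun t := circleMap c ρ (2 * Real.pi * t)
  continuous_toFun := by fun_prop
  source' := by simp [circleMap]
  target' := by simp [circleMap]

theorem circlePath_piecewiseC1 (c : ℂ) (ρ : ℝ) : PiecewiseC1 (circlePath c ρ) :=
  .of_contDiff (f := fun t => circleMap c ρ (2 * Real.pi * t))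
    ((contDiff_circleMap c ρ).comp (by fun_prop)) fun _ _ => rfl

theorem norm_circlePath_sub (c : ℂ) {ρ : ℝ} (hρ : 0 ≤ ρ) (t) : ‖circlePath c ρ t - c‖ = ρ := by
  simp [circlePath, abs_of_nonneg hρ]

theorem curveIntegral_circlePath (F : ℂ → ℂ) (c : ℂ) (ρ : ℝ) :
    curveIntegral (oneForm F) (circlePath c ρ) = ∮ z in C(c, ρ), F z := by
  rw [curveIntegral_oneForm, circleIntegral]
  have h := intervalIntegral.smul_integral_comp_mul_left (a := 0) (b := 1)
    (fun θ => deriv (circleMap c ρ) θ • F (circleMap c ρ θ)) (2 * Real.pi)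
  rw [mul_zero, mul_one] at h
  rw [← h, ← intervalIntegral.integral_smul]
  refine intervalIntegral.integral_congr_ae_restrict ?_
  rw [uIoc_of_le zero_le_one, ← restrict_Ioo_eq_restrict_Ioc]
  filter_upwards [ae_restrict_mem measurableSet_Ioo] with t ht
  have he : (circlePath c ρ).extend =ᶠ[𝓝 t] fun t => circleMap c ρ (2 * Real.pi * t) := by
    filter_upwards [Icc_mem_nhds ht.1 ht.2] with x hx
    rw [Path.extend_apply _ hx]; rfl
  rw [he.deriv_eq, he.self_of_nhds]
  have := deriv_comp_mul_left (2 * Real.pi) (circleMap c ρ) t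
  rw [this, smul_eq_mul, Complex.real_smul, Complex.real_smul]
  ring

theorem winding_circlePath_of_lt {c w : ℂ} {ρ : ℝ} (h : ‖w - c‖ < ρ) :
    winding (circlePath c ρ) w = 1 := by
  rw [winding, lineIntegral, curveIntegral_circlePath,
    circleIntegral.integral_sub_inv_of_mem_ball (by simpa [dist_eq_norm] using h)]
  exact inv_mul_cancel₀ Complex.two_pi_I_ne_zero

theorem winding_circlePath_of_gt {c w : ℂ} {ρ : ℝ} (hρ : 0 ≤ ρ) (h : ρ < ‖w - c‖) :
    winding (circlePath c ρ) w = 0 := by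
  rw [winding, lineIntegral, curveIntegral_circlePath]
  have hne : ∀ z ∈ Metric.closedBall c ρ, z - w ≠ 0 := fun z hz h' => by
    rw [sub_eq_zero.1 h', mem_closedBall_iff_norm] at hz
    exact absurd h (not_lt.2 hz)
  rw [Complex.circleIntegral_eq_zero_of_differentiable_on_off_countable hρ (s := ∅)
    countable_empty ?_ ?_, mul_zero]
  · intro z hz
    exact ((continuousAt_id.sub continuousAt_const).inv₀ (hne z hz)).continuousWithinAt
  · rintro z ⟨hz, -⟩
    exact (differentiableAt_id.sub_const w).inv (hne z (Metric.ball_subset_closedBall hz))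

theorem curveIntegrable_inv_sub {a b : ℂ} {γ : Path a b} (hγ : PiecewiseC1 γ) {w : ℂ}
    (hw : ∀ t, γ t ≠ w) : CurveIntegrable (oneForm fun z => (z - w)⁻¹) γ :=
  hγ.curveIntegrable fun t => (continuousAt_id.sub continuousAt_const).inv₀ (sub_ne_zero.2 (hw t))

/-- Two points off a countable set are joined by two segments off this set. -/
theorem exists_segments_compl {S : Set ℂ} (hS : S.Countable) {a b : ℂ} (ha : a ∉ S)
    (hb : b ∉ S) : ∃ γ : Path a b, PiecewiseC1 γ ∧ ∀ t, γ t ∉ S := by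
  rcases eq_or_ne a b with rfl | hab
  · exact ⟨Path.refl a, .of_contDiff (f := fun _ => a) contDiff_const fun _ _ => rfl, fun _ => ha⟩
  have h : 1 < Module.rank ℝ ℂ := by rw [Complex.rank_real_complex]; norm_num
  let c := (2 : ℝ)⁻¹ • (a + b)
  let x := (2 : ℝ)⁻¹ • (b - a)
  have Ia : c - x = a := by
    simp only [c, x]
    module
  have Ib : c + x = b := by
    simp only [c, x]
    module
  have x_ne_zero : x ≠ 0 := by simpa [x] using sub_ne_zero.2 hab.symm
  obtain ⟨y, hy⟩ : ∃ y, LinearIndependent ℝ ![x, y] :=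
    exists_linearIndependent_pair_of_one_lt_rank h x_ne_zero
  -- Segments from one endpoint to distinct points `c + t • y` meet only in that endpoint, which is
  -- off `S`. Hence only countably many `t` give a segment that meets `S`, and some `t` works for
  -- both ends.
  have key : ∀ x' : ℂ, c + x' ∉ S → LinearIndependent ℝ ![x', y] →
      Set.Countable {t : ℝ | (segment ℝ (c + x') (c + t • y) ∩ S).Nonempty} := by
    intro x' hx' hy'
    apply countable_ofPred_nonempty_of_disjoint _ (fun t ↦ inter_subset_right) hS
    intro t t' htt'
    apply disjoint_iff_inter_eq_empty.2
    have N : {c + x'} ∩ S = ∅ := by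
      simpa only [singleton_inter_eq_empty] using hx'
    rw [inter_assoc, inter_comm S, inter_assoc, inter_self, ← inter_assoc, ← subset_empty_iff, ← N]
    apply inter_subset_inter_left
    apply Eq.subset
    exact segment_inter_eq_endpoint_of_linearIndependent_of_ne hy' htt'.symm _
  have A := key x (by rwa [Ib]) hy
  have B := key (-x) (by rwa [← sub_eq_add_neg, Ia]) (by
    convert! hy.units_smul ![-1, 1]
    simp [← List.ofFn_inj])
  obtain ⟨t, ht⟩ := ((A.union B).dense_compl ℝ).nonempty
  simp only [compl_union, mem_inter_iff, mem_compl_iff, mem_ofPred_eq, not_nonempty_iff_eq_empty]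
    at ht
  rw [Ib, ← sub_eq_add_neg, Ia, segment_symm ℝ b] at ht
  refine ⟨(Path.segment a (c + t • y)).trans (Path.segment (c + t • y) b),
    (PiecewiseC1.segment _ _).trans (.segment _ _), fun s hs => ?_⟩
  have hr := mem_range_self (f := (Path.segment a (c + t • y)).trans
    (Path.segment (c + t • y) b)) s
  rw [Path.trans_range, Path.range_segment, Path.range_segment] at hr
  rcases hr with hr | hr
  · exact (ht.2.subset ⟨hr, hs⟩ : _ ∈ (∅ : Set ℂ))
  · exact (ht.1.subset ⟨hr, hs⟩ : _ ∈ (∅ : Set ℂ))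

theorem trans_notMem {a b c : ℂ} {γ : Path a b} {δ : Path b c} {S : Set ℂ} (h : ∀ t, γ t ∉ S)
    (h' : ∀ t, δ t ∉ S) (t) : (γ.trans δ) t ∉ S := by
  intro ht
  have hr := mem_range_self (f := γ.trans δ) t
  rw [Path.trans_range] at hr
  rcases hr with ⟨x, hx⟩ | ⟨x, hx⟩
  · exact h x (hx ▸ ht)
  · exact h' x (hx ▸ ht)

/-- The winding number of a closed curve around a single isolated point can be changed by one. -/
theorem exists_winding_add {S : Set ℂ} (hS : S.Countable) {z₀ : ℂ} {γ : Path z₀ z₀}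
    (hγ : PiecewiseC1 γ) (hγS : ∀ t, γ t ∉ S) {p : ℂ} (hpS : p ∈ S) {ε : ℝ} (hε : 0 < ε)
    (hp : ∀ w ∈ S, w ≠ p → ε < ‖w - p‖) {σ : ℂ} (hσ : σ = 1 ∨ σ = -1) :
    ∃ γ' : Path z₀ z₀, PiecewiseC1 γ' ∧ (∀ t, γ' t ∉ S) ∧ winding γ' p = winding γ p + σ ∧
      ∀ w ∈ S, w ≠ p → winding γ' w = winding γ w := by
  have hcS : ∀ t, circlePath p ε t ∉ S := by
    intro t ht
    have h1 := norm_circlePath_sub p hε.le t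
    by_cases h2 : circlePath p ε t = p
    · rw [h2, sub_self, norm_zero] at h1
      exact hε.ne h1
    · exact absurd (hp _ ht h2) (by rw [h1]; exact lt_irrefl _)
  obtain ⟨δ, hδ, hδS, hδw⟩ : ∃ δ : Path (p + ε) (p + ε), PiecewiseC1 δ ∧ (∀ t, δ t ∉ S) ∧
      ∀ w, winding δ w = σ * winding (circlePath p ε) w := by
    rcases hσ with rfl | rfl
    · exact ⟨circlePath p ε, circlePath_piecewiseC1 p ε, hcS, fun w => (one_mul _).symm⟩
    · refine ⟨(circlePath p ε).symm, (circlePath_piecewiseC1 p ε).symm, fun t => hcS _, ?_⟩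
      intro w
      simp [winding, lineIntegral]
  -- The inserted loop runs along `τ`, around the small circle and back along `τ`; the two passages
  -- of `τ` cancel in every winding number.
  obtain ⟨τ, hτ, hτS⟩ := exists_segments_compl hS (a := z₀) (b := p + ε)
    (by simpa using hγS 0) (by simpa using hδS 0)
  have hτS' : ∀ t, τ.symm t ∉ S := fun t => hτS _
  have hsum : ∀ w ∈ S, winding (γ.trans ((τ.trans δ).trans τ.symm)) w =
      winding γ w + winding δ w := by
    intro w hw
    have hi : ∀ {a b : ℂ} {η : Path a b}, PiecewiseC1 η → (∀ t, η t ∉ S) →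
        CurveIntegrable (oneForm fun z => (z - w)⁻¹) η := fun h h' =>
      curveIntegrable_inv_sub h fun t ht => h' t (ht ▸ hw)
    have h1 := hi hγ hγS
    have h2 := hi hτ hτS
    have h3 := hi hδ hδS
    have h4 := hi hτ.symm hτS'
    simp only [winding, lineIntegral]
    rw [curveIntegral_trans h1 ((h2.trans h3).trans h4), curveIntegral_trans (h2.trans h3) h4,
      curveIntegral_trans h2 h3, curveIntegral_symm]
    ring
  refine ⟨γ.trans ((τ.trans δ).trans τ.symm), hγ.trans ((hτ.trans hδ).trans hτ.symm),
    trans_notMem hγS (trans_notMem (trans_notMem hτS hδS) hτS'), ?_, ?_⟩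
  · rw [hsum p hpS, hδw, winding_circlePath_of_lt (by simpa using hε), mul_one]
  · intro w hw hwp
    rw [hsum w hw, hδw, winding_circlePath_of_gt hε.le (hp w hw hwp), mul_zero, add_zero]

/-- The sign may be chosen point by point: `1` brings a point inside the curve, `-1` expels it. -/
theorem exists_winding_add_finset {S : Set ℂ} (hS : S.Countable) {z₀ : ℂ} {γ : Path z₀ z₀}
    (hγ : PiecewiseC1 γ) (hγS : ∀ t, γ t ∉ S) {σ : ℂ → ℂ} (hσ : ∀ p, σ p = 1 ∨ σ p = -1)
    (T : Finset ℂ) (hT : ∀ p ∈ T, p ∈ S ∧ ∃ ε > 0, ∀ w ∈ S, w ≠ p → ε < ‖w - p‖) :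
    ∃ γ' : Path z₀ z₀, PiecewiseC1 γ' ∧ (∀ t, γ' t ∉ S) ∧
      ∀ w ∈ S, winding γ' w = winding γ w + if w ∈ T then σ w else 0 := by
  classical
  induction T using Finset.induction_on with
  | empty => exact ⟨γ, hγ, hγS, by simp⟩
  | insert p T hpT ih =>
    obtain ⟨γ₁, h1, h2, h3⟩ := ih fun x hx => hT x (by simp [hx])
    obtain ⟨hpS, ε, hε, hp⟩ := hT p (by simp)
    obtain ⟨γ₂, k1, k2, k3, k4⟩ := exists_winding_add hS h1 h2 hpS hε hp (hσ p)
    refine ⟨γ₂, k1, k2, fun w hw => ?_⟩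
    by_cases hwp : w = p
    · subst hwp
      rw [k3, h3 w hw]
      simp [hpT]
    · rw [k4 w hw hwp, h3 w hw]
      simp [hwp]

/-! ### Infinite `q`-shifted factorials and theta functions. -/

section QFunctions

variable {q : ℂ}

theorem summable_norm_mul_pow (hq1 : ‖q‖ < 1) (a : ℂ) : Summable fun i : ℕ => ‖-(a * q ^ i)‖ := by
  simpa using (summable_geometric_of_lt_one (norm_nonneg _) hq1).mul_left ‖a‖

theorem multipliable_qInf (hq1 : ‖q‖ < 1) (a : ℂ) : Multipliable fun i : ℕ => 1 - a * q ^ i := by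
  simpa [sub_eq_add_neg] using multipliable_one_add_of_summable (summable_norm_mul_pow hq1 a)

theorem prod_mul_qInf (hq1 : ‖q‖ < 1) (a : ℂ) (n : ℕ) :
    (∏ i ∈ Finset.range n, (1 - a * q ^ i)) * qInf q (a * q ^ n) = qInf q a := by
  have h : (fun i : ℕ => 1 - a * q ^ n * q ^ i) = fun i => 1 - a * q ^ (i + n) := by
    funext i; rw [pow_add]; ring
  have := Multipliable.prod_mul_tprod_nat_mul' (f := fun i : ℕ => 1 - a * q ^ i) (k := n)
    (h ▸ multipliable_qInf hq1 (a * q ^ n))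
  rw [qInf, h]
  exact this

theorem qInf_eq (hq1 : ‖q‖ < 1) (a : ℂ) : qInf q a = (1 - a) * qInf q (q * a) := by
  simpa [mul_comm] using (prod_mul_qInf hq1 a 1).symm

theorem tendsto_prod_qInf (hq1 : ‖q‖ < 1) (a : ℂ) :
    Tendsto (fun n => ∏ i ∈ Finset.range n, (1 - a * q ^ i)) atTop (𝓝 (qInf q a)) :=
  (multipliable_qInf hq1 a).tendsto_prod_tprod_nat

theorem differentiable_qInf (hq1 : ‖q‖ < 1) : Differentiable ℂ (qInf q) := by
  intro a
  have hK : IsOpen (Metric.ball (0 : ℂ) (‖a‖ + 1)) := Metric.isOpen_ball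
  have hu : Summable fun i : ℕ => (‖a‖ + 1) * ‖q‖ ^ i :=
    (summable_geometric_of_lt_one (norm_nonneg _) hq1).mul_left _
  have h := hu.hasProdLocallyUniformlyOn_nat_one_add (f := fun i x => -(x * q ^ i)) hK
    (Eventually.of_forall fun n x hx => by
      rw [mem_ball_zero_iff] at hx
      rw [norm_neg, norm_mul, norm_pow]
      gcongr) (fun i => by fun_prop)
  have hd := h.differentiableOn (.of_forall fun _ ↦ by
    simpa [Finset.prod_fn] using DifferentiableOn.finsetProd (fun _ _ ↦ by fun_prop)) hK
  have he : qInf q = fun x => ∏' i : ℕ, (1 + -(x * q ^ i)) := by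
    funext x; simp [qInf, sub_eq_add_neg]
  rw [he]
  exact hd.differentiableAt (hK.mem_nhds (by simp))

theorem analyticAt_qInf (hq1 : ‖q‖ < 1) (a : ℂ) : AnalyticAt ℂ (qInf q) a :=
  (differentiable_qInf hq1).analyticAt a

theorem qInf_ne_zero (hq1 : ‖q‖ < 1) {a : ℂ} (h : ∀ n : ℕ, a * q ^ n ≠ 1) : qInf q a ≠ 0 := by
  have := tprod_one_add_ne_zero_of_summable (f := fun i : ℕ => -(a * q ^ i))
    (fun i => by rw [← sub_eq_add_neg]; exact sub_ne_zero.2 (h i).symm)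
    (summable_norm_mul_pow hq1 a)
  simpa [qInf, sub_eq_add_neg] using this

theorem qInf_eq_zero (hq1 : ‖q‖ < 1) {a : ℂ} {n : ℕ} (h : a * q ^ n = 1) : qInf q a = 0 := by
  rw [← prod_mul_qInf hq1 a (n + 1), Finset.prod_range_succ, h]
  simp

theorem qInf_q_ne_zero (hq1 : ‖q‖ < 1) : qInf q q ≠ 0 := by
  refine qInf_ne_zero hq1 fun n h => ?_
  have h1 : ‖q‖ ^ (n + 1) = 1 := by rw [← norm_pow, pow_succ', h, norm_one]
  exact (pow_lt_one₀ (norm_nonneg q) hq1 n.succ_ne_zero).ne h1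

theorem zpow_injective (hq0 : q ≠ 0) (hq1 : ‖q‖ < 1) : Function.Injective fun n : ℤ => q ^ n := by
  intro m n h
  have h1 : ‖q‖ ^ m = ‖q‖ ^ n := by rw [← norm_zpow, ← norm_zpow]; exact congrArg _ h
  exact (zpow_right_injective₀ (norm_pos_iff.2 hq0) hq1.ne) h1

/-- Only the factor `1 - x q^n` vanishes at `a`, so the derivative is its derivative times the other
factors, and the tail `(a q^(n+1))_∞` is `(q)_∞` because `a q^n = 1`. -/
theorem hasDerivAt_qInf (hq1 : ‖q‖ < 1) {a : ℂ} {n : ℕ} (h : a * q ^ n = 1) :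
    HasDerivAt (qInf q) (-q ^ n * ((∏ i ∈ Finset.range n, (1 - a * q ^ i)) * qInf q q)) a := by
  have he : qInf q = fun x => (1 - x * q ^ n) *
      ((∏ i ∈ Finset.range n, (1 - x * q ^ i)) * qInf q (x * q ^ (n + 1))) := by
    funext x
    rw [← prod_mul_qInf hq1 x (n + 1), Finset.prod_range_succ]
    ring
  have h1 : HasDerivAt (fun x : ℂ => 1 - x * q ^ n) (-q ^ n) a := by
    simpa using ((hasDerivAt_id a).mul_const (q ^ n)).const_sub 1
  have h2 : DifferentiableAt ℂ (fun x => (∏ i ∈ Finset.range n, (1 - x * q ^ i)) *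
      qInf q (x * q ^ (n + 1))) a := by
    refine DifferentiableAt.mul (by fun_prop) ?_
    exact (differentiable_qInf hq1 _).comp a (by fun_prop)
  have h3 := h1.mul h2.hasDerivAt
  have h4 : a * q ^ (n + 1) = q := by rw [pow_succ, ← mul_assoc, h, one_mul]
  have h5 := h3.congr_of_eventuallyEq (Eventually.of_forall fun x => congrFun he x)
  refine h5.congr_deriv ?_
  rw [h4, h, sub_self, zero_mul, add_zero]

/-- The reciprocal of an infinite `q`-shifted factorial has simple poles. -/
theorem HasSimplePole.inv_qInf (hq0 : q ≠ 0) (hq1 : ‖q‖ < 1) {f : ℂ → ℂ} {p f' : ℂ}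
    (hf : AnalyticAt ℂ f p) (hf' : HasDerivAt f f' p) (h0 : f' ≠ 0) {n : ℕ}
    (hp : f p * q ^ n = 1) :
    HasSimplePole (fun z => (qInf q (f z))⁻¹) p
      (-q ^ n * ((∏ i ∈ Finset.range n, (1 - f p * q ^ i)) * qInf q q) * f')⁻¹ := by
  refine HasSimplePole.inv_of_simple_zero ((analyticAt_qInf hq1 _).comp hf)
    (qInf_eq_zero hq1 hp) ((hasDerivAt_qInf hq1 hp).comp p hf') ?_
  refine mul_ne_zero (mul_ne_zero (neg_ne_zero.2 (pow_ne_zero _ hq0))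
    (mul_ne_zero (Finset.prod_ne_zero_iff.2 fun i hi => ?_) (qInf_q_ne_zero hq1))) h0
  intro h
  have h1 : q ^ ((i : ℤ)) = q ^ (n : ℤ) := by
    rw [zpow_natCast, zpow_natCast]
    have hfp : f p ≠ 0 := fun h' => by simp [h'] at hp
    exact mul_left_cancel₀ hfp ((sub_eq_zero.1 h).symm.trans hp.symm)
  have := zpow_injective hq0 hq1 h1
  rw [Finset.mem_range] at hi
  omega

/-- This turns multiplication by a spanning function into a shift of parameters in the weight. For
negative `k` the nonvanishing of the denominator also excludes zero factors in the inverted product.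
-/
theorem qFactorial_eq_div (hq0 : q ≠ 0) (hq1 : ‖q‖ < 1) {a : ℂ} {k : ℤ}
    (h : qInf q (a * q ^ k) ≠ 0) : qFactorial q a k = qInf q a / qInf q (a * q ^ k) := by
  rcases k with n | n
  · simp only [Int.ofNat_eq_natCast, zpow_natCast] at h ⊢
    rw [eq_div_iff h]
    exact prod_mul_qInf hq1 a n
  · rw [qFactorial]
    have h1 := prod_mul_qInf hq1 (a * q ^ (Int.negSucc n)) (n + 1)
    have h2 : a * q ^ (Int.negSucc n) * q ^ (n + 1) = a := by
      rw [zpow_negSucc, mul_assoc, inv_mul_cancel₀ (pow_ne_zero _ hq0), mul_one]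
    rw [h2] at h1
    have h3 : ∏ i ∈ Finset.range (n + 1), (1 - a * q ^ (Int.negSucc n) * q ^ i) =
        ∏ i ∈ Finset.range (n + 1), (1 - a * q⁻¹ ^ (i + 1)) := by
      rw [← Finset.prod_range_reflect]
      refine Finset.prod_congr rfl fun i hi => ?_
      rw [Finset.mem_range] at hi
      have : q ^ (Int.negSucc n) * q ^ (n + 1 - 1 - i) = q⁻¹ ^ (i + 1) := by
        rw [zpow_negSucc, inv_pow, inv_mul_eq_iff_eq_mul₀ (pow_ne_zero _ hq0),
          eq_mul_inv_iff_mul_eq₀ (pow_ne_zero _ hq0), ← pow_add]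
        congr 1
        omega
      rw [mul_assoc, this]
    rw [h3] at h1
    rw [← h1] at h ⊢
    rw [eq_div_iff h, inv_mul_cancel_left₀ (left_ne_zero_of_mul h)]

/-! ### Theta functions -/

theorem theta_mul_q (hq0 : q ≠ 0) (hq1 : ‖q‖ < 1) {x : ℂ} (hx : x ≠ 0) :
    theta q (q * x) = -x⁻¹ * theta q x := by
  have h1 : q / (q * x) = x⁻¹ := by field_simp
  rw [theta, theta, h1, qInf_eq hq1 x⁻¹, qInf_eq hq1 x, div_eq_mul_inv]
  field_simp
  ring

theorem theta_div_left (hq0 : q ≠ 0) (x : ℂ) : theta q (q / x) = theta q x := by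
  rw [theta, theta, div_div_cancel₀ hq0, mul_comm]

theorem theta_inv (hq0 : q ≠ 0) (hq1 : ‖q‖ < 1) {x : ℂ} (hx : x ≠ 0) :
    theta q x⁻¹ = -x⁻¹ * theta q x := by
  rw [← theta_mul_q hq0 hq1 hx, ← theta_div_left hq0 x⁻¹, div_inv_eq_mul]

theorem two_mul_binomTwo (n : ℤ) : 2 * binomTwo n = n * (n - 1) := by
  rw [binomTwo, Int.mul_ediv_cancel']
  rw [← even_iff_two_dvd]
  exact Int.even_mul_pred_self n

theorem binomTwo_add_one (n : ℤ) : binomTwo (n + 1) = binomTwo n + n := by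
  have h1 := two_mul_binomTwo n
  have h2 := two_mul_binomTwo (n + 1)
  have h3 : (n + 1) * (n + 1 - 1) = n * (n - 1) + 2 * n := by ring
  rw [h3] at h2
  omega

theorem theta_zpow_mul (hq0 : q ≠ 0) (hq1 : ‖q‖ < 1) (n : ℤ) {x : ℂ} (hx : x ≠ 0) :
    theta q (q ^ n * x) = (-x) ^ (-n) * q ^ (-binomTwo n) * theta q x := by
  have step : ∀ n : ℤ, theta q (q ^ (n + 1) * x) = -(q ^ n * x)⁻¹ * theta q (q ^ n * x) := by
    intro n
    rw [zpow_add₀ hq0, zpow_one, mul_comm (q ^ n), mul_assoc]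
    exact theta_mul_q hq0 hq1 (mul_ne_zero (zpow_ne_zero _ hq0) hx)
  have hx' : -x ≠ 0 := neg_ne_zero.2 hx
  have hfac : ∀ n : ℤ, (-x) ^ (-(n + 1)) * q ^ (-binomTwo (n + 1)) =
      -(q ^ n * x)⁻¹ * ((-x) ^ (-n) * q ^ (-binomTwo n)) := by
    intro n
    rw [binomTwo_add_one, neg_add, neg_add, zpow_add₀ hx', zpow_add₀ hq0, zpow_neg_one,
      zpow_neg q n, mul_inv, inv_neg]
    ring
  induction n using Int.induction_on with
  | zero => simp [binomTwo]
  | succ n ih => rw [step, ih, hfac]; ring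
  | pred n ih =>
    have h1 := step (-(n : ℤ) - 1)
    have h2 := hfac (-(n : ℤ) - 1)
    rw [sub_add_cancel] at h1 h2
    rw [ih, h2] at h1
    have h3 : -(q ^ (-(n : ℤ) - 1) * x)⁻¹ ≠ 0 :=
      neg_ne_zero.2 (inv_ne_zero (mul_ne_zero (zpow_ne_zero _ hq0) hx))
    rw [mul_assoc] at h1
    exact (mul_left_cancel₀ h3 h1).symm

theorem theta_zpow (hq0 : q ≠ 0) (hq1 : ‖q‖ < 1) (n : ℤ) : theta q (q ^ n) = 0 := by
  have h := theta_zpow_mul hq0 hq1 n one_ne_zero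
  rw [mul_one] at h
  rw [h, theta, qInf_eq hq1 1]
  simp

theorem theta_ne_zero (hq0 : q ≠ 0) (hq1 : ‖q‖ < 1) {x : ℂ} (h : ∀ n : ℤ, x ≠ q ^ n) :
    theta q x ≠ 0 := by
  refine mul_ne_zero (qInf_ne_zero hq1 fun n hn => ?_) (qInf_ne_zero hq1 fun n hn => ?_)
  · refine h (-n) ?_
    rw [zpow_neg, zpow_natCast]
    exact eq_inv_of_mul_eq_one_left hn
  · by_cases hx : x = 0
    · simp [hx] at hn
    refine h (n + 1) ?_
    rw [zpow_add₀ hq0, zpow_natCast, zpow_one]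
    field_simp at hn
    rw [← hn, mul_comm]

theorem analyticAt_theta (hq1 : ‖q‖ < 1) {x : ℂ} (hx : x ≠ 0) : AnalyticAt ℂ (theta q) x :=
  (analyticAt_qInf hq1 x).mul
    ((analyticAt_qInf hq1 _).comp (analyticAt_const.div analyticAt_id hx))

/-- The reciprocal of a theta function has at most simple poles. -/
theorem HasSimplePole.inv_theta (hq0 : q ≠ 0) (hq1 : ‖q‖ < 1) {s p : ℂ} (hs : s ≠ 0)
    (hp : p ≠ 0) : ∃ c, HasSimplePole (fun z => (theta q (z / s))⁻¹) p c := by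
  have ha1 : AnalyticAt ℂ (fun z => z / s) p := by fun_prop
  have ha2 : AnalyticAt ℂ (fun z => q / (z / s)) p := analyticAt_const.div ha1 (div_ne_zero hp hs)
  have hps : p / s ≠ 0 := div_ne_zero hp hs
  have hd1 : HasDerivAt (fun z => z / s) (1 / s) p := (hasDerivAt_id p).div_const s
  have hd2 : HasDerivAt (fun z => q / (z / s)) (-(q * (1 / s)) / (p / s) ^ 2) p := by
    have h := (hasDerivAt_const p q).div hd1 hps
    rw [zero_mul, zero_sub] at h
    exact h
  -- The two factors of `θ` vanish at `q^(-n)` and at `q^(n+1)` respectively, with `n ≥ 0`. They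
  -- have no common zero, so every zero of `θ` is simple.
  by_cases h : ∃ n : ℕ, p / s * q ^ n = 1
  · obtain ⟨n, hn⟩ := h
    have h1 := HasSimplePole.inv_qInf hq0 hq1 ha1 hd1 (one_div_ne_zero hs) hn
    have h2 : qInf q (q / (p / s)) ≠ 0 := by
      refine qInf_ne_zero hq1 fun m hm => ?_
      have h3 : q ^ ((m + 1 + n : ℕ) : ℤ) = q ^ (0 : ℤ) := by
        have : q ^ (m + 1 + n) = (q / (p / s) * q ^ m) * (p / s * q ^ n) := by
          field_simp
          ring
        rw [zpow_natCast, zpow_zero, this, hm, hn, one_mul]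
      have := zpow_injective hq0 hq1 h3
      omega
    refine ⟨_, (h1.mul_analyticAt (((analyticAt_qInf hq1 _).comp ha2).inv h2)).congr ?_⟩
    exact Eventually.of_forall fun z => by simp [theta, mul_comm]
  · push Not at h
    have h1 : qInf q (p / s) ≠ 0 := qInf_ne_zero hq1 h
    have ha : AnalyticAt ℂ (fun z => (qInf q (z / s))⁻¹) p :=
      ((analyticAt_qInf hq1 _).comp ha1).inv h1
    by_cases h' : ∃ n : ℕ, q / (p / s) * q ^ n = 1
    · obtain ⟨n, hn⟩ := h'
      have h2 := HasSimplePole.inv_qInf hq0 hq1 ha2 hd2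
        (div_ne_zero (neg_ne_zero.2 (mul_ne_zero hq0 (one_div_ne_zero hs))) (pow_ne_zero _ hps)) hn
      refine ⟨_, (h2.mul_analyticAt ha).congr ?_⟩
      exact Eventually.of_forall fun z => by simp [theta, mul_comm]
    · push Not at h'
      refine ⟨0, HasSimplePole.of_analyticAt ?_⟩
      refine AnalyticAt.inv (AnalyticAt.mul ((analyticAt_qInf hq1 _).comp ha1)
        ((analyticAt_qInf hq1 _).comp ha2)) ?_
      exact mul_ne_zero h1 (qInf_ne_zero hq1 h')

end QFunctions

/-! ### Vanishing of theta functions of negative degree or with too many zeros. -/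

section Vanishing

variable {q : ℂ}

/-- Continuous functions on the punctured plane that agree off a countable set are equal. -/
theorem eq_of_eq_off_countable {f g : ℂ → ℂ} {N : Set ℂ} (hN : N.Countable)
    (hf : ∀ s ≠ 0, ContinuousAt f s) (hg : ∀ s ≠ 0, ContinuousAt g s)
    (h : ∀ s ≠ 0, s ∉ N → f s = g s) : ∀ s ≠ 0, f s = g s := by
  intro s hs
  by_contra hne
  have h1 : ∀ᶠ y in 𝓝 s, f y - g y ≠ 0 :=
    ((hf s hs).sub (hg s hs)).eventually_ne (sub_ne_zero.2 hne)
  have h2 : ∀ᶠ y in 𝓝 s, y ≠ 0 := isOpen_ne.mem_nhds hs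
  have hd : Dense Nᶜ := hN.dense_compl ℝ
  obtain ⟨y, hy1, hy2, hy3⟩ := hd.inter_nhds_nonempty (h1.and h2)
  exact hy2 (sub_eq_zero.2 (h y hy3 hy1))

/-- A continuous function on the punctured plane that decreases under `z ↦ q z` near the origin
is bounded near the origin. -/
theorem exists_bound_of_contracting (hq0 : q ≠ 0) (hq1 : ‖q‖ < 1) {f : ℂ → ℝ} {r : ℝ}
    (hr : 0 < r) (hf : ∀ z : ℂ, z ≠ 0 → ‖z‖ ≤ r → ContinuousAt f z)
    (h : ∀ z : ℂ, z ≠ 0 → ‖z‖ ≤ r → f (q * z) ≤ f z) :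
    ∃ C, ∀ z : ℂ, z ≠ 0 → ‖z‖ ≤ r → f z ≤ C := by
  have hqn : 0 < ‖q‖ := norm_pos_iff.2 hq0
  -- A compact annulus that meets every `q`-orbit near the origin; a bound on it propagates inwards.
  set K : Set ℂ := Metric.closedBall 0 r ∩ {z | ‖q‖ * r ≤ ‖z‖} with hK
  have hKc : IsCompact K := (isCompact_closedBall 0 r).inter_right
    (isClosed_le continuous_const continuous_norm)
  have hK0 : ∀ z ∈ K, z ≠ 0 ∧ ‖z‖ ≤ r := by
    rintro z ⟨h1, h2⟩
    refine ⟨fun h0 => ?_, by simpa using h1⟩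
    simp only [mem_ofPred_eq, h0, norm_zero] at h2
    exact absurd h2 (not_le.2 (mul_pos hqn hr))
  obtain ⟨C, hC⟩ := hKc.exists_bound_of_continuousOn (f := f)
    fun z hz => (hf z (hK0 z hz).1 (hK0 z hz).2).continuousWithinAt
  have hiter : ∀ (n : ℕ) (z : ℂ), z ≠ 0 → ‖z‖ ≤ r → f (q ^ n * z) ≤ f z := by
    intro n
    induction n with
    | zero => intro z _ _; simp
    | succ n ih =>
      intro z hz hzr
      rw [pow_succ', mul_assoc]
      refine (h _ (mul_ne_zero (pow_ne_zero _ hq0) hz) ?_).trans (ih z hz hzr)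
      rw [norm_mul, norm_pow]
      exact (mul_le_of_le_one_left (norm_nonneg _) (pow_le_one₀ hqn.le hq1.le)).trans hzr
  refine ⟨C, fun z hz hzr => ?_⟩
  obtain ⟨n, hn1, hn2⟩ := exists_nat_pow_near_of_lt_one (x := ‖z‖ / r)
    (div_pos (norm_pos_iff.2 hz) hr) ((div_le_one hr).2 hzr) hqn hq1
  have hqn' : 0 < ‖q‖ ^ n := pow_pos hqn n
  have hz' : (q ^ n)⁻¹ * z ∈ K := by
    refine ⟨?_, ?_⟩
    · rw [mem_closedBall_zero_iff, norm_mul, norm_inv, norm_pow, inv_mul_le_iff₀ hqn']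
      exact (div_le_iff₀ hr).1 hn2
    · rw [mem_ofPred_eq, norm_mul, norm_inv, norm_pow, le_inv_mul_iff₀ hqn', ← mul_assoc, ← pow_succ]
      exact ((lt_div_iff₀ hr).1 hn1).le
  have h1 := hiter n _ (hK0 _ hz').1 (hK0 _ hz').2
  rw [mul_inv_cancel_left₀ (pow_ne_zero _ hq0)] at h1
  exact h1.trans ((le_abs_self _).trans (hC _ hz'))

/-- A holomorphic function on the punctured plane with `G (q s) = μ s G (s)` vanishes. -/
theorem eq_zero_of_degree_neg (hq0 : q ≠ 0) (hq1 : ‖q‖ < 1) {G : ℂ → ℂ} {μ : ℂ}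
    (hG : ∀ s ≠ 0, AnalyticAt ℂ G s) (h : ∀ s ≠ 0, G (q * s) = μ * s * G s) :
    ∀ s ≠ 0, G s = 0 := by
  have hqn : 0 < ‖q‖ := norm_pos_iff.2 hq0
  -- For small `z` one has `‖μ z‖ ≤ ‖q‖ ^ M`, so `‖G z‖ / ‖z‖ ^ M` does not increase under `z ↦ q
  -- z`. Thus `G` decays at the origin faster than any power.
  have hO : ∀ M : ℕ, ∃ r > 0, ∃ C, ∀ z : ℂ, z ≠ 0 → ‖z‖ ≤ r → ‖G z‖ ≤ C * ‖z‖ ^ M := by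
    intro M
    have hr : 0 < ‖q‖ ^ M / (‖μ‖ + 1) := by positivity
    refine ⟨_, hr, ?_⟩
    obtain ⟨C, hC⟩ := exists_bound_of_contracting hq0 hq1 (f := fun z => ‖G z‖ / ‖z‖ ^ M) hr
      (fun z hz _ => (hG z hz).continuousAt.norm.div (by fun_prop)
        (pow_ne_zero _ (norm_ne_zero_iff.2 hz))) (fun z hz hzr => by
        have hzn : 0 < ‖z‖ := norm_pos_iff.2 hz
        rw [h z hz, norm_mul, norm_mul, norm_mul, mul_pow, div_le_div_iff₀ (by positivity)
          (by positivity)]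
        have h1 : ‖μ‖ * ‖z‖ ≤ ‖q‖ ^ M := by
          calc ‖μ‖ * ‖z‖ ≤ (‖μ‖ + 1) * ‖z‖ := by gcongr; linarith
            _ ≤ (‖μ‖ + 1) * (‖q‖ ^ M / (‖μ‖ + 1)) := by gcongr
            _ = ‖q‖ ^ M := by field_simp
        calc ‖μ‖ * ‖z‖ * ‖G z‖ * ‖z‖ ^ M = (‖μ‖ * ‖z‖) * (‖G z‖ * ‖z‖ ^ M) := by ring
          _ ≤ ‖q‖ ^ M * (‖G z‖ * ‖z‖ ^ M) := by gcongr
          _ = ‖G z‖ * (‖q‖ ^ M * ‖z‖ ^ M) := by ring)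
    exact ⟨C, fun z hz hzr => (div_le_iff₀ (pow_pos (norm_pos_iff.2 hz) M)).1 (hC z hz hzr)⟩
  set G₀ : ℂ → ℂ := Function.update G 0 0 with hG₀
  have hne : ∀ s ≠ 0, G₀ s = G s := fun s hs => Function.update_of_ne hs _ _
  have hd : Differentiable ℂ G₀ := by
    intro s
    by_cases hs : s = 0
    · subst hs
      obtain ⟨r, hr, C, hC⟩ := hO 2
      have : HasDerivAt G₀ 0 0 := by
        rw [hasDerivAt_iff_isLittleO]
        have hO2 : (fun z => G₀ z) =O[𝓝 0] fun z : ℂ => z ^ 2 := by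
          refine Asymptotics.IsBigO.of_bound C ?_
          filter_upwards [Metric.closedBall_mem_nhds (0 : ℂ) hr] with z hz
          by_cases hz0 : z = 0
          · simp [hz0, hG₀]
          · rw [hne z hz0, norm_pow]
            exact hC z hz0 (by simpa using hz)
        have h2 : (fun z : ℂ => z ^ 2) =o[𝓝 0] fun z : ℂ => z := by
          simpa using Asymptotics.isLittleO_pow_pow (𝕜 := ℂ) (m := 1) (n := 2) (by norm_num)
        have h3 : G₀ 0 = 0 := by simp [hG₀]
        simpa [h3] using hO2.trans_isLittleO h2
      exact this.differentiableAt
    · refine (hG s hs).differentiableAt.congr_of_eventuallyEq ?_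
      filter_upwards [isOpen_ne.mem_nhds hs] with y hy using hne y hy
  have ha : AnalyticAt ℂ G₀ 0 := hd.analyticAt 0
  -- After extension by zero, a nontrivial leading term at the origin would contradict the decay of
  -- the next order.
  have hev : ∀ᶠ z in 𝓝 0, G₀ z = 0 := by
    by_contra hnot
    obtain ⟨n, g, hg, hg0, hgn⟩ := ha.exists_eventuallyEq_pow_smul_nonzero_iff.2 hnot
    obtain ⟨r, hr, C, hC⟩ := hO (n + 1)
    have hlim : Tendsto g (𝓝[≠] 0) (𝓝 0) := by
      rw [tendsto_zero_iff_norm_tendsto_zero]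
      have hb : Tendsto (fun z : ℂ => C * ‖z‖) (𝓝[≠] 0) (𝓝 0) := by
        have : Tendsto (fun z : ℂ => C * ‖z‖) (𝓝 0) (𝓝 (C * ‖(0 : ℂ)‖)) :=
          Continuous.tendsto (by fun_prop) 0
        rw [norm_zero, mul_zero] at this
        exact this.mono_left nhdsWithin_le_nhds
      refine squeeze_zero' (Eventually.of_forall fun _ => norm_nonneg _) ?_ hb
      filter_upwards [hgn.filter_mono nhdsWithin_le_nhds, self_mem_nhdsWithin,
        nhdsWithin_le_nhds (Metric.closedBall_mem_nhds (0 : ℂ) hr)] with z h1 h2 h3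
      have h4 := hC z h2 (by simpa using h3)
      have hzn : 0 < ‖z‖ := norm_pos_iff.2 h2
      rw [← hne z h2, h1, sub_zero, norm_smul, norm_pow, pow_succ] at h4
      have h5 : ‖z‖ ^ n * ‖g z‖ ≤ ‖z‖ ^ n * (C * ‖z‖) := by linarith
      exact le_of_mul_le_mul_left h5 (pow_pos hzn n)
    exact hg0 (tendsto_nhds_unique (hg.continuousAt.tendsto.mono_left nhdsWithin_le_nhds) hlim)
  have hz : G₀ = 0 := AnalyticOnNhd.eq_of_eventuallyEq (fun z _ => hd.analyticAt z)
    (fun z _ => analyticAt_const) hev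
  intro s hs
  rw [← hne s hs, hz]
  rfl

theorem theta_div_eq_zero_iff (hq0 : q ≠ 0) (hq1 : ‖q‖ < 1) {p s : ℂ} (hs : s ≠ 0) :
    theta q (p / s) = 0 ↔ ∃ n : ℤ, p = q ^ n * s := by
  constructor
  · intro h
    by_contra hne
    push Not at hne
    exact theta_ne_zero hq0 hq1 (fun n hn => hne n ((div_eq_iff hs).1 hn)) h
  · rintro ⟨n, rfl⟩
    rw [mul_div_cancel_right₀ _ hs]
    exact theta_zpow hq0 hq1 n

/-- A theta function of degree two on the punctured plane with three inequivalent zeros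
vanishes identically. -/
theorem eq_zero_of_three_zeros (hq0 : q ≠ 0) (hq1 : ‖q‖ < 1) {E : ℂ → ℂ} {κ : ℂ} (hκ : κ ≠ 0)
    (hE : ∀ s ≠ 0, AnalyticAt ℂ E s) (h : ∀ s ≠ 0, s ^ 2 * E (q * s) = κ * E s)
    {x : Fin 3 → ℂ} (hx : ∀ i, x i ≠ 0) (hxx : ∀ i j, i ≠ j → ∀ n : ℤ, x i ≠ q ^ n * x j)
    (hEx : ∀ i, E (x i) = 0) : ∀ s ≠ 0, E s = 0 := by
  have hz : ∀ i (n : ℤ), E (q ^ n * x i) = 0 := by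
    intro i n
    have hs : ∀ n : ℤ, E (q ^ (n + 1) * x i) = 0 ↔ E (q ^ n * x i) = 0 := by
      intro n
      have h1 : q ^ n * x i ≠ 0 := mul_ne_zero (zpow_ne_zero _ hq0) (hx i)
      have h2 := h _ h1
      rw [← mul_assoc, ← zpow_one_add₀ hq0, add_comm] at h2
      constructor
      · intro h3
        rw [h3, mul_zero] at h2
        exact (mul_eq_zero.1 h2.symm).resolve_left hκ
      · intro h3
        rw [h3, mul_zero] at h2
        exact (mul_eq_zero.1 h2).resolve_left (pow_ne_zero _ h1)
    induction n using Int.induction_on with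
    | zero => simpa using hEx i
    | succ n ih => exact (hs n).2 ih
    | pred n ih =>
      have := hs (-(n : ℤ) - 1)
      rw [sub_add_cancel] at this
      exact this.1 ih
  have hz' : ∀ i (p : ℂ), theta q (p / x i) = 0 → E p = 0 := by
    intro i p hp
    obtain ⟨n, rfl⟩ := (theta_div_eq_zero_iff hq0 hq1 (hx i)).1 hp
    exact hz i n
  have hdis : ∀ i j, i ≠ j → ∀ p, theta q (p / x i) = 0 → theta q (p / x j) ≠ 0 := by
    intro i j hij p hi hj
    obtain ⟨n, hn⟩ := (theta_div_eq_zero_iff hq0 hq1 (hx i)).1 hi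
    obtain ⟨m, hm⟩ := (theta_div_eq_zero_iff hq0 hq1 (hx j)).1 hj
    refine hxx i j hij (m - n) ?_
    rw [zpow_sub₀ hq0, div_mul_eq_mul_div, eq_div_iff (zpow_ne_zero _ hq0), mul_comm, ← hn, hm]
  have hta : ∀ i (p : ℂ), p ≠ 0 → AnalyticAt ℂ (fun z => theta q (z / x i)) p := fun i p hp =>
    (analyticAt_theta hq1 (div_ne_zero hp (hx i))).comp (f := fun z => z / x i) (by fun_prop)
  -- The quotient of `E`, of degree two, by a product of three theta functions has degree `-1`. The
  -- zeros of the denominator are simple and pairwise distinct, and `E` vanishes at each of them, so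
  -- all singularities are removable.
  set H : ℂ → ℂ := fun z => E z * ((theta q (z / x 0))⁻¹ * (theta q (z / x 1))⁻¹ *
    (theta q (z / x 2))⁻¹) with hH
  have main : ∀ i j k : Fin 3, (∀ z, H z = (theta q (z / x i))⁻¹ *
      (E z * ((theta q (z / x j))⁻¹ * (theta q (z / x k))⁻¹))) → ∀ p ≠ 0,
      theta q (p / x j) ≠ 0 → theta q (p / x k) ≠ 0 → HasSimplePole H p 0 := by
    intro i j k hHe p hp hj hk
    have ha : AnalyticAt ℂ (fun z => E z * ((theta q (z / x j))⁻¹ * (theta q (z / x k))⁻¹)) p :=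
      (hE p hp).mul (((hta j p hp).inv hj).mul ((hta k p hp).inv hk))
    by_cases hi : theta q (p / x i) = 0
    · obtain ⟨c, hc⟩ := HasSimplePole.inv_theta hq0 hq1 (hx i) hp
      have := hc.mul_analyticAt ha
      rw [hz' i p hi, zero_mul, mul_zero] at this
      exact this.congr (Eventually.of_forall fun z => (hHe z).symm)
    · exact (HasSimplePole.of_analyticAt (((hta i p hp).inv hi).mul ha)).congr
        (Eventually.of_forall fun z => (hHe z).symm)
  have hHs : ∀ p ≠ 0, HasSimplePole H p 0 := by
    intro p hp
    by_cases h0 : theta q (p / x 0) = 0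
    · exact main 0 1 2 (fun z => by simp only [hH]; ring) p hp (hdis 0 1 (by decide) p h0)
        (hdis 0 2 (by decide) p h0)
    by_cases h1 : theta q (p / x 1) = 0
    · exact main 1 0 2 (fun z => by simp only [hH]; ring) p hp h0 (hdis 1 2 (by decide) p h1)
    · exact main 2 0 1 (fun z => by simp only [hH]; ring) p hp h0 h1
  set μ : ℂ := -κ / (x 0 * x 1 * x 2) with hμ
  have hHq : ∀ s ≠ 0, H (q * s) = μ * s * H s := by
    intro s hs
    have ht : ∀ i, theta q (q * s / x i) = -(x i / s) * theta q (s / x i) := fun i => by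
      rw [mul_div_assoc, theta_mul_q hq0 hq1 (div_ne_zero hs (hx i)), inv_div]
    have hEq : E (q * s) = κ / s ^ 2 * E s := by
      rw [div_mul_eq_mul_div, eq_div_iff (pow_ne_zero _ hs), mul_comm, h s hs]
    simp only [hH, ht, hEq, mul_inv, hμ, inv_div, inv_neg]
    have := hx 0; have := hx 1; have := hx 2
    field_simp
  set G := regularize H with hGdef
  have hGa : ∀ s ≠ 0, AnalyticAt ℂ G s := fun s hs => (hHs s hs).analyticAt_regularize
  -- The functional equation of `H` carries over to its regularization by continuity, since the two
  -- agree off a countable set.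
  have hGq : ∀ s ≠ 0, G (q * s) = μ * s * G s := by
    refine eq_of_eq_off_countable (N := {z | ¬ (H z = G z ∧ H (q * z) = G (q * z))} ∩ {0}ᶜ)
      (countable_of_eventually_notMem ?_) (fun s hs => ?_) (fun s hs => ?_) (fun s hs hsN => ?_)
    · intro z hz
      have h1 := (hHs z hz).eventually_eq_regularize
      have h2 := (hHs _ (mul_ne_zero hq0 hz)).eventually_eq_regularize
      have h3 : Tendsto (fun y => q * y) (𝓝[≠] z) (𝓝[≠] (q * z)) := by
        refine tendsto_nhdsWithin_iff.2 ⟨?_, ?_⟩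
        · exact (Continuous.tendsto (by fun_prop) z).mono_left nhdsWithin_le_nhds
        · filter_upwards [self_mem_nhdsWithin] with y hy
          exact fun h => hy (mul_left_cancel₀ hq0 h)
      filter_upwards [h1, h3.eventually h2] with y hy1 hy2
      exact not_not.2 ⟨hy1, hy2⟩
    · exact ContinuousAt.comp (f := fun s => q * s) (hGa _ (mul_ne_zero hq0 hs)).continuousAt
        (by fun_prop)
    · exact (by fun_prop : ContinuousAt (fun s => μ * s) s).mul (hGa s hs).continuousAt
    · have h1 : H s = G s ∧ H (q * s) = G (q * s) := by
        by_contra h1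
        exact hsN ⟨h1, hs⟩
      rw [← h1.1, ← h1.2, hHq s hs]
  have hG0 := eq_zero_of_degree_neg hq0 hq1 hGa hGq
  intro s hs
  by_cases h0 : ∃ i, theta q (s / x i) = 0
  · obtain ⟨i, hi⟩ := h0
    exact hz' i s hi
  · push Not at h0
    have hHa : AnalyticAt ℂ H s := (hE s hs).mul ((((hta 0 s hs).inv (h0 0)).mul
      ((hta 1 s hs).inv (h0 1))).mul ((hta 2 s hs).inv (h0 2)))
    have h1 : G s = H s := regularize_eq hHa.continuousAt (Eventually.of_forall fun _ => rfl)
    rw [hG0 s hs] at h1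
    simp only [hH] at h1
    have h2 := mul_eq_zero.1 h1.symm
    refine h2.resolve_right ?_
    exact mul_ne_zero (mul_ne_zero (inv_ne_zero (h0 0)) (inv_ne_zero (h0 1))) (inv_ne_zero (h0 2))

end Vanishing

/-! ### Weierstrass' addition formula and a three-term relation. -/

section ThetaIdentities

variable {q : ℂ}

theorem theta_div_q (hq0 : q ≠ 0) (hq1 : ‖q‖ < 1) {x : ℂ} (hx : x ≠ 0) :
    theta q (x / q) = -(x / q) * theta q x := by
  have h := theta_mul_q hq0 hq1 (div_ne_zero hx hq0)
  rw [mul_div_cancel₀ _ hq0] at h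
  rw [h]
  field_simp

theorem theta_q_sq_div (hq0 : q ≠ 0) (hq1 : ‖q‖ < 1) {x : ℂ} (hx : x ≠ 0) :
    theta q (q ^ 2 / x) = -(x / q) * theta q x := by
  have h := theta_mul_q hq0 hq1 (div_ne_zero hq0 hx)
  rw [theta_div_left hq0, inv_div] at h
  rw [← h]
  congr 1
  ring

theorem theta_one (hq0 : q ≠ 0) (hq1 : ‖q‖ < 1) : theta q 1 = 0 := by
  simpa using theta_zpow hq0 hq1 0

theorem analyticAt_theta_mul (hq1 : ‖q‖ < 1) {c : ℂ} (hc : c ≠ 0) {x : ℂ} (hx : x ≠ 0) :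
    AnalyticAt ℂ (fun x => theta q (x * c)) x :=
  (analyticAt_theta hq1 (mul_ne_zero hx hc)).comp (f := fun x => x * c) (by fun_prop)

theorem analyticAt_theta_div (hq1 : ‖q‖ < 1) {c : ℂ} (hc : c ≠ 0) {x : ℂ} (hx : x ≠ 0) :
    AnalyticAt ℂ (fun x => theta q (c / x)) x :=
  (analyticAt_theta hq1 (div_ne_zero hc hx)).comp (f := fun x => c / x)
    (analyticAt_const.div analyticAt_id hx)

/-- Weierstrass' addition formula for theta functions. -/
theorem theta_addition (hq0 : q ≠ 0) (hq1 : ‖q‖ < 1) {a b a' b' y : ℂ}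
    (ha : a ≠ 0) (ha' : a' ≠ 0) (hb : b ≠ 0) (hb' : b' ≠ 0) (hy : y ≠ 0)
    (hbal : a * a' * b * b' = q) (hbb : ∀ n : ℤ, b ≠ q ^ n * b') (hab : ∀ n : ℤ, a * b ≠ q ^ n)
    (hab' : ∀ n : ℤ, a * b' ≠ q ^ n) {x : ℂ} (hx : x ≠ 0) :
    theta q (x / a) * theta q (x / a') * theta q (y * b) * theta q (y * b') -
      x / y * (theta q (x * b) * theta q (x * b') * theta q (y / a) * theta q (y / a')) =
    theta q (x / y) * theta q (q * a * a' / y / x) * theta q (a * b) * theta q (a * b') := by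
  -- In `x` every term is a theta function of degree two with the same multiplier `a a'`. The
  -- hypotheses on `a b`, `a b'` and `b / b'` make the three test points `a`, `b⁻¹`, `b'⁻¹`
  -- inequivalent.
  set E : ℂ → ℂ := fun x => theta q (x / a) * theta q (x / a') * theta q (y * b) * theta q (y * b') -
      x / y * (theta q (x * b) * theta q (x * b') * theta q (y / a) * theta q (y / a')) -
    theta q (x / y) * theta q (q * a * a' / y / x) * theta q (a * b) * theta q (a * b') with hE
  suffices E x = 0 from sub_eq_zero.1 this
  have hqaa : q * a * a' / y ≠ 0 := by positivity
  refine eq_zero_of_three_zeros hq0 hq1 (E := E) (κ := a * a') (mul_ne_zero ha ha') ?_ ?_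
    (x := ![a, b⁻¹, b'⁻¹]) ?_ ?_ ?_ x hx
  · intro s hs
    simp only [hE, div_eq_mul_inv _ a, div_eq_mul_inv _ a', div_eq_mul_inv _ y]
    have h1 := analyticAt_theta_mul hq1 (inv_ne_zero ha) hs
    have h2 := analyticAt_theta_mul hq1 (inv_ne_zero ha') hs
    have h3 := analyticAt_theta_mul hq1 hb hs
    have h4 := analyticAt_theta_mul hq1 hb' hs
    have h5 := analyticAt_theta_mul hq1 (inv_ne_zero hy) hs
    have h6 := analyticAt_theta_div hq1 hqaa hs
    rw [div_eq_mul_inv _ y] at h6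
    fun_prop
  · intro s hs
    have e1 : ∀ {c : ℂ}, c ≠ 0 → theta q (q * s / c) = -(c / s) * theta q (s / c) := fun hc => by
      rw [mul_div_assoc, theta_mul_q hq0 hq1 (div_ne_zero hs hc), inv_div]
    have e2 : ∀ {c : ℂ}, c ≠ 0 → theta q (q * s * c) = -(s * c)⁻¹ * theta q (s * c) := fun hc => by
      rw [mul_assoc, theta_mul_q hq0 hq1 (mul_ne_zero hs hc)]
    have e3 : theta q (q * a * a' / y / (q * s)) =
        -(a * a' / (y * s)) * theta q (q * a * a' / y / s) := by
      have := theta_div_q hq0 hq1 (div_ne_zero hqaa hs)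
      rw [div_div, mul_comm s q] at this
      rw [this]
      congr 1
      field_simp
    simp only [hE]
    rw [e1 ha, e1 ha', e2 hb, e2 hb', e1 hy, e3]
    have hbb : (s * b)⁻¹ * (s * b')⁻¹ = a * a' / (q * s ^ 2) := by
      rw [← hbal]
      field_simp
    have : q * s / y * (-(s * b)⁻¹ * theta q (s * b) * (-(s * b')⁻¹ * theta q (s * b')) *
        theta q (y / a) * theta q (y / a')) = q * s / y * ((s * b)⁻¹ * (s * b')⁻¹) *
        (theta q (s * b) * theta q (s * b') * theta q (y / a) * theta q (y / a')) := by ring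
    rw [this, hbb]
    field_simp
  · intro i
    fin_cases i
    · exact ha
    · exact inv_ne_zero hb
    · exact inv_ne_zero hb'
  · have e2 : ∀ {b : ℂ}, b ≠ 0 → (∀ n : ℤ, a * b ≠ q ^ n) → ∀ n : ℤ, a ≠ q ^ n * b⁻¹ :=
      fun hb h n hn => h n (by rw [hn, inv_mul_cancel_right₀ hb])
    have e3 : ∀ {b : ℂ}, b ≠ 0 → (∀ n : ℤ, a * b ≠ q ^ n) → ∀ n : ℤ, b⁻¹ ≠ q ^ n * a :=
      fun {b} hb h n hn => h (-n) (by
        rw [zpow_neg]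
        have : q ^ n * (a * b) = 1 := by rw [← mul_assoc, ← hn, inv_mul_cancel₀ hb]
        exact eq_inv_of_mul_eq_one_right this)
    intro i j hij n
    fin_cases i <;> fin_cases j
    · exact absurd rfl hij
    · exact e2 hb hab n
    · exact e2 hb' hab' n
    · exact e3 hb hab n
    · exact absurd rfl hij
    · intro h
      refine hbb (-n) ?_
      change b⁻¹ = q ^ n * b'⁻¹ at h
      rw [zpow_neg, ← inv_inv b, h, mul_inv, inv_inv]
    · exact e3 hb' hab' n
    · intro h
      refine hbb n ?_
      change b'⁻¹ = q ^ n * b⁻¹ at h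
      rw [← inv_inv b', h, mul_inv, inv_inv, mul_inv_cancel_left₀ (zpow_ne_zero _ hq0)]
    · exact absurd rfl hij
  · have t1 := theta_one hq0 hq1
    have hinv : ∀ {c : ℂ}, c ≠ 0 → theta q (c / y) = -(c / y) * theta q (y / c) := fun {c} hc => by
      have := theta_inv hq0 hq1 (div_ne_zero hy hc)
      rwa [inv_div] at this
    -- At `b⁻¹` the second product contains `θ(1) = 0`, and quasi-periodicity with the balancing
    -- condition matches the other two terms. Quantifying over `b` and `b'` covers `b'⁻¹` by
    -- symmetry.
    have hzero : ∀ {b b' : ℂ}, b ≠ 0 → b' ≠ 0 → a * a' * b * b' = q →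
        theta q (b⁻¹ / a) * theta q (b⁻¹ / a') * theta q (y * b) * theta q (y * b') -
          b⁻¹ / y * (theta q (b⁻¹ * b) * theta q (b⁻¹ * b') * theta q (y / a) * theta q (y / a')) -
        theta q (b⁻¹ / y) * theta q (q * a * a' / y / b⁻¹) * theta q (a * b) * theta q (a * b') =
          0 := by
      intro b b' hb hb' hbal
      have h1 : theta q (q * a * a' / y / b⁻¹) = -(y * b' / q) * theta q (y * b') := by
        rw [← theta_q_sq_div hq0 hq1 (mul_ne_zero hy hb')]
        congr 1
        rw [eq_div_iff (mul_ne_zero hy hb'), sq]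
        nth_rw 3 [← hbal]
        field_simp
      have h2 : theta q (b⁻¹ / a) = -(a * b)⁻¹ * theta q (a * b) := by
        rw [← theta_inv hq0 hq1 (mul_ne_zero ha hb), mul_inv, mul_comm, div_eq_mul_inv]
      have h3 : theta q (b⁻¹ / a') = -(a * b' / q) * theta q (a * b') := by
        rw [← theta_div_q hq0 hq1 (mul_ne_zero ha hb')]
        congr 1
        rw [← hbal]
        field_simp
      have h4 : theta q (b⁻¹ / y) = -(y * b)⁻¹ * theta q (y * b) := by
        rw [← theta_inv hq0 hq1 (mul_ne_zero hy hb), mul_inv]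
        congr 1
        field_simp
      simp only [inv_mul_cancel₀ hb, t1, h1, h2, h3, h4]
      field_simp
      ring
    intro i
    fin_cases i
    · change E a = 0
      have h1 : theta q (q * a * a' / y / a) = theta q (y / a') := by
        rw [← theta_div_left hq0 (y / a')]
        congr 1
        field_simp
      simp only [hE, div_self ha, t1, h1, hinv ha]
      ring
    · exact hzero hb hb' hbal
    · have := hzero hb' hb (by rw [← hbal]; ring)
      change E b'⁻¹ = 0
      rw [← this]
      simp only [hE]
      ring

/-- One of the three terms in `sum_theta_eq_zero`. -/
def thetaTerm (q y b₁ b₂ b₃ x : ℂ) : ℂ :=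
  theta q (x * b₁) * theta q (y * b₁) * theta q (q ^ 2 * b₁ / (y * (b₁ * b₂ * b₃)) / x) /
    (b₁ * (theta q (b₂ / b₁) * theta q (b₃ / b₁)))

/-- The residues of an elliptic function with three simple poles sum to zero. -/
theorem sum_theta_eq_zero (hq0 : q ≠ 0) (hq1 : ‖q‖ < 1) {b : Fin 3 → ℂ} (hb : ∀ i, b i ≠ 0)
    (hbb : ∀ i j, i ≠ j → ∀ n : ℤ, b i ≠ q ^ n * b j) {y : ℂ} (hy : y ≠ 0) {x : ℂ} (hx : x ≠ 0) :
    thetaTerm q y (b 0) (b 1) (b 2) x + thetaTerm q y (b 1) (b 2) (b 0) x +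
      thetaTerm q y (b 2) (b 0) (b 1) x = 0 := by
  have hB : ∀ i j k, b i * b j * b k ≠ 0 := fun i j k =>
    mul_ne_zero (mul_ne_zero (hb i) (hb j)) (hb k)
  have htb : ∀ i j, i ≠ j → theta q (b i / b j) ≠ 0 := fun i j hij =>
    theta_ne_zero hq0 hq1 fun n hn => hbb i j hij n ((div_eq_iff (hb j)).1 hn)
  have hc : ∀ i j k, q ^ 2 * b i / (y * (b i * b j * b k)) ≠ 0 := fun i j k =>
    div_ne_zero (mul_ne_zero (pow_ne_zero _ hq0) (hb i)) (mul_ne_zero hy (hB i j k))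
  have han : ∀ i j k, i ≠ j → i ≠ k → ∀ s ≠ 0,
      AnalyticAt ℂ (thetaTerm q y (b i) (b j) (b k)) s := by
    intro i j k hij hik s hs
    have h1 := analyticAt_theta_mul hq1 (hb i) hs
    have h2 := analyticAt_theta_div hq1 (hc i j k) hs
    have h3 : b i * (theta q (b j / b i) * theta q (b k / b i)) ≠ 0 :=
      mul_ne_zero (hb i) (mul_ne_zero (htb j i hij.symm) (htb k i hik.symm))
    unfold thetaTerm
    exact ((h1.mul analyticAt_const).mul h2).div analyticAt_const h3
  have hq : ∀ i j k, ∀ s ≠ 0, s ^ 2 * thetaTerm q y (b i) (b j) (b k) (q * s) =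
      q / (y * (b i * b j * b k)) * thetaTerm q y (b i) (b j) (b k) s := by
    intro i j k s hs
    have e2 : theta q (q * s * b i) = -(s * b i)⁻¹ * theta q (s * b i) := by
      rw [mul_assoc, theta_mul_q hq0 hq1 (mul_ne_zero hs (hb i))]
    have e3 := theta_div_q hq0 hq1 (div_ne_zero (hc i j k) hs)
    rw [div_div _ s q, mul_comm s q] at e3
    simp only [thetaTerm]
    rw [e2, e3]
    have := hb i; have := hb j; have := hb k
    field_simp
  -- At `b_i⁻¹` one of the terms contains `θ(1) = 0`, and the other two are opposite to each other.
  have hzero : ∀ i j k, i ≠ j → i ≠ k → j ≠ k → thetaTerm q y (b i) (b j) (b k) (b i)⁻¹ +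
      thetaTerm q y (b j) (b k) (b i) (b i)⁻¹ + thetaTerm q y (b k) (b i) (b j) (b i)⁻¹ = 0 := by
    intro i j k hij hik hjk
    have := hb i; have := hb j; have := hb k
    have hinv : ∀ m n, theta q (b m / b n) = -(b m / b n) * theta q (b n / b m) := fun m n => by
      have := theta_inv hq0 hq1 (div_ne_zero (hb n) (hb m))
      rwa [inv_div] at this
    have h3 : theta q (q ^ 2 * b j / (y * (b j * b k * b i)) / (b i)⁻¹) =
        -(y * b k / q) * theta q (y * b k) := by
      rw [← theta_q_sq_div hq0 hq1 (mul_ne_zero hy (hb k))]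
      congr 1
      field_simp
    have h4 : theta q (q ^ 2 * b k / (y * (b k * b i * b j)) / (b i)⁻¹) =
        -(y * b j / q) * theta q (y * b j) := by
      rw [← theta_q_sq_div hq0 hq1 (mul_ne_zero hy (hb j))]
      congr 1
      field_simp
    have e1 := htb i j hij
    have e2 := htb i k hik
    have e3 := htb j k hjk
    simp only [thetaTerm, inv_mul_cancel₀ (hb i), theta_one hq0 hq1, h3, h4]
    rw [inv_mul_eq_div, inv_mul_eq_div, hinv j i, hinv k i, hinv k j]
    field_simp
    ring
  refine eq_zero_of_three_zeros hq0 hq1 (E := fun x => thetaTerm q y (b 0) (b 1) (b 2) x +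
    thetaTerm q y (b 1) (b 2) (b 0) x + thetaTerm q y (b 2) (b 0) (b 1) x)
    (κ := q / (y * (b 0 * b 1 * b 2))) (div_ne_zero hq0 (mul_ne_zero hy (hB 0 1 2))) ?_ ?_
    (x := fun i => (b i)⁻¹) (fun i => inv_ne_zero (hb i)) ?_ ?_ x hx
  · intro s hs
    exact ((han 0 1 2 (by decide) (by decide) s hs).add
      (han 1 2 0 (by decide) (by decide) s hs)).add (han 2 0 1 (by decide) (by decide) s hs)
  · intro s hs
    rw [mul_add, mul_add, hq 0 1 2 s hs, hq 1 2 0 s hs, hq 2 0 1 s hs,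
      show b 1 * b 2 * b 0 = b 0 * b 1 * b 2 by ring, show b 2 * b 0 * b 1 = b 0 * b 1 * b 2 by ring]
    ring
  · intro i j hij n h
    refine hbb j i hij.symm n ?_
    rw [inv_eq_iff_eq_inv, mul_inv, inv_inv] at h
    rw [h, mul_inv_cancel_left₀ (zpow_ne_zero _ hq0)]
  · intro i
    fin_cases i
    · exact hzero 0 1 2 (by decide) (by decide) (by decide)
    · have := hzero 1 2 0 (by decide) (by decide) (by decide)
      change thetaTerm q y (b 0) (b 1) (b 2) (b 1)⁻¹ + thetaTerm q y (b 1) (b 2) (b 0) (b 1)⁻¹ +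
        thetaTerm q y (b 2) (b 0) (b 1) (b 1)⁻¹ = 0
      rw [← this]; ring
    · have := hzero 2 0 1 (by decide) (by decide) (by decide)
      change thetaTerm q y (b 0) (b 1) (b 2) (b 2)⁻¹ + thetaTerm q y (b 1) (b 2) (b 0) (b 2)⁻¹ +
        thetaTerm q y (b 2) (b 0) (b 1) (b 2)⁻¹ = 0
      rw [← this]; ring

end ThetaIdentities

/-! ### The hypergeometric series of residues. -/

section Series

variable {q : ℂ}

/-- The finite `q`-shifted factorial. -/
def qPoch (q x : ℂ) (n : ℕ) : ℂ := ∏ i ∈ Finset.range n, (1 - x * q ^ i)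

theorem qPoch_succ (q x : ℂ) (n : ℕ) : qPoch q x (n + 1) = qPoch q x n * (1 - x * q ^ n) :=
  Finset.prod_range_succ _ _

theorem qPoch_zero (q x : ℂ) : qPoch q x 0 = 1 := Finset.prod_range_zero _

theorem norm_qPoch_le (hq1 : ‖q‖ < 1) (x : ℂ) (n : ℕ) :
    ‖qPoch q x n‖ ≤ Real.exp (‖x‖ * (1 - ‖q‖)⁻¹) := by
  rw [qPoch, norm_prod]
  calc ∏ i ∈ Finset.range n, ‖1 - x * q ^ i‖
      ≤ ∏ i ∈ Finset.range n, Real.exp (‖x‖ * ‖q‖ ^ i) := by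
        refine Finset.prod_le_prod (fun _ _ => norm_nonneg _) fun i _ => ?_
        calc ‖1 - x * q ^ i‖ ≤ ‖(1 : ℂ)‖ + ‖x * q ^ i‖ := norm_sub_le _ _
          _ = ‖x‖ * ‖q‖ ^ i + 1 := by rw [norm_one, norm_mul, norm_pow, add_comm]
          _ ≤ _ := Real.add_one_le_exp _
    _ = Real.exp (‖x‖ * ∑ i ∈ Finset.range n, ‖q‖ ^ i) := by
        rw [← Real.exp_sum, Finset.mul_sum]
    _ ≤ _ := by
        rw [← tsum_geometric_of_lt_one (norm_nonneg _) hq1]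
        gcongr
        exact (summable_geometric_of_lt_one (norm_nonneg _) hq1).sum_le_tsum _
          fun _ _ => by positivity

theorem qPoch_ne_zero {x : ℂ} (hx : ∀ n : ℕ, x * q ^ n ≠ 1) (n : ℕ) : qPoch q x n ≠ 0 :=
  Finset.prod_ne_zero_iff.2 fun i _ => sub_ne_zero.2 (hx i).symm

theorem exists_norm_inv_qPoch_le (hq1 : ‖q‖ < 1) {x : ℂ} (hx : ∀ n : ℕ, x * q ^ n ≠ 1) :
    ∃ C, 0 < C ∧ ∀ n, ‖(qPoch q x n)⁻¹‖ ≤ C := by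
  have h : Tendsto (fun n => (qPoch q x n)⁻¹) atTop (𝓝 (qInf q x)⁻¹) :=
    (tendsto_prod_qInf hq1 x).inv₀ (qInf_ne_zero hq1 hx)
  obtain ⟨C, hC, h'⟩ := (Metric.isBounded_range_of_tendsto _ h).exists_pos_norm_le
  exact ⟨C, hC, fun n => h' _ (mem_range_self n)⟩

/-- The general term of the basic hypergeometric series attached to the residues at `b_j q^n`. -/
def seriesTerm (q : ℂ) (a b : Fin 3 → ℂ) (j : Fin 3) (n : ℕ) : ℂ :=
  q ^ n * (∏ i, qPoch q (a i * b j) n) * ∏ k, (qPoch q (q * b j / b k) n)⁻¹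

/-- Parameters with ratios off the integral powers of `q`. -/
def Inequivalent (q : ℂ) (b : Fin 3 → ℂ) : Prop :=
  (∀ i, b i ≠ 0) ∧ ∀ i j, i ≠ j → ∀ n : ℤ, b i ≠ q ^ n * b j

theorem Inequivalent.mul_pow_ne_one {b : Fin 3 → ℂ} (hb : Inequivalent q b) (hq0 : q ≠ 0)
    (hq1 : ‖q‖ < 1) (j k : Fin 3) (n : ℕ) : q * b j / b k * q ^ n ≠ 1 := by
  intro h
  by_cases hjk : j = k
  · subst hjk
    rw [mul_div_cancel_right₀ _ (hb.1 j), ← pow_succ'] at h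
    have h1 : ‖q‖ ^ (n + 1) = 1 := by rw [← norm_pow, h, norm_one]
    exact (pow_lt_one₀ (norm_nonneg q) hq1 n.succ_ne_zero).ne h1
  · refine hb.2 k j (Ne.symm hjk) (n + 1) ?_
    have := hb.1 k
    rw [div_mul_eq_mul_div, div_eq_one_iff_eq this] at h
    rw [← h, zpow_add₀ hq0, zpow_natCast, zpow_one]
    ring

/-- The bound is uniform for bounded `a`, as the Weierstrass test needs for analyticity of the
series along an analytic family of parameters. -/
theorem exists_norm_seriesTerm_le (hq0 : q ≠ 0) (hq1 : ‖q‖ < 1) {b : Fin 3 → ℂ}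
    (hb : Inequivalent q b) (M : ℝ) (j : Fin 3) : ∃ C, ∀ a : Fin 3 → ℂ, (∀ i, ‖a i‖ ≤ M) →
      ∀ n, ‖seriesTerm q a b j n‖ ≤ C * ‖q‖ ^ n := by
  choose C hC hCn using fun k =>
    exists_norm_inv_qPoch_le hq1 (hb.mul_pow_ne_one hq0 hq1 j k)
  set D : ℝ := Real.exp (M * ‖b j‖ * (1 - ‖q‖)⁻¹) with hD
  refine ⟨(∏ _i : Fin 3, D) * ∏ k, C k, fun a ha n => ?_⟩
  rw [seriesTerm, norm_mul, norm_mul, norm_pow, norm_prod, norm_prod]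
  have h1 : ∏ i, ‖qPoch q (a i * b j) n‖ ≤ ∏ _i : Fin 3, D := by
    refine Finset.prod_le_prod (fun _ _ => norm_nonneg _) fun i _ => ?_
    refine (norm_qPoch_le hq1 _ n).trans ?_
    rw [hD, norm_mul]
    have : 0 ≤ (1 - ‖q‖)⁻¹ := inv_nonneg.2 (by linarith)
    gcongr
    exact ha i
  have h2 : ∏ k, ‖(qPoch q (q * b j / b k) n)⁻¹‖ ≤ ∏ k, C k :=
    Finset.prod_le_prod (fun _ _ => norm_nonneg _) fun k _ => hCn k n
  calc ‖q‖ ^ n * (∏ i, ‖qPoch q (a i * b j) n‖) * ∏ k, ‖(qPoch q (q * b j / b k) n)⁻¹‖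
      ≤ ‖q‖ ^ n * (∏ _i : Fin 3, D) * ∏ k, C k := by
        gcongr
    _ = _ := by ring

theorem summable_seriesTerm (hq0 : q ≠ 0) (hq1 : ‖q‖ < 1) {b : Fin 3 → ℂ}
    (hb : Inequivalent q b) (a : Fin 3 → ℂ) (j : Fin 3) : Summable (seriesTerm q a b j) := by
  obtain ⟨C, hC⟩ := exists_norm_seriesTerm_le hq0 hq1 hb (∑ i, ‖a i‖) j
  exact Summable.of_norm_bounded ((summable_geometric_of_lt_one (norm_nonneg _) hq1).mul_left C)
    (hC a fun i => Finset.single_le_sum (f := fun i => ‖a i‖) (fun _ _ => norm_nonneg _)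
      (Finset.mem_univ i))

theorem analyticAt_tsum_seriesTerm (hq0 : q ≠ 0) (hq1 : ‖q‖ < 1) {b : Fin 3 → ℂ}
    (hb : Inequivalent q b) (j : Fin 3) {a : ℂ → Fin 3 → ℂ} {s : ℂ}
    (ha : ∀ i, AnalyticAt ℂ (fun s => a s i) s) :
    AnalyticAt ℂ (fun s => ∑' n, seriesTerm q (a s) b j n) s := by
  have h1 : ∀ᶠ t in 𝓝 s, ∀ i, AnalyticAt ℂ (fun s => a s i) t ∧ ‖a t i‖ < ‖a s i‖ + 1 := by
    rw [eventually_all]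
    intro i
    refine (ha i).eventually_analyticAt.and ?_
    exact (ha i).continuousAt.norm.eventually_lt_const (by linarith)
  obtain ⟨U, hU, hUo, hsU⟩ := eventually_nhds_iff.1 h1
  obtain ⟨C, hC⟩ := exists_norm_seriesTerm_le hq0 hq1 hb (∑ i, (‖a s i‖ + 1)) j
  have hd := Complex.differentiableOn_tsum_of_summable_norm (U := U)
    (F := fun n t => seriesTerm q (a t) b j n)
    ((summable_geometric_of_lt_one (norm_nonneg _) hq1).mul_left C) (fun n t ht => ?_) hUo
    (fun n t ht => hC (a t) (fun i => ((hU t ht i).2.le).trans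
      (Finset.single_le_sum (f := fun i => ‖a s i‖ + 1) (fun _ _ => by positivity)
        (Finset.mem_univ i))) n)
  · exact hd.analyticAt (hUo.mem_nhds hsU)
  · have h2 : ∀ i, DifferentiableAt ℂ (fun s => a s i) t := fun i => (hU t ht i).1.differentiableAt
    unfold seriesTerm qPoch
    refine DifferentiableAt.differentiableWithinAt ?_
    refine DifferentiableAt.mul_const (DifferentiableAt.const_mul ?_ _) _
    refine DifferentiableAt.fun_finsetProd fun i _ => DifferentiableAt.fun_finsetProd fun m _ => ?_
    have := h2 i
    fun_prop

theorem seriesTerm_zero (q : ℂ) (a b : Fin 3 → ℂ) (j : Fin 3) : seriesTerm q a b j 0 = 1 := by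
  simp [seriesTerm, qPoch_zero]

/-- The coefficients of the hypergeometric series, up to the factors depending on `a`. -/
def seriesCoeff (q : ℂ) (b lam : Fin 3 → ℂ) (j : Fin 3) : ℂ :=
  (∏ i, theta q (lam i * b j)) / (qInf q q * ∏ k ∈ Finset.univ.erase j, qInf q (b k / b j))

/-- The product of the `(a_i b_k)_∞` with `k ≠ j`. -/
def offProd (q : ℂ) (a b : Fin 3 → ℂ) (j : Fin 3) : ℂ :=
  ∏ i, ∏ k ∈ Finset.univ.erase j, qInf q (a i * b k)

/-- The sum of the residues of the weight, times the product of the `(a_i b_j)_∞`. -/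
def residueSum (q : ℂ) (a b lam : Fin 3 → ℂ) : ℂ :=
  ∑ j, seriesCoeff q b lam j * offProd q a b j * ∑' n, seriesTerm q a b j n

/-- The series with index `j` stops after its first term because it contains `(1)_n`, while every
other series is multiplied by `(a_{i₀} b_j)_∞ = (1)_∞ = 0`. -/
theorem residueSum_of_mul_eq_one (hq1 : ‖q‖ < 1) {a b lam : Fin 3 → ℂ} {i₀ j : Fin 3}
    (h : a i₀ * b j = 1) : residueSum q a b lam = seriesCoeff q b lam j * offProd q a b j := by
  rw [residueSum, Finset.sum_eq_single j]
  · rw [tsum_eq_single 0, seriesTerm_zero, mul_one]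
    intro n hn
    obtain ⟨m, rfl⟩ := Nat.exists_eq_succ_of_ne_zero hn
    have : qPoch q (a i₀ * b j) (m + 1) = 0 :=
      Finset.prod_eq_zero (Finset.mem_range.2 m.succ_pos) (by simp [h])
    rw [seriesTerm, Finset.prod_eq_zero (Finset.mem_univ i₀) this]
    simp
  · intro k _ hk
    have : offProd q a b k = 0 := by
      refine Finset.prod_eq_zero (Finset.mem_univ i₀) ?_
      refine Finset.prod_eq_zero (Finset.mem_erase.2 ⟨Ne.symm hk, Finset.mem_univ j⟩) ?_
      exact qInf_eq_zero hq1 (n := 0) (by simpa using h)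
    rw [this]
    simp
  · simp

/-- The telescoping identity behind the contiguity relation. -/
theorem telescoping_identity {q a₁ a₂ a₃ b₁ b₂ b₃ z : ℂ} (hq0 : q ≠ 0) (h1 : a₁ ≠ 0) (h2 : a₂ ≠ 0)
    (hb₁ : b₁ ≠ 0) (hb₂ : b₂ ≠ 0) (hb₃ : b₃ ≠ 0) (hbal : a₁ * a₂ * a₃ * (b₁ * b₂ * b₃) = q) :
    (1 - a₂ * b₁ / q) * (1 - a₂ * b₂ / q) * (1 - a₂ * b₃ / q) * (1 - a₁ * z) * z -
      a₂ / (q * a₁) * z * (1 - a₂ * z / q) * ((1 - a₁ * b₁) * (1 - a₁ * b₂) * (1 - a₁ * b₃)) =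
    (a₂ / q) ^ 2 * (1 - q * a₁ / a₂) * ((b₁ * b₂ * b₃) * (1 - a₁ * z) * (1 - a₃ * z) *
      (1 - a₂ * z / q) + (z - b₁) * (z - b₂) * (z - b₃)) := by
  -- The balancing condition eliminates `a₃`; without it the identity fails.
  have h3 : a₃ = q / (a₁ * a₂ * (b₁ * b₂ * b₃)) := by
    rw [eq_div_iff (by positivity), ← hbal]; ring
  subst h3
  field_simp
  ring

end Series

/-! ### The contiguity relation under `(a₁, a₂) ↦ (q a₁, a₂ / q)`. -/

section Contiguity

variable {q : ℂ}

theorem qPoch_mul_q (q x : ℂ) (n : ℕ) :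
    qPoch q (q * x) n * (1 - x) = qPoch q x n * (1 - x * q ^ n) := by
  rw [← qPoch_succ, qPoch, qPoch, Finset.prod_range_succ']
  simp only [pow_zero, mul_one, pow_succ]
  congr 1
  exact Finset.prod_congr rfl fun i _ => by ring

theorem seriesTerm_succ {a b : Fin 3 → ℂ} (j : Fin 3) (n : ℕ) :
    seriesTerm q a b j (n + 1) = seriesTerm q a b j n *
      (q * (∏ i, (1 - a i * (b j * q ^ n))) * ∏ k, (1 - q * (b j * q ^ n) / b k)⁻¹) := by
  have h1 : ∀ i, 1 - a i * b j * q ^ n = 1 - a i * (b j * q ^ n) := fun i => by ring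
  have h2 : ∀ k, 1 - q * b j / b k * q ^ n = 1 - q * (b j * q ^ n) / b k := fun i => by ring
  simp only [seriesTerm, qPoch_succ, mul_inv, Finset.prod_mul_distrib, h1, h2, pow_succ]
  ring

/-- Up to a factor independent of `n`, the shift multiplies the term by a rational function of `b_j
q^n`; this reduces the contiguity relation to an identity of rational functions. -/
theorem seriesTerm_shift {a b : Fin 3 → ℂ} (hq0 : q ≠ 0) {j : Fin 3}
    (h0 : 1 - a 0 * b j ≠ 0) (n : ℕ) (h1 : 1 - a 1 * (b j * q ^ n) / q ≠ 0) :
    seriesTerm q ![q * a 0, a 1 / q, a 2] b j n = (1 - a 1 * b j / q) / (1 - a 0 * b j) *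
      ((1 - a 0 * (b j * q ^ n)) / (1 - a 1 * (b j * q ^ n) / q)) * seriesTerm q a b j n := by
  have e0 : qPoch q (q * (a 0 * b j)) n =
      qPoch q (a 0 * b j) n * (1 - a 0 * b j * q ^ n) / (1 - a 0 * b j) := by
    rw [eq_div_iff h0, qPoch_mul_q]
  have h1' : 1 - a 1 * b j / q * q ^ n ≠ 0 := by convert h1 using 2; ring
  have e1 : qPoch q (a 1 * b j / q) n =
      qPoch q (a 1 * b j) n * (1 - a 1 * b j / q) / (1 - a 1 * b j / q * q ^ n) := by
    have := qPoch_mul_q q (a 1 * b j / q) n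
    rw [mul_div_cancel₀ _ hq0] at this
    rw [eq_div_iff h1', this]
  simp only [seriesTerm, Fin.prod_univ_three]
  simp only [Matrix.cons_val_zero, Matrix.cons_val_one, Matrix.cons_val]
  rw [mul_assoc q, e0, show a 1 / q * b j = a 1 * b j / q by ring, e1]
  have r1 : a 1 * b j / q * q ^ n = a 1 * (b j * q ^ n) / q := by ring
  have r0 : a 0 * b j * q ^ n = a 0 * (b j * q ^ n) := by ring
  rw [r1, r0]
  field_simp

theorem offProd_shift {a b : Fin 3 → ℂ} (hq0 : q ≠ 0) (hq1 : ‖q‖ < 1) (j : Fin 3)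
    (h0 : ∀ k, 1 - a 0 * b k ≠ 0) :
    offProd q ![q * a 0, a 1 / q, a 2] b j =
      (∏ k ∈ Finset.univ.erase j, (1 - a 1 * b k / q) / (1 - a 0 * b k)) * offProd q a b j := by
  simp only [offProd, Fin.prod_univ_three, ← Finset.prod_mul_distrib]
  refine Finset.prod_congr rfl fun k _ => ?_
  simp only [Matrix.cons_val_zero, Matrix.cons_val_one, Matrix.cons_val]
  have e1 := qInf_eq hq1 (a 1 / q * b k)
  rw [show q * (a 1 / q * b k) = a 1 * b k by field_simp] at e1
  rw [e1, qInf_eq hq1 (a 0 * b k), ← mul_assoc q]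
  have := h0 k
  field_simp

/-- The factor `(q b_j / b_i)_∞` completes `(b_i / b_j)_∞` to a theta function for `i ≠ j`, and the
condition on the product of the `λ_i` eliminates `λ₃`. -/
theorem seriesCoeff_div {b lam : Fin 3 → ℂ} (hb : Inequivalent q b)
    {j k l : Fin 3} (hjk : j ≠ k) (hjl : j ≠ l) (hkl : k ≠ l)
    (h : ∏ i, lam i = q ^ 2 / ∏ i, b i) (h0 : lam 0 ≠ 0) (h1 : lam 1 ≠ 0) :
    seriesCoeff q b lam j / (b j * ∏ i, qInf q (q * b j / b i)) =
      thetaTerm q (lam 1) (b j) (b k) (b l) (lam 0) / qInf q q ^ 2 := by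
  have hu : (Finset.univ : Finset (Fin 3)).erase j = {k, l} := by
    revert j k l; decide
  have hu' : (Finset.univ : Finset (Fin 3)) = {j, k, l} := by
    revert j k l; decide
  have e2 : lam 2 * b j = q ^ 2 * b j / (lam 1 * (b j * b k * b l)) / lam 0 := by
    have hB : ∏ i, b i = b j * b k * b l := by
      rw [hu', Finset.prod_insert (by simp [hjk, hjl]), Finset.prod_insert (by simp [hkl]),
        Finset.prod_singleton, mul_assoc]
    rw [hB, Fin.prod_univ_three, eq_div_iff (by simp [hb.1])] at h
    rw [div_div, eq_div_iff (by simp [hb.1, h0, h1]), ← h]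
    ring
  have ht : ∀ i, q * b j / b i = q / (b i / b j) := fun i => by rw [div_div_eq_mul_div]
  have hp : ∏ i, qInf q (q * b j / b i) =
      qInf q q * (qInf q (q / (b k / b j)) * qInf q (q / (b l / b j))) := by
    rw [hu', Finset.prod_insert (by simp [hjk, hjl]), Finset.prod_pair hkl,
      mul_div_cancel_right₀ _ (hb.1 j), ht, ht]
  rw [seriesCoeff, hu, Finset.prod_pair hkl, hp, Fin.prod_univ_three, e2, thetaTerm]
  simp only [theta, div_div]
  ring

/-- Cancellation of the boundary terms of the three telescoping sums. -/
theorem sum_seriesCoeff_div (hq0 : q ≠ 0) (hq1 : ‖q‖ < 1) {b lam : Fin 3 → ℂ}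
    (hb : Inequivalent q b) (h : ∏ i, lam i = q ^ 2 / ∏ i, b i) (h0 : lam 0 ≠ 0) (h1 : lam 1 ≠ 0) :
    ∑ j, seriesCoeff q b lam j / (b j * ∏ i, qInf q (q * b j / b i)) = 0 := by
  rw [Fin.sum_univ_three,
    seriesCoeff_div hb (j := 0) (k := 1) (l := 2) (by decide) (by decide) (by decide)
      h h0 h1,
    seriesCoeff_div hb (j := 1) (k := 2) (l := 0) (by decide) (by decide) (by decide)
      h h0 h1,
    seriesCoeff_div hb (j := 2) (k := 0) (l := 1) (by decide) (by decide) (by decide)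
      h h0 h1, ← add_div, ← add_div, sum_theta_eq_zero hq0 hq1 hb.1 hb.2 h1 h0, zero_div]

/-- The telescoping certificate of the contiguity relation. -/
def certificate (q : ℂ) (a b : Fin 3 → ℂ) (j : Fin 3) (n : ℕ) : ℂ :=
  -((a 1 / q) ^ 2 * (1 - q * a 0 / a 1)) / (∏ k, (1 - a 0 * b k)) *
    ((∏ k, (b j * q ^ n - b k)) / (b j * q ^ n * (1 - a 1 * (b j * q ^ n) / q))) *
    seriesTerm q a b j n

theorem certificate_zero (q : ℂ) (a b : Fin 3 → ℂ) (j : Fin 3) : certificate q a b j 0 = 0 := by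
  have : ∏ k, (b j * q ^ 0 - b k) = 0 := Finset.prod_eq_zero (Finset.mem_univ j) (by simp)
  rw [certificate, this]
  simp

/-- The product over `q z - b_k` in the certificate, with `z = b_j q^n`, cancels the denominators in
the ratio of consecutive series terms, and `1 - a₂ z` cancels one factor of its numerator. -/
theorem certificate_succ (hq0 : q ≠ 0) {a b : Fin 3 → ℂ} {j : Fin 3} (n : ℕ) (hb : ∀ k, b k ≠ 0)
    (hk : ∀ k, 1 - q * (b j * q ^ n) / b k ≠ 0) (h1 : 1 - a 1 * (b j * q ^ n) ≠ 0) :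
    certificate q a b j (n + 1) =
      (a 1 / q) ^ 2 * (1 - q * a 0 / a 1) / (∏ k, (1 - a 0 * b k)) *
      ((∏ k, b k) * (1 - a 0 * (b j * q ^ n)) * (1 - a 2 * (b j * q ^ n)) / (b j * q ^ n)) *
      seriesTerm q a b j n := by
  rw [certificate, seriesTerm_succ]
  have hz : b j * q ^ n ≠ 0 := mul_ne_zero (hb j) (pow_ne_zero _ hq0)
  have e : b j * q ^ (n + 1) = q * (b j * q ^ n) := by rw [pow_succ]; ring
  rw [e]
  generalize b j * q ^ n = z at *
  have hk' : ∀ k, b k - q * z ≠ 0 := fun k hh => hk k (by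
    rw [← sub_eq_zero.1 hh, div_self (hb k), sub_self])
  have hbk : ∏ k, (q * z - b k) = (-∏ k, b k) * ∏ k, (1 - q * z / b k) := by
    simp only [Fin.prod_univ_three]
    have := hb 0; have := hb 1; have := hb 2
    field_simp
    ring
  have hP : ∏ k, (1 - q * z / b k) ≠ 0 := Finset.prod_ne_zero_iff.2 fun k _ => hk k
  have e2 : a 1 * (q * z) / q = a 1 * z := by field_simp
  rw [hbk, e2, Finset.prod_inv_distrib, Fin.prod_univ_three (f := fun i => 1 - a i * z)]
  generalize ∏ k, (1 - q * z / b k) = P at *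
  generalize (1 - a 1 * z) = y at *
  rcases eq_or_ne (∏ k, (1 - a 0 * b k)) 0 with h | h
  · simp [h]
  field_simp

theorem certificate_sub (hq0 : q ≠ 0) {a b : Fin 3 → ℂ} {j : Fin 3} (n : ℕ) (hb : ∀ k, b k ≠ 0)
    (ha0 : a 0 ≠ 0) (ha1 : a 1 ≠ 0) (hbal : (∏ j, a j) * ∏ j, b j = q)
    (h0 : ∀ k, 1 - a 0 * b k ≠ 0)
    (hk : ∀ k, 1 - q * (b j * q ^ n) / b k ≠ 0) (h1 : 1 - a 1 * (b j * q ^ n) ≠ 0)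
    (h1' : 1 - a 1 * (b j * q ^ n) / q ≠ 0) :
    certificate q a b j (n + 1) - certificate q a b j n =
      (∏ k, (1 - a 1 * b k / q) / (1 - a 0 * b k)) *
        ((1 - a 0 * (b j * q ^ n)) / (1 - a 1 * (b j * q ^ n) / q)) * seriesTerm q a b j n -
      a 1 / (q * a 0) * seriesTerm q a b j n := by
  rw [certificate_succ hq0 n hb hk h1, certificate]
  have hz : b j * q ^ n ≠ 0 := mul_ne_zero (hb j) (pow_ne_zero _ hq0)
  generalize b j * q ^ n = z at *
  generalize seriesTerm q a b j n = t
  rw [Fin.prod_univ_three, Fin.prod_univ_three] at hbal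
  -- With `z = b_j q^n`, the left side of the identity is a multiple of the shifted term minus the
  -- old one, and the two summands on the right are the new and the old certificate.
  have key := telescoping_identity (z := z) hq0 ha0 ha1 (hb 0) (hb 1) (hb 2) hbal
  rw [Finset.prod_div_distrib]
  have hP : ∏ k, (1 - a 0 * b k) ≠ 0 := Finset.prod_ne_zero_iff.2 fun k _ => h0 k
  have e1 : ∏ k, (1 - a 0 * b k) = (1 - a 0 * b 0) * (1 - a 0 * b 1) * (1 - a 0 * b 2) :=
    Fin.prod_univ_three _
  have e2 : ∏ k, (1 - a 1 * b k / q) = (1 - a 1 * b 0 / q) * (1 - a 1 * b 1 / q) *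
    (1 - a 1 * b 2 / q) := Fin.prod_univ_three _
  have e3 : ∏ k, (z - b k) = (z - b 0) * (z - b 1) * (z - b 2) := Fin.prod_univ_three _
  have e4 : ∏ k, b k = b 0 * b 1 * b 2 := Fin.prod_univ_three _
  rw [← e1, ← e2, ← e3, ← e4] at key
  generalize ∏ k, (1 - a 0 * b k) = P at *
  generalize ∏ k, (1 - a 1 * b k / q) = P' at *
  generalize ∏ k, (z - b k) = Q at *
  generalize ∏ k, b k = B at *
  generalize (1 - a 1 * z / q) = y at *
  generalize (a 1 / q) ^ 2 * (1 - q * a 0 / a 1) = c at *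
  generalize a 1 / (q * a 0) = x at *
  field_simp
  linear_combination (-t) * key

/-- The factor `q^n` of the series term cancels against `b_j q^n` in the denominator of the
certificate, so each series leaves a boundary term that in general is not zero. -/
theorem tendsto_certificate (hq0 : q ≠ 0) (hq1 : ‖q‖ < 1) {b : Fin 3 → ℂ}
    (hb : Inequivalent q b) (a : Fin 3 → ℂ) (j : Fin 3) :
    Tendsto (certificate q a b j) atTop
      (𝓝 ((a 1 / q) ^ 2 * (1 - q * a 0 / a 1) / (∏ k, (1 - a 0 * b k)) * (∏ k, b k) *
        ((∏ i, qInf q (a i * b j)) / (b j * ∏ k, qInf q (q * b j / b k))))) := by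
  have hqn : Tendsto (fun n : ℕ => q ^ n) atTop (𝓝 0) := tendsto_pow_atTop_nhds_zero_of_norm_lt_one hq1
  have h1 : Tendsto (fun n : ℕ => ∏ k, (b j * q ^ n - b k)) atTop (𝓝 (∏ k, (b j * 0 - b k))) :=
    tendsto_finsetProd _ fun k _ => ((hqn.const_mul _).sub_const _)
  have h2 : Tendsto (fun n : ℕ => 1 - a 1 * (b j * q ^ n) / q) atTop
      (𝓝 (1 - a 1 * (b j * 0) / q)) :=
    (((hqn.const_mul _).const_mul _).div_const _).const_sub _
  have h3 : Tendsto (fun n : ℕ => ∏ i, qPoch q (a i * b j) n) atTop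
      (𝓝 (∏ i, qInf q (a i * b j))) := tendsto_finsetProd _ fun i _ => tendsto_prod_qInf hq1 _
  have h4 : Tendsto (fun n : ℕ => ∏ k, (qPoch q (q * b j / b k) n)⁻¹) atTop
      (𝓝 (∏ k, (qInf q (q * b j / b k))⁻¹)) := tendsto_finsetProd _ fun i _ =>
    (tendsto_prod_qInf hq1 _).inv₀ (qInf_ne_zero hq1 (hb.mul_pow_ne_one hq0 hq1 j i))
  have h5 := ((h1.div h2 (by simp)).mul (h3.mul h4)).const_mul
    (-((a 1 / q) ^ 2 * (1 - q * a 0 / a 1)) / (∏ k, (1 - a 0 * b k)) / b j)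
  refine (h5.congr fun n => ?_).trans (le_of_eq ?_)
  · rw [certificate, seriesTerm]
    have := pow_ne_zero n hq0
    have := hb.1 j
    simp only [Pi.div_apply]
    rw [mul_comm (b j * q ^ n) (1 - _), ← div_div]
    generalize 1 - a 1 * (b j * q ^ n) / q = y
    field_simp
  · congr 1
    simp only [mul_zero, zero_sub, zero_div, sub_zero, Finset.prod_neg, Finset.prod_inv_distrib]
    simp
    ring

/-- For each `j` the combination of the shifted and the original series telescopes to a boundary
value `L j`. Only the sum over `j` of these values, weighted with the coefficients, vanishes. -/
theorem residueSum_shift (hq0 : q ≠ 0) (hq1 : ‖q‖ < 1) {a b lam : Fin 3 → ℂ}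
    (hb : Inequivalent q b) (ha0 : a 0 ≠ 0) (ha1 : a 1 ≠ 0) (hbal : (∏ j, a j) * ∏ j, b j = q)
    (h : ∏ i, lam i = q ^ 2 / ∏ i, b i) (hl0 : lam 0 ≠ 0) (hl1 : lam 1 ≠ 0)
    (h0 : ∀ k, 1 - a 0 * b k ≠ 0) (h1 : ∀ j (n : ℕ), 1 - a 1 * (b j * q ^ n) / q ≠ 0) :
    residueSum q ![q * a 0, a 1 / q, a 2] b lam = a 1 / (q * a 0) * residueSum q a b lam := by
  have h1' : ∀ j (n : ℕ), 1 - a 1 * (b j * q ^ n) ≠ 0 := fun j n hh => h1 j (n + 1) (by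
    rw [← hh, pow_succ]; field_simp)
  have hk : ∀ j k (n : ℕ), 1 - q * (b j * q ^ n) / b k ≠ 0 := fun j k n hh =>
    hb.mul_pow_ne_one hq0 hq1 j k n (by rw [sub_eq_zero] at hh; rw [hh]; ring)
  set L : Fin 3 → ℂ := fun j => (a 1 / q) ^ 2 * (1 - q * a 0 / a 1) / (∏ k, (1 - a 0 * b k)) *
    (∏ k, b k) * ((∏ i, qInf q (a i * b j)) / (b j * ∏ k, qInf q (q * b j / b k))) with hL
  have hj : ∀ j, offProd q ![q * a 0, a 1 / q, a 2] b j *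
      ∑' n, seriesTerm q ![q * a 0, a 1 / q, a 2] b j n - a 1 / (q * a 0) *
        (offProd q a b j * ∑' n, seriesTerm q a b j n) = offProd q a b j * L j := by
    intro j
    have hs := (summable_seriesTerm hq0 hq1 hb a j).hasSum.mul_left (a 1 / (q * a 0))
    have hs' := (summable_seriesTerm hq0 hq1 hb ![q * a 0, a 1 / q, a 2] j).hasSum.mul_left
      (∏ k ∈ Finset.univ.erase j, (1 - a 1 * b k / q) / (1 - a 0 * b k))
    have hd := (hs'.sub hs).tendsto_sum_nat
    have hc : ∀ N, ∑ n ∈ Finset.range N, ((∏ k ∈ Finset.univ.erase j,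
        (1 - a 1 * b k / q) / (1 - a 0 * b k)) * seriesTerm q ![q * a 0, a 1 / q, a 2] b j n -
        a 1 / (q * a 0) * seriesTerm q a b j n) = certificate q a b j N := by
      intro N
      rw [← sub_zero (certificate q a b j N), ← certificate_zero q a b j,
        ← Finset.sum_range_sub]
      refine Finset.sum_congr rfl fun n _ => ?_
      rw [certificate_sub hq0 n hb.1 ha0 ha1 hbal h0 (fun k => hk j k n) (h1' j n) (h1 j n),
        seriesTerm_shift hq0 (h0 j) n (h1 j n), ← Finset.mul_prod_erase _ _ (Finset.mem_univ j)]
      ring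
    have := tendsto_nhds_unique (hd.congr hc) (tendsto_certificate hq0 hq1 hb a j)
    rw [offProd_shift hq0 hq1 j h0, hL]
    simp only
    rw [← this]
    ring
  -- Multiplication by `offProd` completes the products in `L j` to a factor common to all `j`.
  have hsum : ∑ j, seriesCoeff q b lam j * (offProd q a b j * L j) = 0 := by
    have h2 : ∀ j, seriesCoeff q b lam j * (offProd q a b j * L j) =
        ((a 1 / q) ^ 2 * (1 - q * a 0 / a 1) / (∏ k, (1 - a 0 * b k)) * (∏ k, b k) *
          ∏ i, ∏ k, qInf q (a i * b k)) *
          (seriesCoeff q b lam j / (b j * ∏ i, qInf q (q * b j / b i))) := by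
      intro j
      have h3 : ∏ i, ∏ k, qInf q (a i * b k) = (∏ i, qInf q (a i * b j)) * offProd q a b j := by
        rw [offProd, ← Finset.prod_mul_distrib]
        exact Finset.prod_congr rfl fun i _ =>
          (Finset.mul_prod_erase _ (fun k => qInf q (a i * b k)) (Finset.mem_univ j)).symm
      rw [h3, hL]
      ring
    rw [Finset.sum_congr rfl fun j _ => h2 j, ← Finset.mul_sum,
      sum_seriesCoeff_div hq0 hq1 hb h hl0 hl1, mul_zero]
  rw [← sub_eq_zero, ← hsum, residueSum, residueSum, Finset.mul_sum, ← Finset.sum_sub_distrib]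
  refine Finset.sum_congr rfl fun j _ => ?_
  rw [← hj j]
  ring

end Contiguity

/-! ### Closed form of the residue sum. -/

section ResidueSum

variable {q : ℂ}

/-- A single term survives on the left. On the right `θ(x / a₁) = θ(x b_j)` splits off, and what
remains is the addition formula. -/
theorem residueSum_eq_of_mul_eq_one (hq0 : q ≠ 0) (hq1 : ‖q‖ < 1) {a b lam : Fin 3 → ℂ}
    (hb : Inequivalent q b) (ha : ∀ i, a i ≠ 0) (hbal : (∏ j, a j) * ∏ j, b j = q)
    (h : ∏ i, lam i = q * ∏ i, a i) (hl0 : lam 0 ≠ 0) (hl1 : lam 1 ≠ 0)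
    (hab : ∀ j (n : ℤ), a 2 * b j ≠ q ^ n) {j k l : Fin 3}
    (hjk : j ≠ k) (hjl : j ≠ l) (hkl : k ≠ l) (h1 : a 0 * b j = 1) :
    qInf q q * theta q (lam 0 / lam 1) * residueSum q a b lam =
      normDenom q a b (lam 0) (lam 1) := by
  have hu : (Finset.univ : Finset (Fin 3)).erase j = {k, l} := by
    clear h1; revert j k l; decide
  have hu' : (Finset.univ : Finset (Fin 3)) = {j, k, l} := by
    clear h1 hu; revert j k l; decide
  have hprod : ∀ f : Fin 3 → ℂ, ∏ i, f i = f j * (f k * f l) := by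
    intro f
    rw [hu', Finset.prod_insert (by simp [hjk, hjl]), Finset.prod_pair hkl]
  have hbj := hb.1 j
  have ha0 : a 0 = 1 / b j := by rw [eq_div_iff hbj, h1]
  have hbal' : a 2 * a 1 * b k * b l = q := by
    rw [Fin.prod_univ_three, hprod] at hbal
    linear_combination hbal - a 2 * a 1 * b k * b l * h1
  have hx : ∀ x, x / a 0 = x * b j := fun x => by rw [ha0, div_div_eq_mul_div, div_one]
  -- Because `a₁ b_j = 1`, the four parameters `a₃`, `a₂`, `b_k`, `b_l` have product `q`, as the
  -- formula requires.
  have hW := theta_addition hq0 hq1 (ha 2) (ha 1) (hb.1 k) (hb.1 l) hl1 hbal' (hb.2 k l hkl)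
    (hab k) (hab l) hl0
  have e2 : q * a 2 * a 1 / lam 1 / lam 0 = lam 2 * b j := by
    rw [Fin.prod_univ_three, Fin.prod_univ_three] at h
    rw [div_div, div_eq_iff (mul_ne_zero hl1 hl0)]
    linear_combination (-b j) * h - q * a 1 * a 2 * h1
  have hne : ∀ i, i ≠ j → qInf q (b i / b j) ≠ 0 := fun i hi =>
    qInf_ne_zero hq1 fun n hn => hb.2 j i hi.symm n (by
      rw [div_mul_eq_mul_div, div_eq_one_iff_eq hbj] at hn
      rw [← hn, zpow_natCast, mul_comm])
  have hk := hne k hjk.symm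
  have hl := hne l hjl.symm
  have hqq : qInf q q ≠ 0 := qInf_q_ne_zero hq1
  have t1 : theta q (a 2 * b k) = qInf q (a 2 * b k) * qInf q (a 1 * b l) := by
    rw [theta]; congr 2
    rw [div_eq_iff (mul_ne_zero (ha 2) (hb.1 k)), ← hbal']; ring
  have t2 : theta q (a 2 * b l) = qInf q (a 2 * b l) * qInf q (a 1 * b k) := by
    rw [theta]; congr 2
    rw [div_eq_iff (mul_ne_zero (ha 2) (hb.1 l)), ← hbal']; ring
  have t3 : ∀ i, a 0 * b i = b i / b j := fun i => by rw [ha0]; ring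
  rw [residueSum_of_mul_eq_one hq1 h1, seriesCoeff, offProd, normDenom, hu,
    Finset.prod_pair hkl]
  simp only [Finset.prod_pair hkl]
  simp only [Finset.prod_mul_distrib, Fin.prod_univ_three (f := fun i => theta q (_ / a i)),
    hprod (fun i => theta q (_ * b i)), hx]
  simp only [Fin.prod_univ_three, t3]
  rw [e2, t1, t2] at hW
  generalize theta q (lam 2 * b j) = t at *
  generalize qInf q (a 1 * b k) = u at *
  generalize qInf q (a 2 * b k) = u' at *
  generalize qInf q (a 1 * b l) = v at *
  generalize qInf q (a 2 * b l) = v' at *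
  generalize lam 0 / lam 1 = r at *
  generalize theta q (lam 1 * b j) = x at *
  generalize theta q (lam 1 * b k) = y at *
  generalize theta q (lam 1 * b l) = z at *
  field_simp
  linear_combination (-(theta q (lam 0 * b j) * x)) * hW

/-- The sum of the residues of the weight in closed form. -/
theorem residueSum_eq (hq0 : q ≠ 0) (hq1 : ‖q‖ < 1) {a b lam : Fin 3 → ℂ}
    (hb : Inequivalent q b) (ha : ∀ i, a i ≠ 0) (hbal : (∏ j, a j) * ∏ j, b j = q)
    (h : ∏ i, lam i = q * ∏ i, a i) (hl0 : lam 0 ≠ 0) (hl1 : lam 1 ≠ 0)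
    (hab : ∀ j (n : ℤ), a 2 * b j ≠ q ^ n) :
    qInf q q * theta q (lam 0 / lam 1) * residueSum q a b lam =
      normDenom q a b (lam 0) (lam 1) := by
  -- The deformation keeps the product of the `a_i`, and hence balancing, and replacing `s` by `q s`
  -- is exactly the contiguous shift.
  set A : ℂ → Fin 3 → ℂ := fun s => ![a 0 * s, a 1 / s, a 2] with hA
  have hA0 : ∀ s, A s 0 = a 0 * s := fun s => rfl
  have hA1 : ∀ s, A s 1 = a 1 / s := fun s => rfl
  have hA2 : ∀ s, A s 2 = a 2 := fun s => rfl
  have hAprod : ∀ s ≠ 0, ∏ i, A s i = ∏ i, a i := by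
    intro s hs
    rw [Fin.prod_univ_three, Fin.prod_univ_three, hA0, hA1, hA2]
    field_simp
  have hAne : ∀ s ≠ 0, ∀ i, A s i ≠ 0 := by
    intro s hs i
    fin_cases i
    · exact mul_ne_zero (ha 0) hs
    · exact div_ne_zero (ha 1) hs
    · exact ha 2
  have hAan : ∀ s ≠ 0, ∀ i, AnalyticAt ℂ (fun s => A s i) s := by
    intro s hs i
    fin_cases i
    · exact analyticAt_const.mul analyticAt_id
    · exact analyticAt_const.div analyticAt_id hs
    · exact analyticAt_const
  have hRan : ∀ s ≠ 0, AnalyticAt ℂ (fun s => residueSum q (A s) b lam) s := by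
    intro s hs
    unfold residueSum offProd
    refine Finset.analyticAt_fun_sum _ fun j _ => ?_
    refine AnalyticAt.mul (analyticAt_const.mul ?_)
      (analyticAt_tsum_seriesTerm hq0 hq1 hb j (hAan s hs))
    refine Finset.analyticAt_fun_prod _ fun i _ => Finset.analyticAt_fun_prod _ fun k _ => ?_
    exact (analyticAt_qInf hq1 _).fun_comp ((hAan s hs i).mul analyticAt_const)
  have hNan : ∀ s ≠ 0, AnalyticAt ℂ (fun s => normDenom q (A s) b (lam 0) (lam 1)) s := by
    intro s hs
    have h1 : ∀ c ≠ 0, ∀ i, AnalyticAt ℂ (fun s => theta q (c / A s i)) s := fun c hc i =>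
      AnalyticAt.fun_comp (f := fun s => c / A s i)
        (analyticAt_theta hq1 (div_ne_zero hc (hAne s hs i)))
        (analyticAt_const.fun_div (hAan s hs i) (hAne s hs i))
    unfold normDenom
    refine AnalyticAt.sub ?_ (analyticAt_const.mul ?_)
    · exact Finset.analyticAt_fun_prod _ fun i _ => (h1 _ hl0 i).mul analyticAt_const
    · exact Finset.analyticAt_fun_prod _ fun i _ => analyticAt_const.mul (h1 _ hl1 i)
  have hq1' : ∏ i, b i ≠ 0 := Finset.prod_ne_zero_iff.2 fun i _ => hb.1 i
  have hlam' : ∏ i, lam i = q ^ 2 / ∏ i, b i := by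
    rw [h, eq_div_iff hq1', mul_assoc, hbal, sq]
  -- The contiguity relation needs nonvanishing denominators, which fails only for countably many
  -- `s`; continuity covers these.
  have hR : ∀ s ≠ 0, s ^ 2 * residueSum q (A (q * s)) b lam =
      a 1 / (q * a 0) * residueSum q (A s) b lam := by
    set N : Set ℂ := (⋃ k, {s | a 0 * s * b k = 1}) ∪
      ⋃ j, ⋃ n : ℕ, {s | s = a 1 * (b j * q ^ n) / q} with hN
    have hNc : N.Countable := by
      refine Countable.union (countable_iUnion fun k => ?_)
        (countable_iUnion fun j => countable_iUnion fun n => ?_)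
      · refine (countable_singleton (1 / (a 0 * b k))).mono fun s hs => ?_
        rw [mem_singleton_iff, eq_div_iff (mul_ne_zero (ha 0) (hb.1 k)), ← hs.out]
        ring
      · exact countable_singleton _
    refine eq_of_eq_off_countable hNc (fun s hs => ?_) (fun s hs => ?_) fun s hs hsN => ?_
    · have hqs : q * s ≠ 0 := mul_ne_zero hq0 hs
      exact ((analyticAt_id.pow 2).mul ((hRan _ hqs).fun_comp
        (analyticAt_const.mul analyticAt_id))).continuousAt
    · exact (analyticAt_const.mul (hRan s hs)).continuousAt
    · have e : A (q * s) = ![q * A s 0, A s 1 / q, A s 2] := by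
        rw [hA0, hA1, hA2, hA]
        simp only [div_div]
        rw [mul_left_comm, mul_comm q s]
      rw [e, residueSum_shift hq0 hq1 hb (hAne s hs 0) (hAne s hs 1) (by rw [hAprod s hs, hbal])
        hlam' hl0 hl1, hA0, hA1]
      · have := ha 0
        field_simp
      · intro k hk
        exact hsN (Or.inl (mem_iUnion.2 ⟨k, (sub_eq_zero.1 hk).symm⟩))
      · intro j n hk
        refine hsN (Or.inr (mem_iUnion.2 ⟨j, mem_iUnion.2 ⟨n, ?_⟩⟩))
        rw [hA1, sub_eq_zero] at hk
        rw [mem_ofPred_eq, eq_div_iff hq0]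
        field_simp at hk
        linear_combination hk
  have hD : ∀ s ≠ 0, s ^ 2 * normDenom q (A (q * s)) b (lam 0) (lam 1) =
      a 1 / (q * a 0) * normDenom q (A s) b (lam 0) (lam 1) := by
    intro s hs
    have ht : ∀ c ≠ 0, theta q (c / A (q * s) 0) * theta q (c / A (q * s) 1) =
        a 1 / (q * a 0) / s ^ 2 * (theta q (c / A s 0) * theta q (c / A s 1)) := by
      intro c hc
      have e0 : c / A (q * s) 0 = c / A s 0 / q := by
        rw [hA0, hA0, div_div]; ring_nf
      have e1 : c / A (q * s) 1 = q * (c / A s 1) := by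
        rw [hA1, hA1]; have := ha 1; field_simp
      rw [e0, e1, theta_div_q hq0 hq1 (div_ne_zero hc (hAne s hs 0)),
        theta_mul_q hq0 hq1 (div_ne_zero hc (hAne s hs 1)), hA0, hA1]
      have := ha 0; have := ha 1
      field_simp
    have h0 := ht _ hl0
    have h1 := ht _ hl1
    simp only [normDenom, Finset.prod_mul_distrib, Fin.prod_univ_three
      (f := fun i => theta q (_ / A _ i)), h0, h1]
    simp only [hA2]
    field_simp
  -- The test points `1 / (a₁ b_j)` are those where the deformed parameters satisfy `A s 0 * b j =
  -- 1`. They are inequivalent because the `b_j` are.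
  have hzero := eq_zero_of_three_zeros (q := q) hq0 hq1 (κ := a 1 / (q * a 0))
    (E := fun s => qInf q q * theta q (lam 0 / lam 1) * residueSum q (A s) b lam -
      normDenom q (A s) b (lam 0) (lam 1)) (div_ne_zero (ha 1) (mul_ne_zero hq0 (ha 0)))
    (fun s hs => (analyticAt_const.mul (hRan s hs)).sub (hNan s hs))
    (fun s hs => by
      rw [mul_sub, hD s hs, mul_left_comm, hR s hs]
      ring)
    (x := fun j => 1 / (a 0 * b j))
    (fun j => div_ne_zero one_ne_zero (mul_ne_zero (ha 0) (hb.1 j)))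
    (fun i j hij n hn => hb.2 j i hij.symm n (by
      have := ha 0; have := hb.1 i; have := hb.1 j
      field_simp at hn
      rw [hn, mul_comm]))
    (fun j => by
      have hs : 1 / (a 0 * b j) ≠ 0 := div_ne_zero one_ne_zero (mul_ne_zero (ha 0) (hb.1 j))
      obtain ⟨k, l, hjk, hjl, hkl⟩ : ∃ k l : Fin 3, j ≠ k ∧ j ≠ l ∧ k ≠ l := by
        clear hs; revert j; decide
      refine sub_eq_zero.2 (residueSum_eq_of_mul_eq_one hq0 hq1 hb (hAne _ hs)
        (by rw [hAprod _ hs, hbal]) (by rw [hAprod _ hs, h]) hl0 hl1 hab hjk hjl hkl ?_)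
      rw [hA0]
      have := ha 0; have := hb.1 j
      field_simp)
  have h1 := sub_eq_zero.1 (hzero 1 one_ne_zero)
  have hA' : A 1 = a := by
    ext i
    fin_cases i <;> simp [hA]
  rwa [hA'] at h1

end ResidueSum

/-! ### The `q`-orbits of the parameters and the possible poles. -/

section Orbits

variable {q : ℂ}

/-- The union of the `q`-orbits of the points `c j`. -/
def orbit (q : ℂ) (c : Fin 3 → ℂ) : Set ℂ := {z | ∃ (j : Fin 3) (m : ℤ), z = c j * q ^ m}

theorem countable_orbit (q : ℂ) (c : Fin 3 → ℂ) : (orbit q c).Countable := by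
  have : orbit q c = range fun x : Fin 3 × ℤ => c x.1 * q ^ x.2 := by
    ext z
    simp [orbit, eq_comm]
  rw [this]
  exact countable_range _

theorem ne_zero_of_mem_orbit (hq0 : q ≠ 0) {c : Fin 3 → ℂ} (hc : ∀ j, c j ≠ 0) {z : ℂ}
    (hz : z ∈ orbit q c) : z ≠ 0 := by
  obtain ⟨j, m, rfl⟩ := hz
  exact mul_ne_zero (hc j) (zpow_ne_zero _ hq0)

theorem exists_zpow_lt (hq0 : q ≠ 0) (hq1 : ‖q‖ < 1) {r : ℝ} (hr : 0 < r) :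
    ∃ n : ℕ, ∀ m : ℤ, n ≤ m → ‖q‖ ^ m < r := by
  obtain ⟨n, hn⟩ := exists_pow_lt_of_lt_one hr hq1
  refine ⟨n, fun m hm => (zpow_right_anti₀ (norm_pos_iff.2 hq0) hq1.le hm).trans_lt ?_⟩
  simpa using hn

theorem finite_orbit_inter (hq0 : q ≠ 0) (hq1 : ‖q‖ < 1) {c : Fin 3 → ℂ} (hc : ∀ j, c j ≠ 0)
    {r : ℝ} (hr : 0 < r) (R : ℝ) : {z | z ∈ orbit q c ∧ r ≤ ‖z‖ ∧ ‖z‖ ≤ R}.Finite := by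
  have hq : 0 < ‖q‖ := norm_pos_iff.2 hq0
  have h : ∀ j, ∃ n n' : ℕ, ∀ m : ℤ, r ≤ ‖c j * q ^ m‖ → ‖c j * q ^ m‖ ≤ R →
      m ∈ Finset.Icc (-n' : ℤ) n := by
    intro j
    have hcj : 0 < ‖c j‖ := norm_pos_iff.2 (hc j)
    obtain ⟨n, hn⟩ := exists_zpow_lt hq0 hq1 (div_pos hr hcj)
    obtain ⟨n', hn'⟩ := exists_zpow_lt hq0 hq1 (div_pos hcj (by positivity : 0 < |R| + 1))
    refine ⟨n, n', fun m h1 h2 => Finset.mem_Icc.2 ⟨?_, ?_⟩⟩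
    · by_contra! hm
      have h3 := hn' (-m) (by omega)
      rw [norm_mul, norm_zpow] at h2
      rw [zpow_neg, lt_div_iff₀ (by positivity), inv_mul_lt_iff₀ (zpow_pos hq m)] at h3
      linarith [le_abs_self R]
    · by_contra! hm
      have h3 := hn m hm.le
      rw [norm_mul, norm_zpow] at h1
      rw [lt_div_iff₀ hcj] at h3
      linarith
  choose n n' hn using h
  refine (Set.finite_iUnion fun j => (Set.Finite.image (fun m : ℤ => c j * q ^ m)
    (Finset.Icc (-n' j : ℤ) (n j)).finite_toSet)).subset ?_
  rintro z ⟨⟨j, m, rfl⟩, h1, h2⟩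
  exact mem_iUnion.2 ⟨j, m, hn j m h1 h2, rfl⟩

theorem mul_zpow_mem_orbit (q : ℂ) {c : Fin 3 → ℂ} {z : ℂ} (hz : z ∈ orbit q c) (hq0 : q ≠ 0)
    (n : ℤ) : z * q ^ n ∈ orbit q c := by
  obtain ⟨j, m, rfl⟩ := hz
  exact ⟨j, m + n, by rw [zpow_add₀ hq0, mul_assoc]⟩

end Orbits

/-- The standing assumptions on the parameters. -/
structure Generic (q : ℂ) (a b : Fin 3 → ℂ) : Prop where
  q_ne : q ≠ 0
  norm_q : ‖q‖ < 1
  bal : (∏ j, a j) * ∏ j, b j = q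
  aa : Inequivalent q a
  bb : Inequivalent q b
  ab : ∀ i j (n : ℤ), a i * b j ≠ q ^ n

/-- The possible poles of the integrand away from the origin. -/
def candidates (q : ℂ) (a b : Fin 3 → ℂ) : Set ℂ := orbit q b ∪ orbit q a⁻¹

namespace Generic

variable {q : ℂ} {a b : Fin 3 → ℂ}

theorem inv_ne (h : Generic q a b) (j : Fin 3) : a⁻¹ j ≠ 0 := inv_ne_zero (h.aa.1 j)

theorem notMem_orbit_inv (h : Generic q a b) {z : ℂ} (hz : z ∈ orbit q b) : z ∉ orbit q a⁻¹ := by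
  rintro ⟨i, m, hm⟩
  obtain ⟨j, n, rfl⟩ := hz
  refine h.ab i j (m - n) ?_
  have := h.aa.1 i
  rw [Pi.inv_apply] at hm
  rw [zpow_sub₀ h.q_ne, eq_div_iff (zpow_ne_zero _ h.q_ne), mul_assoc, hm]
  field_simp

theorem countable_candidates (_ : Generic q a b) : (candidates q a b).Countable :=
  (countable_orbit q b).union (countable_orbit q _)

theorem ne_zero_of_mem_candidates (h : Generic q a b) {z : ℂ} (hz : z ∈ candidates q a b) :
    z ≠ 0 :=
  hz.elim (ne_zero_of_mem_orbit h.q_ne h.bb.1) (ne_zero_of_mem_orbit h.q_ne h.inv_ne)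

theorem finite_candidates_inter (h : Generic q a b) {r : ℝ} (hr : 0 < r) (R : ℝ) :
    {z | z ∈ candidates q a b ∧ r ≤ ‖z‖ ∧ ‖z‖ ≤ R}.Finite := by
  refine ((finite_orbit_inter h.q_ne h.norm_q h.bb.1 hr R).union
    (finite_orbit_inter h.q_ne h.norm_q h.inv_ne hr R)).subset ?_
  rintro z ⟨hz | hz, h'⟩
  · exact Or.inl ⟨hz, h'⟩
  · exact Or.inr ⟨hz, h'⟩

theorem exists_isolated (h : Generic q a b) {p : ℂ} (hp : p ∈ candidates q a b) :
    ∃ ε > 0, ∀ w ∈ insert 0 (candidates q a b), w ≠ p → ε < ‖w - p‖ := by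
  have hp0 : 0 < ‖p‖ := norm_pos_iff.2 (h.ne_zero_of_mem_candidates hp)
  have hfin := h.finite_candidates_inter (half_pos hp0) (2 * ‖p‖)
  have h1 : ∀ᶠ z in 𝓝 p, z ∉ {z | z ∈ candidates q a b ∧ ‖p‖ / 2 ≤ ‖z‖ ∧ ‖z‖ ≤ 2 * ‖p‖} \ {p} :=
    (hfin.subset sdiff_subset).isClosed.isOpen_compl.mem_nhds (by simp)
  obtain ⟨ε, hε, h2⟩ := Metric.eventually_nhds_iff.1 h1
  refine ⟨min (ε / 2) (‖p‖ / 4), by positivity, fun w hw hwp => ?_⟩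
  by_contra! h3
  have h4 : ‖w - p‖ ≤ ε / 2 := h3.trans (min_le_left _ _)
  have h5 : ‖w - p‖ ≤ ‖p‖ / 4 := h3.trans (min_le_right _ _)
  have h6 : ‖p‖ - ‖w‖ ≤ ‖w - p‖ := by rw [norm_sub_rev]; exact norm_sub_norm_le _ _
  have h7 : ‖w‖ - ‖p‖ ≤ ‖w - p‖ := norm_sub_norm_le _ _
  rcases hw with rfl | hw
  · rw [norm_zero] at h6
    linarith
  · refine h2 (by rw [dist_eq_norm]; linarith) ⟨⟨hw, ?_, ?_⟩, hwp⟩ <;> linarith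

/-- Circles around the origin that avoid the candidates, together with all their `q`-dilates. -/
theorem exists_radius (h : Generic q a b) {δ : ℝ} (hδ : 0 < δ) :
    ∃ ρ, 0 < ρ ∧ ρ < δ ∧ ∀ (N : ℕ), ∀ z ∈ candidates q a b, ‖z‖ ≠ ρ * ‖q‖ ^ N := by
  have hc : ((fun z : ℂ => ‖z‖) '' candidates q a b).Countable := h.countable_candidates.image _
  have : (Ioo 0 δ ∩ ((fun z : ℂ => ‖z‖) '' candidates q a b)ᶜ).Nonempty :=
    (hc.dense_compl ℝ).inter_open_nonempty _ isOpen_Ioo (nonempty_Ioo.2 hδ)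
  obtain ⟨ρ, ⟨h1, h2⟩, h3⟩ := this
  -- The candidates are invariant under powers of `q`, so a candidate of norm `ρ ‖q‖ ^ N` would give
  -- one of norm `ρ`.
  refine ⟨ρ, h1, h2, fun N z hz hzρ => h3 ⟨z * q ^ (-N : ℤ), ?_, ?_⟩⟩
  · exact hz.imp (fun hz => mul_zpow_mem_orbit q hz h.q_ne _)
      fun hz => mul_zpow_mem_orbit q hz h.q_ne _
  · have : ‖q‖ ≠ 0 := norm_ne_zero_iff.2 h.q_ne
    simp only [norm_mul, hzρ, zpow_neg, zpow_natCast, norm_inv, norm_pow]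
    field_simp

end Generic

/-! ### Poles and residues of the weight. -/

section Weight

variable {q : ℂ} {a b lam : Fin 3 → ℂ}

theorem weight_eq (q : ℂ) (a b lam : Fin 3 → ℂ) (z : ℂ) : weight q a b lam z =
    (∏ j, theta q (lam j * z)) * (∏ j, (qInf q (a j * z))⁻¹) * ∏ j, (qInf q (b j / z))⁻¹ := by
  rw [weight, ← Finset.prod_mul_distrib, ← Finset.prod_mul_distrib]
  exact Finset.prod_congr rfl fun j _ => by rw [div_eq_mul_inv, mul_inv]; ring

theorem prod_one_sub_div (hq0 : q ≠ 0) {x : ℂ} (hx : x ≠ 0) (n : ℕ) :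
    ∏ i ∈ Finset.range n, (1 - x / q ^ (i + 1)) =
      (-x) ^ n * q ^ (-binomTwo (n + 1)) * qPoch q (q / x) n := by
  induction n with
  | zero => simp [qPoch_zero, binomTwo]
  | succ n ih =>
    have := pow_ne_zero n hq0
    rw [Finset.prod_range_succ, ih, qPoch_succ, pow_succ (-x), Nat.cast_succ,
      binomTwo_add_one (n + 1), neg_add, zpow_add₀ hq0, zpow_neg q (n + 1), ← Nat.cast_succ,
      zpow_natCast, pow_succ]
    field_simp
    ring

theorem qInf_div_pow (hq0 : q ≠ 0) (hq1 : ‖q‖ < 1) (x : ℂ) (n : ℕ) :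
    qInf q (x / q ^ n) = (∏ i ∈ Finset.range n, (1 - x / q ^ (i + 1))) * qInf q x := by
  induction n with
  | zero => simp
  | succ n ih =>
    have := pow_ne_zero n hq0
    rw [qInf_eq hq1, Finset.prod_range_succ, mul_right_comm, ← ih, mul_comm, pow_succ]
    congr 2
    field_simp

theorem analyticAt_qInf_mul (hq1 : ‖q‖ < 1) (c z : ℂ) : AnalyticAt ℂ (fun z => qInf q (c * z)) z :=
  (analyticAt_qInf hq1 _).fun_comp (analyticAt_const.mul analyticAt_id)

theorem analyticAt_qInf_div (hq1 : ‖q‖ < 1) (c : ℂ) {z : ℂ} (hz : z ≠ 0) :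
    AnalyticAt ℂ (fun z => qInf q (c / z)) z :=
  AnalyticAt.fun_comp (f := fun z => c / z) (analyticAt_qInf hq1 _)
    (analyticAt_const.fun_div analyticAt_id hz)

theorem analyticAt_prod_theta (hq1 : ‖q‖ < 1) (hl : ∀ j, lam j ≠ 0) {z : ℂ} (hz : z ≠ 0) :
    AnalyticAt ℂ (fun z => ∏ j, theta q (lam j * z)) z :=
  Finset.analyticAt_fun_prod _ fun j _ =>
    AnalyticAt.fun_comp (f := fun z => lam j * z) (analyticAt_theta hq1 (mul_ne_zero (hl j) hz))
      (analyticAt_const.mul analyticAt_id)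

theorem analyticAt_weight (hq1 : ‖q‖ < 1) (hl : ∀ j, lam j ≠ 0) {z : ℂ} (hz : z ≠ 0)
    (ha : ∀ j (n : ℕ), a j * z * q ^ n ≠ 1) (hb : ∀ j (n : ℕ), b j / z * q ^ n ≠ 1) :
    AnalyticAt ℂ (weight q a b lam) z := by
  rw [funext (weight_eq q a b lam)]
  refine ((analyticAt_prod_theta hq1 hl hz).mul ?_).mul ?_
  · exact Finset.analyticAt_fun_prod _ fun j _ =>
      (analyticAt_qInf_mul hq1 _ _).inv (qInf_ne_zero hq1 (ha j))
  · exact Finset.analyticAt_fun_prod _ fun j _ =>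
      (analyticAt_qInf_div hq1 _ hz).inv (qInf_ne_zero hq1 (hb j))

namespace Generic

theorem mul_pow_ne_one (h : Generic q a b) {z : ℂ} (hz : z ∈ orbit q b) (j : Fin 3) (n : ℕ) :
    a j * z * q ^ n ≠ 1 := by
  obtain ⟨i, m, rfl⟩ := hz
  intro h1
  refine h.ab j i (-(m + n)) ?_
  rw [zpow_neg]
  refine eq_inv_of_mul_eq_one_left ?_
  rw [zpow_add₀ h.q_ne, zpow_natCast, ← h1]
  ring

theorem div_mul_pow_ne_one (h : Generic q a b) {z : ℂ} (hz : z ∈ orbit q a⁻¹) (j : Fin 3)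
    (n : ℕ) : b j / z * q ^ n ≠ 1 := by
  obtain ⟨i, m, rfl⟩ := hz
  intro h1
  have := h.aa.1 i
  have hm := zpow_ne_zero m h.q_ne
  refine h.ab i j (m - n) ?_
  rw [Pi.inv_apply] at h1
  rw [zpow_sub₀ h.q_ne, zpow_natCast, eq_div_iff (pow_ne_zero _ h.q_ne)]
  field_simp at h1
  linear_combination h1

theorem div_mul_pow_ne_one_of_ne (h : Generic q a b) {j k : Fin 3} (hjk : j ≠ k) (m : ℤ) (n : ℕ) :
    b k / (b j * q ^ m) * q ^ n ≠ 1 := by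
  intro h1
  have := h.bb.1 j
  have hm := zpow_ne_zero m h.q_ne
  refine h.bb.2 k j hjk.symm (m - n) ?_
  rw [zpow_sub₀ h.q_ne, zpow_natCast, div_mul_eq_mul_div, eq_div_iff (pow_ne_zero _ h.q_ne)]
  field_simp at h1
  linear_combination h1

theorem mul_pow_ne_one_of_ne (h : Generic q a b) {j k : Fin 3} (hjk : j ≠ k) (m : ℤ) (n : ℕ) :
    a k * (a⁻¹ j * q ^ m) * q ^ n ≠ 1 := by
  intro h1
  have := h.aa.1 j
  have hm := zpow_ne_zero m h.q_ne
  refine h.aa.2 j k hjk (m + n) ?_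
  rw [Pi.inv_apply] at h1
  rw [zpow_add₀ h.q_ne, zpow_natCast]
  field_simp at h1
  linear_combination -h1

theorem mul_pow_ne_one_of_pos (h : Generic q a b) (j : Fin 3) {m : ℤ} (hm : 0 < m) (n : ℕ) :
    a j * (a⁻¹ j * q ^ m) * q ^ n ≠ 1 := by
  intro h1
  rw [Pi.inv_apply, mul_inv_cancel_left₀ (h.aa.1 j), ← zpow_natCast, ← zpow_add₀ h.q_ne,
    ← zpow_zero q] at h1
  have := zpow_injective h.q_ne h.norm_q h1
  omega

theorem div_mul_pow_ne_one_of_neg (h : Generic q a b) (j : Fin 3) {m : ℤ} (hm : m < 0) (n : ℕ) :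
    b j / (b j * q ^ m) * q ^ n ≠ 1 := by
  intro h1
  have e : b j / (b j * q ^ m) * q ^ n = q ^ (-m + n) := by
    have := h.bb.1 j
    rw [zpow_add₀ h.q_ne, zpow_neg, zpow_natCast]
    field_simp
  rw [e, ← zpow_zero q] at h1
  have := zpow_injective h.q_ne h.norm_q h1
  omega

theorem analyticAt_weight_of_notMem (h : Generic q a b) (hl : ∀ j, lam j ≠ 0) {z : ℂ} (hz : z ≠ 0)
    (hzc : z ∉ candidates q a b) : AnalyticAt ℂ (weight q a b lam) z := by
  refine analyticAt_weight h.norm_q hl hz (fun j n h1 => hzc ?_) fun j n h1 => hzc ?_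
  · have := h.aa.1 j
    refine Or.inr ⟨j, -n, ?_⟩
    rw [Pi.inv_apply, zpow_neg, zpow_natCast, ← mul_inv]
    refine eq_inv_of_mul_eq_one_left ?_
    rw [← h1]
    ring
  · refine Or.inl ⟨j, n, ?_⟩
    rw [div_mul_eq_mul_div, div_eq_one_iff_eq hz] at h1
    rw [zpow_natCast, h1]

/-- On the half-orbit where elements of `W` may have poles the weight has none, so the poles of the
product stay simple. -/
theorem analyticAt_weight_b (h : Generic q a b) (hl : ∀ j, lam j ≠ 0) (j : Fin 3) {m : ℤ}
    (hm : m < 0) : AnalyticAt ℂ (weight q a b lam) (b j * q ^ m) := by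
  refine analyticAt_weight h.norm_q hl (mul_ne_zero (h.bb.1 j) (zpow_ne_zero _ h.q_ne))
    (h.mul_pow_ne_one ⟨j, m, rfl⟩) fun k n => ?_
  rcases eq_or_ne j k with rfl | hjk
  · exact h.div_mul_pow_ne_one_of_neg j hm n
  · exact h.div_mul_pow_ne_one_of_ne hjk m n

theorem analyticAt_weight_a (h : Generic q a b) (hl : ∀ j, lam j ≠ 0) (j : Fin 3) {m : ℤ}
    (hm : 0 < m) : AnalyticAt ℂ (weight q a b lam) (a⁻¹ j * q ^ m) := by
  refine analyticAt_weight h.norm_q hl (mul_ne_zero (h.inv_ne j) (zpow_ne_zero _ h.q_ne))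
    (fun k n => ?_) (h.div_mul_pow_ne_one ⟨j, m, rfl⟩)
  rcases eq_or_ne j k with rfl | hjk
  · exact h.mul_pow_ne_one_of_pos j hm n
  · exact h.mul_pow_ne_one_of_ne hjk m n

/-- The poles of the weight inside the contour. -/
theorem hasSimplePole_weight_b (h : Generic q a b) (hl : ∀ j, lam j ≠ 0)
    (hlb : (∏ j, lam j) * ∏ j, b j = q ^ 2) (j : Fin 3) (n : ℕ) :
    HasSimplePole (weight q a b lam) (b j * q ^ n)
      (b j * q ^ n * (seriesCoeff q b lam j * seriesTerm q a b j n) /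
        ∏ i, qInf q (a i * b j)) := by
  set p := b j * q ^ n with hp
  have hpo : p ∈ orbit q b := ⟨j, n, by rw [hp, zpow_natCast]⟩
  have hp0 : p ≠ 0 := ne_zero_of_mem_orbit h.q_ne h.bb.1 hpo
  have hbj := h.bb.1 j
  have hqn := pow_ne_zero n h.q_ne
  have h1 := HasSimplePole.inv_qInf (f := fun z => b j / z) (p := p) (n := n) h.q_ne h.norm_q
    (analyticAt_const.fun_div analyticAt_id hp0) ((hasDerivAt_const p (b j)).fun_div
      (hasDerivAt_id p) hp0) (by simp [hbj, hp0]) (by rw [hp]; field_simp)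
  have h2 : AnalyticAt ℂ (fun z => (∏ k ∈ Finset.univ.erase j, (qInf q (b k / z))⁻¹) *
      ((∏ k, theta q (lam k * z)) * ∏ k, (qInf q (a k * z))⁻¹)) p := by
    refine AnalyticAt.mul (Finset.analyticAt_fun_prod _ fun k hk => ?_)
      ((analyticAt_prod_theta h.norm_q hl hp0).mul (Finset.analyticAt_fun_prod _ fun k _ => ?_))
    · exact (analyticAt_qInf_div h.norm_q _ hp0).inv (qInf_ne_zero h.norm_q fun m => by
        rw [hp, ← zpow_natCast q n]
        exact h.div_mul_pow_ne_one_of_ne (Finset.ne_of_mem_erase hk).symm _ _)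
    · exact (analyticAt_qInf_mul h.norm_q _ _).inv
        (qInf_ne_zero h.norm_q (h.mul_pow_ne_one hpo k))
  have h3 := (h1.mul_analyticAt h2).congr (F' := weight q a b lam)
    (Eventually.of_forall fun z => by
      rw [weight_eq, ← Finset.mul_prod_erase _ (fun k => (qInf q (b k / z))⁻¹) (Finset.mem_univ j)]
      ring)
  convert h3 using 1
  set Q := qPoch q q n with hQ
  set e := q ^ (-binomTwo (n + 1)) with he
  have he0 : e ≠ 0 := zpow_ne_zero _ h.q_ne
  have e1 : ∏ i ∈ Finset.range n, (1 - b j / p * q ^ i) = (-1) ^ n * e * Q := by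
    have := prod_one_sub_div h.q_ne one_ne_zero n
    rw [div_one] at this
    rw [hQ, ← this, ← Finset.prod_range_reflect]
    refine Finset.prod_congr rfl fun i hi => ?_
    rw [Finset.mem_range] at hi
    have e3 : q ^ n = q ^ (n - 1 - i) * q ^ (i + 1) := by rw [← pow_add]; congr 1; omega
    have e4 := pow_ne_zero (n - 1 - i) h.q_ne
    have e5 := pow_ne_zero (i + 1) h.q_ne
    rw [hp, e3]
    field_simp
  have e2 : ∀ k, qInf q (b k / p) =
      (-(b k / b j)) ^ n * e * qPoch q (q * b j / b k) n * qInf q (b k / b j) := by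
    intro k
    rw [hp, ← div_div, qInf_div_pow h.q_ne h.norm_q, prod_one_sub_div h.q_ne
      (div_ne_zero (h.bb.1 k) hbj), div_div_eq_mul_div]
  have e3 : ∀ i, (qInf q (a i * p))⁻¹ = qPoch q (a i * b j) n / qInf q (a i * b j) := by
    intro i
    have hne : qInf q (a i * b j * q ^ n) ≠ 0 := qInf_ne_zero h.norm_q fun m => by
      rw [mul_assoc (a i)]; exact h.mul_pow_ne_one hpo i m
    have hne' : qInf q (a i * b j) ≠ 0 := qInf_ne_zero h.norm_q fun m => by
      have := h.mul_pow_ne_one ⟨j, 0, rfl⟩ i m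
      rwa [zpow_zero, mul_one] at this
    rw [eq_div_iff hne', ← prod_mul_qInf h.norm_q (a i * b j) n, hp, ← mul_assoc, qPoch]
    field_simp
  have e4 : ∀ i, theta q (lam i * p) =
      (-(lam i * b j)) ^ (-n : ℤ) * (e * q ^ n) * theta q (lam i * b j) := by
    intro i
    have e5 : q ^ (-binomTwo n) = e * q ^ n := by
      rw [he, ← zpow_natCast, ← zpow_add₀ h.q_ne, binomTwo_add_one]
      congr 1; ring
    rw [← e5, ← theta_zpow_mul h.q_ne h.norm_q n (mul_ne_zero (hl i) hbj), hp, zpow_natCast]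
    congr 1; ring
  have hb0 := h.bb.1
  have hQ0 : ∀ k, qPoch q (q * b j / b k) n ≠ 0 := fun k =>
    qPoch_ne_zero (h.bb.mul_pow_ne_one h.q_ne h.norm_q j k) n
  have e6 : ∏ k, (qPoch q (q * b j / b k) n)⁻¹ =
      Q⁻¹ * ∏ k ∈ Finset.univ.erase j, (qPoch q (q * b j / b k) n)⁻¹ := by
    rw [← Finset.mul_prod_erase _ _ (Finset.mem_univ j), mul_div_cancel_right₀ _ hbj]
  have e7 : ∏ k ∈ Finset.univ.erase j, (-(b k / b j)) ^ n * e =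
      (∏ k, b k) ^ n * (((-1) ^ n) ^ 3 * e ^ 3 / (b j ^ n) ^ 3) / ((-1) ^ n * e) := by
    have : ∏ k, (-(b k / b j)) ^ n * e =
        (-1) ^ n * e * ∏ k ∈ Finset.univ.erase j, (-(b k / b j)) ^ n * e := by
      rw [← Finset.mul_prod_erase _ _ (Finset.mem_univ j), div_self hbj]
    have h1 : ((-1 : ℂ)) ^ n ≠ 0 := pow_ne_zero _ (by norm_num)
    rw [eq_div_iff (mul_ne_zero h1 he0), mul_comm, ← this, Fin.prod_univ_three, Fin.prod_univ_three]
    simp only [neg_pow (b _ / b j), div_pow, mul_pow]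
    ring
  have e8 : ∏ k, ((-(lam k * b j)) ^ (-n : ℤ) * (e * q ^ n)) =
      (e * q ^ n) ^ 3 / (((-1) ^ n) ^ 3 * (∏ k, lam k) ^ n * (b j ^ n) ^ 3) := by
    rw [Fin.prod_univ_three, Fin.prod_univ_three]
    simp only [zpow_neg, zpow_natCast, neg_pow (lam _ * b j), mul_pow]
    field_simp
  -- Moving the factors from `b_j q^n` back to `b_j` produces powers of all `λ_i` and `b_k`. The
  -- condition on their product collapses these powers to a power of `q`, which makes the residue a
  -- term of the hypergeometric series.
  have e9 : (∏ j, lam j) ^ n * (∏ j, b j) ^ n = (q ^ n) ^ 2 := by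
    rw [← mul_pow, hlb, ← pow_mul, ← pow_mul, mul_comm]
  rw [e1]
  simp only [e2, e3, e4]
  rw [seriesCoeff, seriesTerm, e6]
  have hL : (∏ j, lam j) ^ n ≠ 0 := pow_ne_zero _ (Finset.prod_ne_zero_iff.2 fun i _ => hl i)
  have hB : (∏ j, b j) ^ n ≠ 0 := pow_ne_zero _ (Finset.prod_ne_zero_iff.2 fun i _ => hb0 i)
  simp only [Finset.prod_inv_distrib, Finset.prod_mul_distrib (g := fun k => theta q (lam k * b j)),
    Finset.prod_mul_distrib (g := fun k => qInf q (b k / b j)),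
    Finset.prod_mul_distrib (g := fun k => qPoch q (q * b j / b k) n), Finset.prod_div_distrib]
  rw [e7, e8]
  have hQ1 : Q ≠ 0 := by
    have := hQ0 j
    rwa [mul_div_cancel_right₀ _ hbj] at this
  have hqq := qInf_q_ne_zero h.norm_q
  have hbjn := pow_ne_zero n hbj
  have hP : ∏ k ∈ Finset.univ.erase j, qPoch q (q * b j / b k) n ≠ 0 :=
    Finset.prod_ne_zero_iff.2 fun k _ => hQ0 k
  have hs : ((-1 : ℂ)) ^ n ≠ 0 := pow_ne_zero _ (by norm_num)
  have hs2 : ((-1 : ℂ) ^ n) ^ 2 = 1 := by rw [← pow_mul, mul_comm, pow_mul]; norm_num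
  rw [hp]
  generalize (-1 : ℂ) ^ n = s at *
  generalize b j ^ n = bn at *
  generalize (∏ j, b j) ^ n = B at *
  generalize (∏ j, lam j) ^ n = L at *
  generalize (∏ k ∈ Finset.univ.erase j, qPoch q (q * b j / b k) n) = P at *
  generalize (∏ k ∈ Finset.univ.erase j, qInf q (b k / b j)) = P' at *
  generalize (∏ i, qInf q (a i * b j)) = A at *
  generalize (∏ i, qPoch q (a i * b j) n) = A' at *
  generalize (∏ i, theta q (lam i * b j)) = Θ at *
  generalize q ^ n = x at *
  obtain rfl : L = x ^ 2 / B := by rw [eq_div_iff hB, e9]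
  simp only [zero_mul, mul_one, zero_sub]
  clear * - hbj hqq he0 hbjn hB hP hqn hQ1 hs2
  rcases sq_eq_one_iff.1 hs2 with rfl | rfl <;> field_simp

/-- The value of the residue is not needed: these poles lie outside the contour. -/
theorem hasSimplePole_weight_a (h : Generic q a b) (hl : ∀ j, lam j ≠ 0) (j : Fin 3) (n : ℕ) :
    ∃ c, HasSimplePole (weight q a b lam) (a⁻¹ j * q ^ (-n : ℤ)) c := by
  set p := a⁻¹ j * q ^ (-n : ℤ) with hp
  have hpo : p ∈ orbit q a⁻¹ := ⟨j, -n, rfl⟩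
  have hp0 : p ≠ 0 := ne_zero_of_mem_orbit h.q_ne h.inv_ne hpo
  have haj := h.aa.1 j
  have h1 := HasSimplePole.inv_qInf (f := fun z => a j * z) (p := p) (n := n) h.q_ne h.norm_q
    (analyticAt_const.mul analyticAt_id) ((hasDerivAt_id p).const_mul (a j)) (by simpa using haj)
    (by
      have := pow_ne_zero n h.q_ne
      simp only [hp, Pi.inv_apply, zpow_neg, zpow_natCast]
      field_simp)
  have h2 : AnalyticAt ℂ (fun z => (∏ k ∈ Finset.univ.erase j, (qInf q (a k * z))⁻¹) *
      ((∏ k, theta q (lam k * z)) * ∏ k, (qInf q (b k / z))⁻¹)) p := by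
    refine AnalyticAt.mul (Finset.analyticAt_fun_prod _ fun k hk => ?_)
      ((analyticAt_prod_theta h.norm_q hl hp0).mul (Finset.analyticAt_fun_prod _ fun k _ => ?_))
    · exact (analyticAt_qInf_mul h.norm_q _ _).inv
        (qInf_ne_zero h.norm_q (h.mul_pow_ne_one_of_ne (Finset.ne_of_mem_erase hk).symm _))
    · exact (analyticAt_qInf_div h.norm_q _ hp0).inv
        (qInf_ne_zero h.norm_q (h.div_mul_pow_ne_one hpo k))
  refine ⟨_, (h1.mul_analyticAt h2).congr (Eventually.of_forall fun z => ?_)⟩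
  rw [weight_eq, ← Finset.mul_prod_erase _ (fun k => (qInf q (a k * z))⁻¹) (Finset.mem_univ j)]
  ring

end Generic

end Weight

/-! ### Analytic properties of the integrands. -/

section Integrand

variable {q : ℂ} {a b lam : Fin 3 → ℂ}

theorem eval_eq_div (f : RatFunc ℂ) (z : ℂ) :
    f.eval (RingHom.id ℂ) z = f.num.eval z / f.denom.eval z := by
  rw [RatFunc.eval, eval₂_id, eval₂_id]

theorem analyticAt_polynomial (p : ℂ[X]) (z : ℂ) : AnalyticAt ℂ (fun z => p.eval z) z :=
  p.differentiable.analyticAt z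

theorem analyticAt_ratFunc {f : RatFunc ℂ} {z : ℂ} (hz : ¬ f.denom.IsRoot z) :
    AnalyticAt ℂ (fun z => f.eval (RingHom.id ℂ) z) z := by
  rw [funext (eval_eq_div f)]
  exact (analyticAt_polynomial _ z).fun_div (analyticAt_polynomial _ z) hz

theorem exists_hasSimplePole_ratFunc {f : RatFunc ℂ} (hf : Squarefree f.denom) {p : ℂ}
    (hp : f.denom.IsRoot p) : ∃ c, HasSimplePole (fun z => f.eval (RingHom.id ℂ) z) p c := by
  obtain ⟨d, hd⟩ := dvd_iff_isRoot.2 hp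
  have hdp : d.eval p ≠ 0 := by
    intro h
    obtain ⟨e, he⟩ := dvd_iff_isRoot.2 (show d.IsRoot p from h)
    refine (irreducible_X_sub_C p).not_isUnit (hf (X - C p) ⟨e, ?_⟩)
    rw [hd, he, mul_assoc]
  refine ⟨_, fun z => f.num.eval z / d.eval z,
    (analyticAt_polynomial _ p).fun_div (analyticAt_polynomial _ p) hdp, rfl,
    Eventually.of_forall fun z => ?_⟩
  simp only [eval_eq_div, hd, eval_mul, eval_sub, eval_X, eval_C, div_eq_mul_inv, mul_inv]
  ring

/-- The properties of the integrands that the residue calculus uses. -/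
structure Admissible (q : ℂ) (a b : Fin 3 → ℂ) (F : ℂ → ℂ) : Prop where
  analyticAt : ∀ z ≠ 0, z ∉ candidates q a b → AnalyticAt ℂ F z
  hasSimplePole : ∀ z ∈ candidates q a b, ∃ c, HasSimplePole F z c
  regular : ∃ M : ℕ, (∀ j (m : ℤ), m < -M → HasSimplePole F (b j * q ^ m) 0) ∧
    ∀ j (m : ℤ), M < m → HasSimplePole F (a⁻¹ j * q ^ m) 0

theorem poleSet_subset (q : ℂ) (a b : Fin 3 → ℂ) : poleSet q a b ⊆ candidates q a b := by
  rintro z ⟨j, n, -, rfl | rfl⟩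
  · exact Or.inr ⟨j, n, by rw [zpow_natCast, Pi.inv_apply]⟩
  · exact Or.inl ⟨j, -n, by rw [zpow_neg, zpow_natCast, inv_pow]⟩

theorem Generic.analyticAt_weight_poleSet (h : Generic q a b) (hl : ∀ j, lam j ≠ 0) {z : ℂ}
    (hz : z ∈ poleSet q a b) : AnalyticAt ℂ (weight q a b lam) z := by
  obtain ⟨j, n, hn, rfl | rfl⟩ := hz
  · have := h.analyticAt_weight_a (lam := lam) hl j (m := n) (by exact_mod_cast hn)
    rwa [zpow_natCast, Pi.inv_apply] at this
  · have := h.analyticAt_weight_b (lam := lam) hl j (m := -n) (by omega)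
    rwa [zpow_neg, zpow_natCast, ← inv_pow] at this

theorem Generic.exists_hasSimplePole_weight (h : Generic q a b) (hl : ∀ j, lam j ≠ 0)
    (hlb : (∏ j, lam j) * ∏ j, b j = q ^ 2) {z : ℂ} (hz : z ∈ candidates q a b) :
    ∃ c, HasSimplePole (weight q a b lam) z c := by
  rcases hz with ⟨j, m, rfl⟩ | ⟨j, m, rfl⟩
  · rcases lt_or_ge m 0 with hm | hm
    · exact ⟨0, .of_analyticAt (h.analyticAt_weight_b hl j hm)⟩
    · obtain ⟨n, rfl⟩ := Int.eq_ofNat_of_zero_le hm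
      rw [zpow_natCast]
      exact ⟨_, h.hasSimplePole_weight_b hl hlb j n⟩
  · rcases lt_or_ge 0 m with hm | hm
    · exact ⟨0, .of_analyticAt (h.analyticAt_weight_a hl j hm)⟩
    · obtain ⟨n, hn⟩ := Int.eq_ofNat_of_zero_le (neg_nonneg.2 hm)
      rw [← neg_neg m, hn]
      exact h.hasSimplePole_weight_a hl j n

theorem Generic.injective_zpow (h : Generic q a b) {c : ℂ} (hc : c ≠ 0) :
    Function.Injective fun m : ℤ => c * q ^ m :=
  (mul_right_injective₀ hc).comp (zpow_injective h.q_ne h.norm_q)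

/-- At each candidate at most one of the two factors, the rational function and the weight, has a
pole, and that pole is simple. -/
theorem Generic.admissible_integrand (h : Generic q a b) (hl : ∀ j, lam j ≠ 0)
    (hlb : (∏ j, lam j) * ∏ j, b j = q ^ 2) {f : RatFunc ℂ} (hf : f ∈ W q a b) :
    Admissible q a b (integrand q a b lam f) := by
  obtain ⟨-, hf1, hf2⟩ := hf
  have hE : integrand q a b lam f =
      fun z => f.eval (RingHom.id ℂ) z * (weight q a b lam z * z⁻¹) :=
    funext fun z => by rw [integrand, mul_div_assoc, div_eq_mul_inv]
  have hinv : ∀ z : ℂ, z ≠ 0 → AnalyticAt ℂ (fun z : ℂ => z⁻¹) z :=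
    fun z hz => analyticAt_id.fun_inv hz
  have hreg : ∀ z ≠ 0, ¬ f.denom.IsRoot z → AnalyticAt ℂ (weight q a b lam) z →
      AnalyticAt ℂ (integrand q a b lam f) z := fun z hz h1 h2 => by
    rw [hE]
    exact (analyticAt_ratFunc h1).mul (h2.mul (hinv z hz))
  refine ⟨fun z hz hzc => ?_, fun z hz => ?_, ?_⟩
  · exact hreg z hz (fun h' => hzc (poleSet_subset q a b (hf2 z h')))
      (h.analyticAt_weight_of_notMem hl hz hzc)
  · have hz0 := h.ne_zero_of_mem_candidates hz
    by_cases hr : f.denom.IsRoot z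
    · obtain ⟨c, hc⟩ := exists_hasSimplePole_ratFunc hf1 hr
      rw [hE]
      exact ⟨_, hc.mul_analyticAt
        ((h.analyticAt_weight_poleSet hl (hf2 z hr)).mul (hinv z hz0))⟩
    · obtain ⟨c, hc⟩ := h.exists_hasSimplePole_weight hl hlb hz
      refine ⟨_, ((hc.mul_analyticAt (hinv z hz0)).mul_analyticAt
        (analyticAt_ratFunc hr)).congr (Eventually.of_forall fun z => ?_)⟩
      rw [hE]
      ring
  -- The finitely many poles of `f` bound the exponents that occur in them; beyond this bound only
  -- the weight could contribute, and it is analytic on these half-orbits.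
  · have hfin : ∀ c ≠ 0, {m : ℤ | f.denom.IsRoot (c * q ^ m)}.Finite := fun c hc =>
      (Polynomial.finite_setOfPred_isRoot f.denom_ne_zero).preimage (h.injective_zpow hc).injOn
    have hfin' : (⋃ j, {m : ℤ | f.denom.IsRoot (b j * q ^ m)} ∪
        {m : ℤ | f.denom.IsRoot (a⁻¹ j * q ^ m)}).Finite :=
      Set.finite_iUnion fun j => (hfin _ (h.bb.1 j)).union (hfin _ (h.inv_ne j))
    obtain ⟨M, hM⟩ := (hfin'.image Int.natAbs).bddAbove
    have hM' : ∀ j (m : ℤ), f.denom.IsRoot (b j * q ^ m) ∨ f.denom.IsRoot (a⁻¹ j * q ^ m) →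
        m.natAbs ≤ M := fun j m hm => hM ⟨m, mem_iUnion.2 ⟨j, hm⟩, rfl⟩
    refine ⟨M, fun j m hm => .of_analyticAt (hreg _
      (h.ne_zero_of_mem_candidates (Or.inl ⟨j, m, rfl⟩)) (fun hr => ?_)
      (h.analyticAt_weight_b hl j (by omega))), fun j m hm => .of_analyticAt (hreg _
      (h.ne_zero_of_mem_candidates (Or.inr ⟨j, m, rfl⟩)) (fun hr => ?_)
      (h.analyticAt_weight_a hl j (by omega)))⟩
    · have := hM' j m (Or.inl hr)
      omega
    · have := hM' j m (Or.inr hr)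
      omega

end Integrand

/-! ### Residue theorem for contours, contour independence and existence. -/

section Contour

variable {q : ℂ} {a b : Fin 3 → ℂ} {F : ℂ → ℂ} {z₀ : ℂ} {γ : Path z₀ z₀}

theorem exists_lt_norm_path (h0 : ∀ t, γ t ≠ 0) : ∃ δ > 0, ∀ t, δ < ‖γ t‖ := by
  obtain ⟨t₀, -, ht₀⟩ := isCompact_univ.exists_isMinOn univ_nonempty
    (γ.continuous.norm.continuousOn (s := univ))
  have h1 : 0 < ‖γ t₀‖ := norm_pos_iff.2 (h0 t₀)
  exact ⟨‖γ t₀‖ / 2, by positivity, fun t => (half_lt_self h1).trans_le (ht₀ (mem_univ t))⟩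

theorem exists_norm_path_lt (γ : Path z₀ z₀) : ∃ R, ∀ t, ‖γ t‖ < R := by
  obtain ⟨t₀, -, ht₀⟩ := isCompact_univ.exists_isMaxOn univ_nonempty
    (γ.continuous.norm.continuousOn (s := univ))
  exact ⟨‖γ t₀‖ + 1, fun t => (ht₀ (mem_univ t)).trans_lt (lt_add_one _)⟩

/-- The residue theorem for contours. -/
theorem Generic.lineIntegral_eq (h : Generic q a b) (hF : Admissible q a b F) {c : ℂ → ℂ}
    (hc : ∀ z ∈ candidates q a b, HasSimplePole F z (c z)) (hγ : IsContour q a b F γ) {ρ R : ℝ}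
    (hρ : 0 < ρ) (hργ : ∀ t, ρ < ‖γ t‖) (hρc : ∀ z ∈ candidates q a b, ‖z‖ ≠ ρ)
    (hR : ∀ t, ‖γ t‖ < R) {P : Finset ℂ}
    (hP : ∀ p, p ∈ P ↔ p ∈ candidates q a b ∧ ρ < ‖p‖ ∧ ‖p‖ < R) :
    CurveIntegrable (oneForm F) γ ∧ lineIntegral F γ =
      ∑ p ∈ P, (orbit q b).indicator c p +
      (2 * (Real.pi : ℂ) * Complex.I)⁻¹ * ∮ z in C(0, ρ), F z := by
  -- Only finitely many candidates have norm between `ρ / 2` and `ρ`, and none has norm `ρ`, so the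
  -- annulus can be widened slightly inwards without meeting further candidates.
  obtain ⟨r, hr, hr', hrc⟩ : ∃ r, 0 < r ∧ r < ρ ∧
      ∀ z ∈ candidates q a b, r < ‖z‖ → ρ < ‖z‖ := by
    have hfin := h.finite_candidates_inter (half_pos hρ) ρ
    have h1 : ∀ᶠ r in 𝓝[<] ρ, ∀ z ∈ {z | z ∈ candidates q a b ∧ ρ / 2 ≤ ‖z‖ ∧ ‖z‖ ≤ ρ},
        ‖z‖ < r := by
      rw [Filter.eventually_all_finite hfin]
      rintro z ⟨hz, -, hz'⟩
      exact nhdsWithin_le_nhds (eventually_gt_nhds (lt_of_le_of_ne hz' (hρc z hz)))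
    obtain ⟨r, h2, h3⟩ := (h1.and (Ioo_mem_nhdsLT (half_lt_self hρ))).exists
    refine ⟨r, (half_pos hρ).trans h3.1, h3.2, fun z hz hrz => ?_⟩
    by_contra! h4
    exact lt_asymm hrz (h2 z ⟨hz, (h3.1.trans hrz).le, h4⟩)
  have hρR : ρ < R := (hργ 0).trans (hR 0)
  have han : ∀ z ≠ 0, z ∉ P → r < ‖z‖ → ‖z‖ < R → AnalyticAt ℂ F z := fun z hz hzP h1 h2 =>
    hF.analyticAt z hz fun hzc => hzP ((hP z).2 ⟨hzc, hrc z hzc h1, h2⟩)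
  have h0 : ∀ z : ℂ, r < ‖z‖ → z ≠ 0 := fun z hz => norm_pos_iff.1 (hr.trans hz)
  obtain ⟨h1, h2⟩ := lineIntegral_eq_sum_residues (F := F) (c := c) (P := P) hr hr' hρR
    (fun p hp => ((hP p).1 hp).2.1) (fun z hz hz' => by
      split_ifs with hzP
      · exact hc z ((hP z).1 hzP).1
      · exact .of_analyticAt (han z (h0 z hz) hzP hz hz'))
    (fun z hz => hF.analyticAt z (h0 z (by rw [hz]; exact hr')) fun hzc => hρc z hzc hz)
    hγ.piecewiseC1 (fun t => ⟨hr'.trans (hργ t), hR t⟩) hγ.winding_zero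
    (fun t ht => (hc _ ((hP _).1 ht).1).eq_zero_of_not_order_neg (hγ.avoids t))
  refine ⟨h1, ?_⟩
  rw [h2]
  congr 1
  refine Finset.sum_congr rfl fun p hp => ?_
  have hpc := ((hP p).1 hp).1
  -- The winding conditions of a contour concern actual poles only. At the other candidates the
  -- residue is zero, whatever the winding number.
  by_cases hcp : c p = 0
  · rw [hcp, zero_mul, Set.indicator_apply_eq_zero.2 fun _ => hcp]
  · have hneg := (hc p hpc).order_neg hcp
    by_cases hpb : p ∈ orbit q b
    · rw [indicator_of_mem hpb]
      obtain ⟨j, m, rfl⟩ := hpb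
      rw [hγ.inside j m hneg, mul_one]
    · rw [indicator_of_notMem hpb]
      obtain ⟨j, m, rfl⟩ := hpc.resolve_left hpb
      rw [Pi.inv_apply, hγ.outside j m hneg, mul_zero]

theorem Generic.exists_finset_candidates (h : Generic q a b) {ρ : ℝ} (hρ : 0 < ρ) (R : ℝ) :
    ∃ P : Finset ℂ, ∀ p, p ∈ P ↔ p ∈ candidates q a b ∧ ρ < ‖p‖ ∧ ‖p‖ < R := by
  have hfin : {p | p ∈ candidates q a b ∧ ρ < ‖p‖ ∧ ‖p‖ < R}.Finite :=
    (h.finite_candidates_inter hρ R).subset fun p hp => ⟨hp.1, hp.2.1.le, hp.2.2.le⟩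
  exact ⟨hfin.toFinset, fun p => hfin.mem_toFinset⟩

/-- With one circle inside both curves and one bound outside both, each integral equals the same sum
of residues plus the same circle integral. -/
theorem Generic.curveIntegrable_and_lineIntegral_eq (h : Generic q a b) (hF : Admissible q a b F)
    (hγ : IsContour q a b F γ) {z₁ : ℂ} {γ' : Path z₁ z₁} (hγ' : IsContour q a b F γ') :
    CurveIntegrable (oneForm F) γ ∧ lineIntegral F γ = lineIntegral F γ' := by
  obtain ⟨δ, hδ, h1⟩ := exists_lt_norm_path hγ.ne_zero
  obtain ⟨δ', hδ', h1'⟩ := exists_lt_norm_path hγ'.ne_zero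
  obtain ⟨R, h2⟩ := exists_norm_path_lt γ
  obtain ⟨R', h2'⟩ := exists_norm_path_lt γ'
  obtain ⟨ρ, hρ, hρδ, h3⟩ := h.exists_radius (lt_min hδ hδ')
  obtain ⟨P, hP⟩ := h.exists_finset_candidates hρ (max R R')
  have h3' : ∀ z ∈ candidates q a b, ‖z‖ ≠ ρ := fun z hz => by simpa using h3 0 z hz
  choose! c hc using hF.hasSimplePole
  have h4 := h.lineIntegral_eq hF hc hγ hρ (fun t => (hρδ.trans_le (min_le_left _ _)).trans (h1 t))
    h3' (fun t => (h2 t).trans_le (le_max_left _ _)) hP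
  have h4' := h.lineIntegral_eq hF hc hγ' hρ
    (fun t => (hρδ.trans_le (min_le_right _ _)).trans (h1' t))
    h3' (fun t => (h2' t).trans_le (le_max_right _ _)) hP
  exact ⟨h4.1, h4.2.trans h4'.2.symm⟩

/-- Contours that separate the two families of candidates up to a given index. -/
theorem Generic.exists_contour (h : Generic q a b) (M : ℕ) : ∃ (z₀ : ℂ) (γ : Path z₀ z₀),
    IsPiecewiseC1 γ ∧ (∀ t, γ t ≠ 0 ∧ γ t ∉ candidates q a b) ∧ winding γ 0 = 1 ∧
    (∀ j (m : ℤ), -M ≤ m → winding γ (b j * q ^ m) = 1) ∧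
    ∀ j (m : ℤ), m ≤ M → winding γ (a⁻¹ j * q ^ m) = 0 := by
  classical
  obtain ⟨ρ, hρ, -, h1⟩ := h.exists_radius one_pos
  have hρc : ∀ z ∈ candidates q a b, ‖z‖ ≠ ρ := fun z hz => by simpa using h1 0 z hz
  set S := insert 0 (candidates q a b) with hS
  have hqpos : 0 < ‖q‖ := norm_pos_iff.2 h.q_ne
  -- Starting from a circle, `B` collects the points to be enclosed that lie outside it, and `A` the
  -- points to be left out that lie inside it. Both sets are finite, since the exponents are bounded
  -- on the side where the norms would leave the range.
  set B : Set ℂ := {z | ρ < ‖z‖ ∧ ∃ j, ∃ m : ℤ, -M ≤ m ∧ z = b j * q ^ m} with hB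
  set A : Set ℂ := {z | ‖z‖ < ρ ∧ ∃ j, ∃ m : ℤ, m ≤ M ∧ z = a⁻¹ j * q ^ m} with hA
  have hBf : B.Finite := by
    refine (finite_orbit_inter h.q_ne h.norm_q h.bb.1 hρ
      (∑ j, ‖b j‖ * ‖q‖ ^ (-M : ℤ))).subset ?_
    rintro z ⟨hz, j, m, hm, rfl⟩
    refine ⟨⟨j, m, rfl⟩, hz.le, ?_⟩
    rw [norm_mul, norm_zpow]
    refine le_trans ?_ (Finset.single_le_sum (f := fun j => ‖b j‖ * ‖q‖ ^ (-M : ℤ))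
      (fun _ _ => by positivity) (Finset.mem_univ j))
    exact mul_le_mul_of_nonneg_left (zpow_right_anti₀ hqpos h.norm_q.le hm) (norm_nonneg _)
  have hAf : A.Finite := by
    have hc : ∀ j, 0 < ‖a⁻¹ j‖ * ‖q‖ ^ (M : ℤ) := fun j =>
      mul_pos (norm_pos_iff.2 (h.inv_ne j)) (zpow_pos hqpos _)
    have hr : 0 < ∏ j, min 1 (‖a⁻¹ j‖ * ‖q‖ ^ (M : ℤ)) :=
      Finset.prod_pos fun j _ => lt_min one_pos (hc j)
    refine (finite_orbit_inter h.q_ne h.norm_q h.inv_ne hr ρ).subset ?_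
    rintro z ⟨hz, j, m, hm, rfl⟩
    refine ⟨⟨j, m, rfl⟩, ?_, hz.le⟩
    rw [norm_mul, norm_zpow]
    calc ∏ j, min 1 (‖a⁻¹ j‖ * ‖q‖ ^ (M : ℤ))
        ≤ min 1 (‖a⁻¹ j‖ * ‖q‖ ^ (M : ℤ)) := by
          rw [← Finset.mul_prod_erase _ _ (Finset.mem_univ j)]
          exact mul_le_of_le_one_right (le_min zero_le_one (hc j).le)
            (Finset.prod_le_one (fun i _ => le_min zero_le_one (hc i).le)
              fun i _ => min_le_left _ _)
      _ ≤ ‖a⁻¹ j‖ * ‖q‖ ^ (M : ℤ) := min_le_right _ _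
      _ ≤ _ := mul_le_mul_of_nonneg_left (zpow_right_anti₀ hqpos h.norm_q.le hm) (norm_nonneg _)
  have hSc : S.Countable := h.countable_candidates.insert _
  have hcirc : ∀ t, ‖circlePath 0 ρ t‖ = ρ := fun t => by
    simpa using norm_circlePath_sub 0 hρ.le t
  have hne0 : ∀ z ∈ candidates q a b, z ≠ 0 := fun z hz => h.ne_zero_of_mem_candidates hz
  have hBc : ∀ z ∈ B, z ∈ orbit q b := by
    rintro z ⟨-, j, m, -, rfl⟩; exact ⟨j, m, rfl⟩
  have hAc : ∀ z ∈ A, z ∈ orbit q a⁻¹ := by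
    rintro z ⟨-, j, m, -, rfl⟩; exact ⟨j, m, rfl⟩
  obtain ⟨γ, h2, h3, h4⟩ := exists_winding_add_finset (S := S) hSc (circlePath_piecewiseC1 0 ρ)
    (fun t ht => by
      rcases ht with ht | ht
      · have := hcirc t
        rw [ht, norm_zero] at this
        exact hρ.ne this
      · exact hρc _ ht (hcirc t))
    (σ := fun p => if p ∈ orbit q b then 1 else -1)
    (fun p => by by_cases hp : p ∈ orbit q b <;> simp [hp]) (hBf.toFinset ∪ hAf.toFinset)
    (fun p hp => by
      have hpc : p ∈ candidates q a b := by
        simp only [Finset.mem_union, Set.Finite.mem_toFinset] at hp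
        exact hp.imp (hBc p) (hAc p)
      exact ⟨Or.inr hpc, h.exists_isolated hpc⟩)
  simp only [Finset.mem_union, Set.Finite.mem_toFinset] at h4
  refine ⟨_, γ, h2, fun t => ⟨fun ht => h3 t (Or.inl ht), fun ht => h3 t (Or.inr ht)⟩, ?_, ?_, ?_⟩
  · rw [h4 0 (Or.inl rfl), winding_circlePath_of_lt (by simpa using hρ), if_neg, add_zero]
    rintro (h' | h')
    · exact hne0 0 (Or.inl (hBc _ h')) rfl
    · exact hne0 0 (Or.inr (hAc _ h')) rfl
  · intro j m hm
    have ho : b j * q ^ m ∈ orbit q b := ⟨j, m, rfl⟩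
    have hnA : b j * q ^ m ∉ A := fun h' => h.notMem_orbit_inv ho (hAc _ h')
    rw [h4 _ (Or.inr (Or.inl ho)), if_pos ho]
    rcases lt_or_gt_of_ne (hρc _ (Or.inl ho)) with hlt | hgt
    · rw [winding_circlePath_of_lt (by simpa using hlt), if_neg, add_zero]
      rintro (h' | h')
      · exact lt_asymm h'.1 hlt
      · exact hnA h'
    · rw [winding_circlePath_of_gt hρ.le (by simpa using hgt), if_pos, zero_add]
      exact Or.inl ⟨hgt, j, m, hm, rfl⟩
  · intro j m hm
    have ho : a⁻¹ j * q ^ m ∈ orbit q a⁻¹ := ⟨j, m, rfl⟩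
    have hob : a⁻¹ j * q ^ m ∉ orbit q b := fun h' => h.notMem_orbit_inv h' ho
    rw [h4 _ (Or.inr (Or.inr ho)), if_neg hob]
    rcases lt_or_gt_of_ne (hρc _ (Or.inr ho)) with hlt | hgt
    · rw [winding_circlePath_of_lt (by simpa using hlt), if_pos, add_neg_cancel]
      exact Or.inr ⟨hlt, j, m, hm, rfl⟩
    · rw [winding_circlePath_of_gt hρ.le (by simpa using hgt), if_neg, add_zero]
      rintro (h' | h')
      · exact hob (hBc _ h')
      · exact lt_asymm h'.1 hgt

end Contour

theorem HasSimplePole.unique {F : ℂ → ℂ} {p c c' : ℂ} (h : HasSimplePole F p c)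
    (h' : HasSimplePole F p c') : c = c' := by
  have h1 : HasSimplePole (fun z => F z - F z) p 0 :=
    (HasSimplePole.of_analyticAt (F := fun _ => 0) analyticAt_const).congr
      (Eventually.of_forall fun z => (sub_self _).symm)
  exact sub_eq_zero.1 ((h.sub h').eq_zero_of_not_order_neg h1.not_order_neg)

/-! ### The integral of the weight as a sum of residues. -/

section WeightIntegral

variable {q : ℂ} {a b lam : Fin 3 → ℂ}

theorem weight_q_mul (hq0 : q ≠ 0) (hq1 : ‖q‖ < 1) (hl : ∀ j, lam j ≠ 0) {z : ℂ} (hz : z ≠ 0)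
    (ha : ∀ j, 1 - a j * z ≠ 0) (hb : ∀ j, q * z - b j ≠ 0) :
    weight q a b lam (q * z) =
      (∏ j, (-(q / lam j) * (1 - a j * z) / (q * z - b j))) * weight q a b lam z := by
  rw [weight, weight, ← Finset.prod_mul_distrib]
  refine Finset.prod_congr rfl fun j _ => ?_
  have h1 := qInf_eq hq1 (a j * z)
  have h2 := qInf_eq hq1 (b j / (q * z))
  rw [show q * (b j / (q * z)) = b j / z by field_simp] at h2
  rw [show lam j * (q * z) = q * (lam j * z) by ring, theta_mul_q hq0 hq1 (mul_ne_zero (hl j) hz),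
    h1, h2, show a j * (q * z) = q * (a j * z) by ring]
  have h3 := ha j
  have h4 := hb j
  have h5 := hl j
  have h6 : 1 - b j / (q * z) = (q * z - b j) / (q * z) := by field_simp
  rw [h6]
  generalize qInf q (q * (a j * z)) = A
  generalize qInf q (b j / z) = B
  generalize theta q (lam j * z) = t
  generalize 1 - a j * z = y at *
  field_simp

/-- The ratio `w (q z) / w z` is a rational function with value `q ^ 3 / (∏ λ_j ∏ b_j) = q` at the
origin, so near it any constant between `‖q‖` and `1` serves; the midpoint is taken. -/
theorem Generic.exists_weight_bound (h : Generic q a b) (hl : ∀ j, lam j ≠ 0)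
    (hlb : (∏ j, lam j) * ∏ j, b j = q ^ 2) :
    ∃ δ > 0, ∃ μ, 0 ≤ μ ∧ μ < 1 ∧ ∀ z ≠ 0, ‖z‖ < δ →
      ‖weight q a b lam (q * z)‖ ≤ μ * ‖weight q a b lam z‖ := by
  set r : ℂ → ℂ := fun z => ∏ j, (-(q / lam j) * (1 - a j * z) / (q * z - b j)) with hr
  have hb0 := h.bb.1
  have hr0 : r 0 = q := by
    have : r 0 = q ^ 3 / ((∏ j, lam j) * ∏ j, b j) := by
      simp only [hr, Fin.prod_univ_three, mul_zero, zero_sub, sub_zero, mul_one]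
      have := hl 0; have := hl 1; have := hl 2
      have := hb0 0; have := hb0 1; have := hb0 2
      field_simp
    rw [this, hlb]
    have := h.q_ne
    field_simp
  have hc : ContinuousAt r 0 := by
    refine tendsto_finsetProd _ fun j _ => ?_
    refine ContinuousAt.div (by fun_prop) (by fun_prop) ?_
    simpa using hb0 j
  have h1 : ∀ᶠ z in 𝓝 (0 : ℂ), ‖r z‖ < (1 + ‖q‖) / 2 := by
    refine hc.norm.eventually_lt_const ?_
    change ‖r 0‖ < _
    rw [hr0]
    linarith [h.norm_q]
  have h2 : ∀ᶠ z in 𝓝 (0 : ℂ), ∀ j, 1 - a j * z ≠ 0 := by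
    rw [eventually_all]
    intro j
    have : ContinuousAt (fun z => 1 - a j * z) 0 := by fun_prop
    exact this.eventually_ne (by simp)
  have h3 : ∀ᶠ z in 𝓝 (0 : ℂ), ∀ j, q * z - b j ≠ 0 := by
    rw [eventually_all]
    intro j
    have : ContinuousAt (fun z => q * z - b j) 0 := by fun_prop
    exact this.eventually_ne (by simpa using hb0 j)
  obtain ⟨δ, hδ, h4⟩ := Metric.eventually_nhds_iff.1 (h1.and (h2.and h3))
  refine ⟨δ, hδ, (1 + ‖q‖) / 2, by positivity, by linarith [h.norm_q], fun z hz hzδ => ?_⟩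
  obtain ⟨h5, h6, h7⟩ := h4 (by simpa using hzδ)
  rw [weight_q_mul h.q_ne h.norm_q hl hz h6 h7, norm_mul]
  exact mul_le_mul_of_nonneg_right h5.le (norm_nonneg _)

theorem integrand_one (q : ℂ) (a b lam : Fin 3 → ℂ) (z : ℂ) :
    integrand q a b lam 1 z = weight q a b lam z / z := by
  rw [integrand, RatFunc.eval_one, one_mul]

theorem one_mem_W (q : ℂ) (a b : Fin 3 → ℂ) : (1 : RatFunc ℂ) ∈ W q a b := by
  refine ⟨by simp, by simp, fun z hz => ?_⟩
  simp [Polynomial.IsRoot] at hz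

/-- On the circle of radius `ρ ‖q‖ ^ N` the weight is at most a constant times `μ ^ N` with `μ < 1`,
and the measure `dz / z` has total mass independent of the radius. This handles the origin, where
the poles accumulate. -/
theorem Generic.tendsto_circleIntegral (h : Generic q a b) (hl : ∀ j, lam j ≠ 0)
    (hlb : (∏ j, lam j) * ∏ j, b j = q ^ 2) {δ : ℝ} (hδ : 0 < δ) : ∃ ρ, 0 < ρ ∧ ρ < δ ∧
      (∀ (N : ℕ), ∀ z ∈ candidates q a b, ‖z‖ ≠ ρ * ‖q‖ ^ N) ∧
      Tendsto (fun N : ℕ => ∮ z in C(0, ρ * ‖q‖ ^ N), integrand q a b lam 1 z) atTop (𝓝 0) := by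
  obtain ⟨δ', hδ', μ, hμ0, hμ1, hw⟩ := h.exists_weight_bound hl hlb
  obtain ⟨ρ, hρ, hρδ, h1⟩ := h.exists_radius (lt_min hδ hδ')
  refine ⟨ρ, hρ, hρδ.trans_le (min_le_left _ _), h1, ?_⟩
  have hqpos : 0 < ‖q‖ := norm_pos_iff.2 h.q_ne
  have hcont : ContinuousOn (weight q a b lam) (Metric.sphere 0 ρ) := fun z hz => by
    rw [mem_sphere_zero_iff_norm] at hz
    refine (h.analyticAt_weight_of_notMem hl ?_ fun hzc => ?_).continuousAt.continuousWithinAt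
    · exact norm_pos_iff.1 (hz ▸ hρ)
    · exact h1 0 z hzc (by simpa using hz)
  obtain ⟨C, hC⟩ := (isCompact_sphere (0 : ℂ) ρ).exists_bound_of_continuousOn hcont
  have hbound : ∀ (N : ℕ) (z : ℂ), ‖z‖ = ρ * ‖q‖ ^ N → ‖weight q a b lam z‖ ≤ C * μ ^ N := by
    intro N
    induction N with
    | zero => intro z hz; simpa using hC z (by simpa using hz)
    | succ N ih =>
      intro z hz
      have hz' : ‖z / q‖ = ρ * ‖q‖ ^ N := by
        rw [norm_div, hz, pow_succ]; field_simp
      have hz0 : z / q ≠ 0 := norm_pos_iff.1 (by rw [hz']; positivity)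
      have h2 := hw (z / q) hz0 (by
        rw [hz']
        exact (mul_le_of_le_one_right hρ.le (pow_le_one₀ (norm_nonneg _) h.norm_q.le)).trans_lt
          (hρδ.trans_le (min_le_right _ _)))
      rw [mul_div_cancel₀ _ h.q_ne] at h2
      calc _ ≤ μ * ‖weight q a b lam (z / q)‖ := h2
        _ ≤ μ * (C * μ ^ N) := mul_le_mul_of_nonneg_left (ih _ hz') hμ0
        _ = _ := by ring
  have hlim : Tendsto (fun N : ℕ => 2 * Real.pi * (C * μ ^ N)) atTop (𝓝 0) := by
    simpa using ((tendsto_pow_atTop_nhds_zero_of_lt_one hμ0 hμ1).const_mul C).const_mul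
      (2 * Real.pi)
  refine squeeze_zero_norm (fun N => ?_) hlim
  have hρN : 0 < ρ * ‖q‖ ^ N := by positivity
  refine (circleIntegral.norm_integral_le_of_norm_le_const hρN.le
    (C := C * μ ^ N / (ρ * ‖q‖ ^ N)) fun z hz => ?_).trans (le_of_eq ?_)
  · rw [mem_sphere_zero_iff_norm] at hz
    rw [integrand_one, norm_div, hz]
    exact div_le_div_of_nonneg_right (hbound N z hz) hρN.le
  · field_simp

/-- The integral of the weight as a sum of residues. -/
theorem Generic.lineIntegral_one (h : Generic q a b) (hl : ∀ j, lam j ≠ 0)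
    (hlb : (∏ j, lam j) * ∏ j, b j = q ^ 2) {z₀ : ℂ} {γ : Path z₀ z₀}
    (hγ : IsContour q a b (integrand q a b lam 1) γ) :
    (∏ i, ∏ j, qInf q (a i * b j)) * lineIntegral (integrand q a b lam 1) γ =
      residueSum q a b lam := by
  have hF := h.admissible_integrand hl hlb (one_mem_W q a b)
  obtain ⟨δ, hδ, hγδ⟩ := exists_lt_norm_path hγ.ne_zero
  obtain ⟨R₀, hR₀⟩ := exists_norm_path_lt γ
  obtain ⟨ρ, hρ, hρδ, hρc, hlim⟩ := h.tendsto_circleIntegral hl hlb hδ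
  set R : ℝ := max R₀ (∑ j, ‖b j‖ + 1) with hR
  have hqpos : 0 < ‖q‖ := norm_pos_iff.2 h.q_ne
  -- The residue theorem is applied for every radius `ρ ‖q‖ ^ N` with the same outer bound `R`,
  -- chosen so large that all `b_j q^n` with `n ≥ 0` lie within it.
  have hρN : ∀ N : ℕ, 0 < ρ * ‖q‖ ^ N := fun N => by positivity
  choose! c hc using hF.hasSimplePole
  choose P hP using fun N => h.exists_finset_candidates (hρN N) R
  set V : Fin 3 → ℕ → ℂ := fun j n =>
    (seriesCoeff q b lam j / ∏ i, qInf q (a i * b j)) * seriesTerm q a b j n with hV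
  have hcV : ∀ j (n : ℕ), c (b j * q ^ n) = V j n := by
    intro j n
    have hm : b j * q ^ n ∈ candidates q a b := Or.inl ⟨j, n, by rw [zpow_natCast]⟩
    have hp0 := h.ne_zero_of_mem_candidates hm
    refine (hc _ hm).unique ?_
    have h1 := ((h.hasSimplePole_weight_b hl hlb j n).mul_analyticAt
      (analyticAt_id.fun_inv hp0)).congr (F' := integrand q a b lam 1)
      (Eventually.of_forall fun z => by rw [integrand_one, div_eq_mul_inv]; rfl)
    convert h1 using 1
    rw [hV]
    simp only [id]
    generalize ∏ i, qInf q (a i * b j) = A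
    generalize b j * q ^ n = p at hp0 ⊢
    field_simp
  have hc0 : ∀ j (m : ℤ), m < 0 → c (b j * q ^ m) = 0 := by
    intro j m hm
    have hmc : b j * q ^ m ∈ candidates q a b := Or.inl ⟨j, m, rfl⟩
    refine (hc _ hmc).unique ((HasSimplePole.of_analyticAt
      ((h.analyticAt_weight_b hl j hm).fun_div analyticAt_id
        (h.ne_zero_of_mem_candidates hmc))).congr (Eventually.of_forall fun z => ?_))
    rw [integrand_one]; rfl
  have hinj : ∀ j, Function.Injective fun n : ℕ => b j * q ^ n := fun j n m hnm => by
    have := h.injective_zpow (h.bb.1 j) (a₁ := (n : ℤ)) (a₂ := m) (by simpa using hnm)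
    exact_mod_cast this
  set s : Fin 3 → ℕ → Finset ℕ := fun j N =>
    (P N).preimage (fun n : ℕ => b j * q ^ n) (hinj j).injOn with hs
  have hsum : ∀ N, ∑ p ∈ P N, (orbit q b).indicator c p = ∑ j, ∑ n ∈ s j N, V j n := by
    intro N
    rw [Finset.sum_sigma']
    symm
    refine Finset.sum_of_injOn (fun x : (_ : Fin 3) × ℕ => b x.1 * q ^ x.2) ?_ ?_ ?_ ?_
    · rintro ⟨j, n⟩ - ⟨k, m⟩ - hjk
      simp only at hjk
      obtain rfl : j = k := by
        by_contra hne
        refine h.bb.2 j k hne (m - n) ?_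
        have := pow_ne_zero n h.q_ne
        rw [zpow_sub₀ h.q_ne, zpow_natCast, zpow_natCast]
        field_simp
        linear_combination hjk
      rw [hinj j hjk]
    · rintro ⟨j, n⟩ hjn
      simpa [hs] using hjn
    · intro p hp hps
      by_cases hpb : p ∈ orbit q b
      · rw [indicator_of_mem hpb]
        obtain ⟨j, m, rfl⟩ := hpb
        rcases lt_or_ge m 0 with hm | hm
        · exact hc0 j m hm
        · obtain ⟨n, rfl⟩ := Int.eq_ofNat_of_zero_le hm
          exact (hps ((Set.mem_image _ _ _).2 ⟨⟨j, n⟩, by simpa [hs] using hp, by simp⟩)).elim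
      · exact indicator_of_notMem hpb _
    · rintro ⟨j, n⟩ -
      have hm : b j * q ^ n ∈ orbit q b := ⟨j, n, by rw [zpow_natCast]⟩
      rw [indicator_of_mem hm, hcV]
  have hmem : ∀ j N n, n ∈ s j N ↔ ρ * ‖q‖ ^ N < ‖b j * q ^ n‖ := by
    intro j N n
    rw [hs, Finset.mem_preimage, hP]
    refine ⟨fun h' => h'.2.1, fun h' => ⟨Or.inl ⟨j, n, by rw [zpow_natCast]⟩, h', ?_⟩⟩
    rw [norm_mul, norm_pow]
    calc ‖b j‖ * ‖q‖ ^ n ≤ ‖b j‖ :=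
          mul_le_of_le_one_right (norm_nonneg _) (pow_le_one₀ (norm_nonneg _) h.norm_q.le)
      _ ≤ ∑ j, ‖b j‖ := Finset.single_le_sum (f := fun j => ‖b j‖)
          (fun _ _ => norm_nonneg _) (Finset.mem_univ j)
      _ < ∑ j, ‖b j‖ + 1 := lt_add_one _
      _ ≤ R := le_max_right _ _
  have hρlim : Tendsto (fun N : ℕ => ρ * ‖q‖ ^ N) atTop (𝓝 0) := by
    simpa using (tendsto_pow_atTop_nhds_zero_of_lt_one (norm_nonneg q) h.norm_q).const_mul ρ
  -- The index sets of the enclosed residues grow to all of `ℕ` as the circle shrinks, so the finite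
  -- sums converge to the series.
  have hslim : ∀ j, Tendsto (s j) atTop atTop := by
    intro j
    refine tendsto_atTop_finset_of_monotone (fun N N' hN n hn => ?_) fun n => ?_
    · rw [hmem] at hn ⊢
      refine lt_of_le_of_lt ?_ hn
      exact mul_le_mul_of_nonneg_left
        (pow_le_pow_of_le_one (norm_nonneg _) h.norm_q.le hN) hρ.le
    · have hpos : 0 < ‖b j * q ^ n‖ :=
        norm_pos_iff.2 (mul_ne_zero (h.bb.1 j) (pow_ne_zero _ h.q_ne))
      obtain ⟨N, hN⟩ := (hρlim.eventually_lt_const hpos).exists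
      exact ⟨N, (hmem j N n).2 hN⟩
  have hL : ∀ N, lineIntegral (integrand q a b lam 1) γ = ∑ j, ∑ n ∈ s j N, V j n +
      (2 * (Real.pi : ℂ) * Complex.I)⁻¹ *
        ∮ z in C(0, ρ * ‖q‖ ^ N), integrand q a b lam 1 z := by
    intro N
    have hρ' : ρ * ‖q‖ ^ N < δ :=
      (mul_le_of_le_one_right hρ.le (pow_le_one₀ (norm_nonneg _) h.norm_q.le)).trans_lt hρδ
    rw [← hsum]
    exact (h.lineIntegral_eq hF hc hγ (hρN N) (fun t => hρ'.trans (hγδ t)) (hρc N)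
      (fun t => (hR₀ t).trans_le (le_max_left _ _)) (hP N)).2
  have hT : Tendsto (fun N => ∑ j, ∑ n ∈ s j N, V j n + (2 * (Real.pi : ℂ) * Complex.I)⁻¹ *
        ∮ z in C(0, ρ * ‖q‖ ^ N), integrand q a b lam 1 z) atTop
      (𝓝 (∑ j, (seriesCoeff q b lam j / ∏ i, qInf q (a i * b j)) *
        ∑' n, seriesTerm q a b j n + (2 * (Real.pi : ℂ) * Complex.I)⁻¹ * 0)) := by
    refine (tendsto_finsetSum _ fun j _ => ?_).add (hlim.const_mul _)
    have h1 : HasSum (V j) _ :=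
      (summable_seriesTerm h.q_ne h.norm_q h.bb a j).hasSum.mul_left
        (seriesCoeff q b lam j / ∏ i, qInf q (a i * b j))
    rw [HasSum, SummationFilter.unconditional_filter] at h1
    have h2 := h1.comp (hslim j)
    exact h2
  have hfinal := tendsto_nhds_unique (tendsto_const_nhds.congr hL) hT
  rw [hfinal, mul_zero, add_zero, residueSum, Finset.mul_sum]
  refine Finset.sum_congr rfl fun j _ => ?_
  have h3 : ∏ i, ∏ k, qInf q (a i * b k) = (∏ i, qInf q (a i * b j)) * offProd q a b j := by
    rw [offProd, ← Finset.prod_mul_distrib]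
    exact Finset.prod_congr rfl fun i _ =>
      (Finset.mul_prod_erase _ (fun k => qInf q (a i * b k)) (Finset.mem_univ j)).symm
  have h4 : ∏ i, qInf q (a i * b j) ≠ 0 := Finset.prod_ne_zero_iff.2 fun i _ =>
    qInf_ne_zero h.norm_q fun m => by
      have := h.mul_pow_ne_one ⟨j, 0, rfl⟩ i m
      rwa [zpow_zero, mul_one] at this
  rw [h3]
  generalize ∏ i, qInf q (a i * b j) = A at *
  field_simp

end WeightIntegral

/-! ### Shifting the parameters by powers of `q`. -/

/-- The parameters `c_j q^(n_j)`. -/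
def qShift (q : ℂ) (c : Fin 3 → ℂ) (n : Fin 3 → ℤ) (j : Fin 3) : ℂ := c j * q ^ n j

section Shift

variable {q : ℂ} {a b lam : Fin 3 → ℂ}

theorem prod_shift (hq0 : q ≠ 0) (c : Fin 3 → ℂ) (n : Fin 3 → ℤ) :
    ∏ j, qShift q c n j = (∏ j, c j) * q ^ (∑ j, n j) := by
  simp only [qShift, Fin.prod_univ_three, Fin.sum_univ_three, zpow_add₀ hq0]
  ring

theorem Inequivalent.shift (hq0 : q ≠ 0) {c : Fin 3 → ℂ} (hc : Inequivalent q c)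
    (n : Fin 3 → ℤ) : Inequivalent q (qShift q c n) := by
  refine ⟨fun i => mul_ne_zero (hc.1 i) (zpow_ne_zero _ hq0), fun i j hij m h => ?_⟩
  refine hc.2 i j hij (m + n j - n i) ?_
  have := zpow_ne_zero (n i) hq0
  rw [qShift, qShift] at h
  rw [zpow_sub₀ hq0, zpow_add₀ hq0]
  field_simp
  linear_combination h

theorem Generic.shift (h : Generic q a b) {k l : Fin 3 → ℤ} (hkl : ∑ j, l j = -∑ j, k j) :
    Generic q (qShift q a k) (qShift q b l) where
  q_ne := h.q_ne
  norm_q := h.norm_q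
  bal := by
    rw [prod_shift h.q_ne, prod_shift h.q_ne, hkl, mul_mul_mul_comm, h.bal, zpow_neg,
      mul_inv_cancel₀ (zpow_ne_zero _ h.q_ne), mul_one]
  aa := h.aa.shift h.q_ne k
  bb := h.bb.shift h.q_ne l
  ab i j n := by
    intro h'
    refine h.ab i j (n - k i - l j) ?_
    have h1 := zpow_ne_zero (k i) h.q_ne
    have h2 := zpow_ne_zero (l j) h.q_ne
    rw [qShift, qShift] at h'
    rw [zpow_sub₀ h.q_ne, zpow_sub₀ h.q_ne]
    field_simp
    linear_combination h'

theorem orbit_shift (hq0 : q ≠ 0) (c : Fin 3 → ℂ) (n : Fin 3 → ℤ) :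
    orbit q (qShift q c n) = orbit q c := by
  ext z
  constructor
  · rintro ⟨j, m, rfl⟩
    exact ⟨j, n j + m, by rw [qShift, zpow_add₀ hq0, mul_assoc]⟩
  · rintro ⟨j, m, rfl⟩
    exact ⟨j, m - n j, by rw [qShift, mul_assoc, ← zpow_add₀ hq0, add_sub_cancel]⟩

theorem shift_inv (q : ℂ) (c : Fin 3 → ℂ) (n : Fin 3 → ℤ) :
    (qShift q c n)⁻¹ = qShift q c⁻¹ (-n) := by
  ext j
  simp [qShift, mul_comm]

theorem candidates_shift (hq0 : q ≠ 0) (a b : Fin 3 → ℂ) (k l : Fin 3 → ℤ) :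
    candidates q (qShift q a k) (qShift q b l) = candidates q a b := by
  rw [candidates, shift_inv, orbit_shift hq0, orbit_shift hq0, candidates]

/-- Shift of the first spectral parameter. -/
def shiftLam (q : ℂ) (lam : Fin 3 → ℂ) (T : ℤ) : Fin 3 → ℂ := ![q ^ T * lam 0, lam 1, lam 2]

theorem Generic.qInf_mul_ne_zero (h : Generic q a b) {z : ℂ}
    (hzc : z ∉ candidates q a b) (j : Fin 3) : qInf q (a j * z) ≠ 0 := by
  refine qInf_ne_zero h.norm_q fun n h1 => hzc (Or.inr ⟨j, -n, ?_⟩)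
  rw [Pi.inv_apply, zpow_neg, zpow_natCast, ← mul_inv]
  refine eq_inv_of_mul_eq_one_left ?_
  rw [← h1]
  ring

theorem Generic.qInf_div_ne_zero (h : Generic q a b) {z : ℂ} (hz : z ≠ 0)
    (hzc : z ∉ candidates q a b) (j : Fin 3) : qInf q (b j / z) ≠ 0 := by
  refine qInf_ne_zero h.norm_q fun n h1 => hzc (Or.inl ⟨j, n, ?_⟩)
  rw [div_mul_eq_mul_div, div_eq_one_iff_eq hz] at h1
  rw [zpow_natCast, h1]

/-- The `q`-shifted factorials replace the denominators by those of the shifted parameters, and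
`z^(-T)` is absorbed into `θ(λ₁ z)` by quasi-periodicity, which shifts `λ₁` by `q^T`. -/
theorem Generic.weight_shift (h : Generic q a b) (hl0 : lam 0 ≠ 0) {k l : Fin 3 → ℤ} {T : ℤ}
    (hk : ∑ j, k j = T) (hl : ∑ j, l j = -T) {z : ℂ} (hz : z ≠ 0) (hzc : z ∉ candidates q a b) :
    (z ^ (-T) * ∏ j, (qFactorial q (a j * z) (k j) * qFactorial q (b j / z) (l j))) *
      weight q a b lam z = (-lam 0) ^ T * q ^ binomTwo T *
        weight q (qShift q a k) (qShift q b l) (shiftLam q lam T) z := by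
  have h' : Generic q (qShift q a k) (qShift q b l) :=
    h.shift (by rw [hl, hk])
  have hzc' : z ∉ candidates q (qShift q a k) (qShift q b l) := by
    rwa [candidates_shift h.q_ne]
  have e1 : ∀ j, qFactorial q (a j * z) (k j) =
      qInf q (a j * z) / qInf q (qShift q a k j * z) := by
    intro j
    have e : qShift q a k j * z = a j * z * q ^ k j := by
      rw [qShift]; ring
    rw [e]
    exact qFactorial_eq_div h.q_ne h.norm_q (e ▸ h'.qInf_mul_ne_zero hzc' j)
  have e2 : ∀ j, qFactorial q (b j / z) (l j) =
      qInf q (b j / z) / qInf q (qShift q b l j / z) := by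
    intro j
    have e : qShift q b l j / z = b j / z * q ^ l j := by
      rw [qShift]; ring
    rw [e]
    exact qFactorial_eq_div h.q_ne h.norm_q (e ▸ h'.qInf_div_ne_zero hz hzc' j)
  have e3 : ∀ j, qFactorial q (a j * z) (k j) * qFactorial q (b j / z) (l j) *
      (theta q (lam j * z) / (qInf q (a j * z) * qInf q (b j / z))) =
      theta q (lam j * z) / (qInf q (qShift q a k j * z) *
        qInf q (qShift q b l j / z)) := by
    intro j
    rw [e1, e2]
    have := h.qInf_mul_ne_zero hzc j
    have := h.qInf_div_ne_zero hz hzc j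
    generalize qInf q (a j * z) = A at *
    generalize qInf q (b j / z) = B at *
    field_simp
  have hn0 : -lam 0 ≠ 0 := neg_ne_zero.2 hl0
  have e4 : z ^ (-T) * theta q (lam 0 * z) =
      (-lam 0) ^ T * q ^ binomTwo T * theta q (q ^ T * lam 0 * z) := by
    have hqT := zpow_ne_zero (binomTwo T) h.q_ne
    have hzT := zpow_ne_zero T hz
    have hlT := zpow_ne_zero T hn0
    rw [mul_assoc (q ^ T), theta_zpow_mul h.q_ne h.norm_q T (mul_ne_zero hl0 hz), ← neg_mul,
      mul_zpow, zpow_neg, zpow_neg, zpow_neg]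
    field_simp
  rw [mul_assoc, weight, ← Finset.prod_mul_distrib, Finset.prod_congr rfl fun j _ => e3 j, weight]
  simp only [Fin.prod_univ_three]
  simp only [shiftLam, Matrix.cons_val_zero, Matrix.cons_val_one, Matrix.cons_val]
  simp only [div_eq_mul_inv]
  linear_combination (qInf q (qShift q a k 0 * z) *
    qInf q (qShift q b l 0 * z⁻¹))⁻¹ *
    (theta q (lam 1 * z) * (qInf q (qShift q a k 1 * z) *
    qInf q (qShift q b l 1 * z⁻¹))⁻¹) *
    (theta q (lam 2 * z) * (qInf q (qShift q a k 2 * z) *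
    qInf q (qShift q b l 2 * z⁻¹))⁻¹) * e4

theorem binomTwo_sub (m n : ℤ) : binomTwo (m - n) = binomTwo m + binomTwo n - m * n + n := by
  have h1 := two_mul_binomTwo (m - n)
  have h2 := two_mul_binomTwo m
  have h3 := two_mul_binomTwo n
  linarith

theorem binomTwo_add (m n : ℤ) : binomTwo (m + n) = binomTwo m + binomTwo n + m * n := by
  have h1 := two_mul_binomTwo (m + n)
  have h2 := two_mul_binomTwo m
  have h3 := two_mul_binomTwo n
  linarith

theorem prod_zpow_three {x : ℂ} (hx : x ≠ 0) (n : Fin 3 → ℤ) : ∏ j, x ^ n j = x ^ ∑ j, n j := by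
  rw [Fin.prod_univ_three, Fin.sum_univ_three, zpow_add₀ hx, zpow_add₀ hx]

/-- The common multiplier of the two terms of `normDenom` under a qShift. -/
def shiftMultiplier (q : ℂ) (a b lam : Fin 3 → ℂ) (k l : Fin 3 → ℤ) (T : ℤ) : ℂ :=
  (-lam 0) ^ (-2 * T) * (-lam 1) ^ T * ((∏ j, a j) ^ T * (∏ j, a j ^ (-k j)) * ∏ j, b j ^ (-l j)) *
    q ^ (-(binomTwo T + ∑ j, binomTwo (k j) + ∑ j, binomTwo (l j)))

/-- Quasi-periodicity of theta gives a multiplier for each of the two products; balancing makes them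
agree once the prefactor `λ₁ / λ₂` is included. -/
theorem normDenom_shift (hq0 : q ≠ 0) (hq1 : ‖q‖ < 1) (ha : ∀ j, a j ≠ 0) (hb : ∀ j, b j ≠ 0)
    (hbal : (∏ j, a j) * ∏ j, b j = q) (hl0 : lam 0 ≠ 0) (hl1 : lam 1 ≠ 0) {k l : Fin 3 → ℤ}
    {T : ℤ} (hk : ∑ j, k j = T) (hl : ∑ j, l j = -T) :
    normDenom q (qShift q a k) (qShift q b l) (q ^ T * lam 0) (lam 1) =
      shiftMultiplier q a b lam k l T * normDenom q a b (lam 0) (lam 1) := by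
  have hn0 : -lam 0 ≠ 0 := neg_ne_zero.2 hl0
  have hn1 : -lam 1 ≠ 0 := neg_ne_zero.2 hl1
  have hA : ∏ j, a j ≠ 0 := Finset.prod_ne_zero_iff.2 fun i _ => ha i
  have hB : ∏ j, b j ≠ 0 := Finset.prod_ne_zero_iff.2 fun i _ => hb i
  have e1 : ∀ j, theta q (q ^ T * lam 0 / qShift q a k j) * theta q (lam 1 * qShift q b l j) =
      (-lam 0) ^ (k j - T) * (-lam 1) ^ (-l j) * (a j ^ T * a j ^ (-k j) * b j ^ (-l j)) *
        q ^ (-(binomTwo (T - k j) + binomTwo (l j))) *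
        (theta q (lam 0 / a j) * theta q (lam 1 * b j)) := by
    intro j
    have r1 : q ^ T * lam 0 / qShift q a k j = q ^ (T - k j) * (lam 0 / a j) := by
      rw [qShift, zpow_sub₀ hq0]; ring
    have r2 : lam 1 * qShift q b l j = q ^ l j * (lam 1 * b j) := by rw [qShift]; ring
    rw [r1, r2, theta_zpow_mul hq0 hq1 _ (div_ne_zero hl0 (ha j)),
      theta_zpow_mul hq0 hq1 _ (mul_ne_zero hl1 (hb j)), ← neg_div, ← neg_mul, div_zpow, mul_zpow,
      neg_add, zpow_add₀ hq0, neg_sub, zpow_sub₀ (ha j), zpow_neg (a j)]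
    have := zpow_ne_zero (k j) (ha j)
    have := zpow_ne_zero T (ha j)
    field_simp
  have e2 : ∀ j, theta q (q ^ T * lam 0 * qShift q b l j) * theta q (lam 1 / qShift q a k j) =
      (-lam 0) ^ (-(T + l j)) * (-lam 1) ^ k j * (b j ^ (-T) * a j ^ (-k j) * b j ^ (-l j)) *
        q ^ (-(binomTwo (T + l j) + binomTwo (-k j))) *
        (theta q (lam 0 * b j) * theta q (lam 1 / a j)) := by
    intro j
    have r1 : q ^ T * lam 0 * qShift q b l j = q ^ (T + l j) * (lam 0 * b j) := by
      rw [qShift, zpow_add₀ hq0]; ring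
    have r2 : lam 1 / qShift q a k j = q ^ (-k j) * (lam 1 / a j) := by
      rw [qShift, zpow_neg]; ring
    rw [r1, r2, theta_zpow_mul hq0 hq1 _ (mul_ne_zero hl0 (hb j)),
      theta_zpow_mul hq0 hq1 _ (div_ne_zero hl1 (ha j)), ← neg_div, ← neg_mul, neg_neg, div_zpow,
      mul_zpow, neg_add (binomTwo (T + l j)), zpow_add₀ hq0, neg_add T, zpow_add₀ (hb j),
      zpow_neg (a j)]
    have := zpow_ne_zero (k j) (ha j)
    field_simp
  have x1 : ∏ j, (q : ℂ) ^ (-(binomTwo (T - k j) + binomTwo (l j))) =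
      q ^ (-(binomTwo T + ∑ j, binomTwo (k j) + ∑ j, binomTwo (l j))) := by
    rw [prod_zpow_three hq0]
    congr 1
    simp only [binomTwo_sub, Fin.sum_univ_three] at hk ⊢
    have := two_mul_binomTwo T
    linear_combination -this + (T - 1) * hk
  have x2 : ∏ j, (q : ℂ) ^ (-(binomTwo (T + l j) + binomTwo (-k j))) =
      q ^ (-(binomTwo T + ∑ j, binomTwo (k j) + ∑ j, binomTwo (l j))) := by
    rw [prod_zpow_three hq0]
    congr 1
    have hneg : ∀ n, binomTwo (-n) = binomTwo n + n := fun n => by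
      have h1 := two_mul_binomTwo (-n)
      have h2 := two_mul_binomTwo n
      linarith
    simp only [binomTwo_add, hneg, Fin.sum_univ_three] at hk hl ⊢
    have := two_mul_binomTwo T
    linear_combination -this - T * hl - hk
  have x3 : ∏ j, a j ^ T = (∏ j, a j) ^ T := Finset.prod_zpow _ _ _
  -- The power `q^(-T)` obtained here cancels the `q^T` that the shift adds to `λ₁ / λ₂`.
  have x4 : ∏ j, b j ^ (-T) = (∏ j, a j) ^ T * q ^ (-T) := by
    rw [Finset.prod_zpow, ← hbal, mul_zpow, ← mul_assoc, ← zpow_add₀ hA, add_neg_cancel, zpow_zero,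
      one_mul]
  rw [normDenom, normDenom, Finset.prod_congr rfl fun j _ => e1 j,
    Finset.prod_congr rfl fun j _ => e2 j]
  simp only [Finset.prod_mul_distrib, x1, x2, x3, x4, prod_zpow_three hn0, prod_zpow_three hn1]
  have y1 : ∑ j, (k j - T) = -2 * T := by
    rw [Fin.sum_univ_three] at hk ⊢; linarith
  have y2 : ∑ j, -l j = T := by
    rw [Fin.sum_univ_three] at hl ⊢; linarith
  have y3 : ∑ j, -(T + l j) = -2 * T := by
    rw [Fin.sum_univ_three] at hl ⊢; linarith
  rw [y1, y2, y3, hk, shiftMultiplier, zpow_neg q T]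
  have := zpow_ne_zero T hq0
  field_simp

end Shift

/-! ### Evaluation of rational functions at regular points, where it respects products and inverses.
-/

section EvalsTo

/-- The rational function `f` is regular at `z` with value `v`. -/
def EvalsTo (f : RatFunc ℂ) (z v : ℂ) : Prop :=
  f.denom.eval z ≠ 0 ∧ f.eval (RingHom.id ℂ) z = v

namespace EvalsTo

variable {f g : RatFunc ℂ} {z v w : ℂ}

theorem C (c z : ℂ) : EvalsTo (RatFunc.C c) z c := by
  refine ⟨by simp, by simp⟩

theorem one (z : ℂ) : EvalsTo 1 z 1 := by
  refine ⟨by simp, by simp⟩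

theorem X (z : ℂ) : EvalsTo RatFunc.X z z := by
  refine ⟨by simp, by simp⟩

theorem mul (hf : EvalsTo f z v) (hg : EvalsTo g z w) : EvalsTo (f * g) z (v * w) := by
  refine ⟨fun h => ?_, ?_⟩
  · have := eval_dvd (x := z) (RatFunc.denom_mul_dvd f g)
    rw [h, eval_mul, zero_dvd_iff] at this
    exact mul_ne_zero hf.1 hg.1 this
  · rw [RatFunc.eval_mul (RingHom.id ℂ) (a := z) (by rw [eval₂_id]; exact hf.1) (by rw [eval₂_id]; exact hg.1), hf.2, hg.2]

theorem inv (hf : EvalsTo f z v) (hv : v ≠ 0) : EvalsTo f⁻¹ z v⁻¹ := by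
  have hf0 : f ≠ 0 := by
    rintro rfl
    exact hv (by rw [← hf.2, RatFunc.eval_zero])
  have h1 : f⁻¹.denom.eval z ≠ 0 := by
    intro h
    have := eval_dvd (x := z) (RatFunc.denom_inv_dvd hf0)
    rw [h, zero_dvd_iff] at this
    exact hv (by rw [← hf.2, eval_eq_div, this, zero_div])
  refine ⟨h1, ?_⟩
  have h2 := RatFunc.eval_mul (RingHom.id ℂ) (x := f) (y := f⁻¹) (a := z)
    (by rw [eval₂_id]; exact hf.1) (by rw [eval₂_id]; exact h1)
  rw [mul_inv_cancel₀ hf0, RatFunc.eval_one, hf.2] at h2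
  exact eq_inv_of_mul_eq_one_right h2.symm

theorem div (hf : EvalsTo f z v) (hg : EvalsTo g z w) (hw : w ≠ 0) : EvalsTo (f / g) z (v / w) := by
  rw [div_eq_mul_inv, div_eq_mul_inv]
  exact hf.mul (hg.inv hw)

theorem one_sub (hf : EvalsTo f z v) : EvalsTo (1 - f) z (1 - v) := by
  have h1 : EvalsTo (RatFunc.C (-1) * f) z (-1 * v) := (C _ _).mul hf
  have e : 1 - f = 1 + RatFunc.C (-1) * f := by simp [sub_eq_add_neg]
  rw [e]
  refine ⟨fun h => ?_, ?_⟩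
  · have := eval_dvd (x := z) (RatFunc.denom_add_dvd 1 (RatFunc.C (-1) * f))
    rw [h, eval_mul, zero_dvd_iff] at this
    exact mul_ne_zero (one z).1 h1.1 this
  · rw [RatFunc.eval_add (RingHom.id ℂ) (a := z) (by rw [eval₂_id]; exact (one z).1) (by rw [eval₂_id]; exact h1.1), h1.2,
      RatFunc.eval_one]
    ring

theorem pow (hf : EvalsTo f z v) (n : ℕ) : EvalsTo (f ^ n) z (v ^ n) := by
  induction n with
  | zero => simpa using one z
  | succ n ih => rw [pow_succ, pow_succ]; exact ih.mul hf

theorem zpow (hf : EvalsTo f z v) (hv : v ≠ 0) (n : ℤ) : EvalsTo (f ^ n) z (v ^ n) := by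
  rcases n with n | n
  · simpa using hf.pow n
  · rw [zpow_negSucc, zpow_negSucc]
    exact (hf.pow _).inv (pow_ne_zero _ hv)

theorem prod {ι : Type*} {s : Finset ι} {f : ι → RatFunc ℂ} {v : ι → ℂ}
    (h : ∀ i ∈ s, EvalsTo (f i) z (v i)) : EvalsTo (∏ i ∈ s, f i) z (∏ i ∈ s, v i) := by
  classical
  induction s using Finset.induction_on with
  | empty => simpa using one z
  | insert i s his ih =>
    rw [Finset.prod_insert his, Finset.prod_insert his]
    exact (h i (by simp)).mul (ih fun j hj => h j (by simp [hj]))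

theorem qFactorial (q : ℂ) (hf : EvalsTo f z v) (k : ℤ) (hq0 : q ≠ 0)
    (hv : ∀ n : ℤ, v * q ^ n ≠ 1) :
    EvalsTo (qFactorial (RatFunc.C q) f k) z (qFactorial q v k) := by
  rcases k with n | n
  · exact prod fun i _ => (hf.mul ((C q z).pow i)).one_sub
  · refine (prod fun i _ => (hf.mul (((C q z).inv hq0).pow (i + 1))).one_sub).inv ?_
    refine Finset.prod_ne_zero_iff.2 fun i _ => sub_ne_zero.2 fun h => hv (-(i + 1 : ℕ)) ?_
    rw [zpow_neg, zpow_natCast, ← inv_pow]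
    exact h.symm

end EvalsTo

theorem Generic.eval_spanningFunction {q : ℂ} {a b : Fin 3 → ℂ} (h : Generic q a b)
    (k l : Fin 3 → ℤ) (T : ℤ) {z : ℂ} (hz : z ≠ 0) (hzc : z ∉ candidates q a b) :
    (spanningFunction q a b k l T).eval (RingHom.id ℂ) z =
      z ^ (-T) * ∏ j, (qFactorial q (a j * z) (k j) * qFactorial q (b j / z) (l j)) := by
  refine And.right (a := (spanningFunction q a b k l T).denom.eval z ≠ 0)
    (((EvalsTo.X z).zpow hz _).mul (EvalsTo.prod fun j _ =>
    (((EvalsTo.C (a j) z).mul (EvalsTo.X z)).qFactorial q (k j) h.q_ne fun n h1 => ?_).mul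
    (((EvalsTo.C (b j) z).div (EvalsTo.X z) hz).qFactorial q (l j) h.q_ne fun n h1 => ?_)))
  · refine hzc (Or.inr ⟨j, -n, ?_⟩)
    rw [Pi.inv_apply, zpow_neg, ← mul_inv]
    refine eq_inv_of_mul_eq_one_left ?_
    rw [← h1]
    ring
  · refine hzc (Or.inl ⟨j, n, ?_⟩)
    rw [div_mul_eq_mul_div, div_eq_one_iff_eq hz] at h1
    rw [h1]

end EvalsTo

/-! ### Evaluation of the integral on the spanning functions. -/

section SpanningValue

variable {q : ℂ} {a b lam : Fin 3 → ℂ}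

theorem Generic.integrand_spanningFunction (h : Generic q a b) (hl0 : lam 0 ≠ 0) {k l : Fin 3 → ℤ}
    {T : ℤ} (hk : ∑ j, k j = T) (hl : ∑ j, l j = -T) {z : ℂ} (hz : z ≠ 0)
    (hzc : z ∉ candidates q a b) :
    integrand q a b lam (spanningFunction q a b k l T) z = (-lam 0) ^ T * q ^ binomTwo T *
      integrand q (qShift q a k) (qShift q b l) (shiftLam q lam T) 1 z := by
  rw [integrand, h.eval_spanningFunction k l T hz hzc, h.weight_shift hl0 hk hl hz hzc,
    integrand_one, mul_div_assoc]

theorem Generic.eventually_notMem (h : Generic q a b) {z : ℂ} (hz : z ≠ 0) :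
    ∀ᶠ y in 𝓝[≠] z, y ≠ 0 ∧ y ∉ candidates q a b := by
  have h0 : ∀ᶠ y in 𝓝 z, y ≠ 0 := isOpen_ne.mem_nhds hz
  refine (h0.filter_mono nhdsWithin_le_nhds).and ?_
  by_cases hzc : z ∈ candidates q a b
  · obtain ⟨ε, hε, h1⟩ := h.exists_isolated hzc
    filter_upwards [self_mem_nhdsWithin, nhdsWithin_le_nhds (Metric.ball_mem_nhds z hε)]
      with y hy hy' hyc
    have := h1 y (Or.inr hyc) hy
    rw [Metric.mem_ball, dist_eq_norm] at hy'
    exact lt_asymm this hy'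
  · have hz1 : 0 < ‖z‖ := norm_pos_iff.2 hz
    have hfin := h.finite_candidates_inter (half_pos hz1) (2 * ‖z‖)
    have h1 : ∀ᶠ y in 𝓝 z, y ∉ {z' | z' ∈ candidates q a b ∧ ‖z‖ / 2 ≤ ‖z'‖ ∧ ‖z'‖ ≤ 2 * ‖z‖} :=
      hfin.isClosed.isOpen_compl.mem_nhds fun hh => hzc hh.1
    have h2 : ∀ᶠ y in 𝓝 z, ‖z‖ / 2 < ‖y‖ :=
      continuous_norm.continuousAt.eventually_const_lt (half_lt_self hz1)
    have h3 : ∀ᶠ y in 𝓝 z, ‖y‖ < 2 * ‖z‖ :=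
      continuous_norm.continuousAt.eventually_lt_const (by linarith)
    filter_upwards [nhdsWithin_le_nhds h1, nhdsWithin_le_nhds h2, nhdsWithin_le_nhds h3]
      with y k1 k2 k3 hyc
    exact k1 ⟨hyc, k2.le, k3.le⟩

theorem meromorphicOrderAt_const_mul {F F' : ℂ → ℂ} {c p : ℂ} (hc : c ≠ 0)
    (h : ∀ᶠ z in 𝓝[≠] p, F z = c * F' z) (hF' : MeromorphicAt F' p) :
    meromorphicOrderAt F p = meromorphicOrderAt F' p := by
  rw [meromorphicOrderAt_congr h]
  have h1 : meromorphicOrderAt (fun _ : ℂ => c) p = 0 := by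
    rw [← tendsto_ne_zero_iff_meromorphicOrderAt_eq_zero (MeromorphicAt.const c p)]
    exact ⟨c, hc, tendsto_const_nhds⟩
  have := meromorphicOrderAt_mul (MeromorphicAt.const c p) hF'
  rw [h1, zero_add] at this
  exact this

theorem Generic.prod_shiftLam (h : Generic q a b) (hlb : (∏ j, lam j) * ∏ j, b j = q ^ 2)
    {l : Fin 3 → ℤ} {T : ℤ} (hl : ∑ j, l j = -T) :
    (∏ j, shiftLam q lam T j) * ∏ j, qShift q b l j = q ^ 2 := by
  have e : ∏ j, shiftLam q lam T j = q ^ T * ∏ j, lam j := by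
    simp [shiftLam, Fin.prod_univ_three, mul_assoc]
  have := zpow_ne_zero T h.q_ne
  rw [e, prod_shift h.q_ne, hl, ← hlb, zpow_neg]
  field_simp

theorem shiftLam_ne_zero (hq0 : q ≠ 0) (hl : ∀ j, lam j ≠ 0) (T : ℤ) (j : Fin 3) :
    shiftLam q lam T j ≠ 0 := by
  fin_cases j
  · exact mul_ne_zero (zpow_ne_zero _ hq0) (hl 0)
  · exact hl 1
  · exact hl 2

/-- Off the countable set of candidates the two integrands are proportional, so they have the same
orders everywhere in the punctured plane; the shift only renumbers the exponents within each orbit.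
-/
theorem Generic.isContour_shift (h : Generic q a b) (hl : ∀ j, lam j ≠ 0)
    (hlb : (∏ j, lam j) * ∏ j, b j = q ^ 2) {k l : Fin 3 → ℤ}
    {T : ℤ} (hk : ∑ j, k j = T) (hl' : ∑ j, l j = -T) {z₀ : ℂ} {γ : Path z₀ z₀}
    (hγ : IsContour q a b (integrand q a b lam (spanningFunction q a b k l T)) γ) :
    IsContour q (qShift q a k) (qShift q b l)
      (integrand q (qShift q a k) (qShift q b l) (shiftLam q lam T) 1) γ := by
  have h' : Generic q (qShift q a k) (qShift q b l) := h.shift (by rw [hl', hk])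
  have hF := h'.admissible_integrand (shiftLam_ne_zero h.q_ne hl T) (h.prod_shiftLam hlb hl')
    (one_mem_W q (qShift q a k) (qShift q b l))
  have hmer : ∀ z ≠ 0, MeromorphicAt
      (integrand q (qShift q a k) (qShift q b l) (shiftLam q lam T) 1) z := by
    intro z hz
    by_cases hzc : z ∈ candidates q (qShift q a k) (qShift q b l)
    · exact (hF.hasSimplePole z hzc).choose_spec.meromorphicAt
    · exact (hF.analyticAt z hz hzc).meromorphicAt
  have hord : ∀ z ≠ 0, meromorphicOrderAt
      (integrand q a b lam (spanningFunction q a b k l T)) z = meromorphicOrderAt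
      (integrand q (qShift q a k) (qShift q b l) (shiftLam q lam T) 1) z := by
    intro z hz
    refine meromorphicOrderAt_const_mul (c := (-lam 0) ^ T * q ^ binomTwo T)
      (mul_ne_zero (zpow_ne_zero _ (neg_ne_zero.2 (hl 0))) (zpow_ne_zero _ h.q_ne)) ?_ (hmer z hz)
    filter_upwards [h.eventually_notMem hz] with y hy
    exact h.integrand_spanningFunction (hl 0) hk hl' hy.1 hy.2
  refine ⟨hγ.piecewiseC1, hγ.ne_zero, fun t => ?_, hγ.winding_zero, fun j m hm => ?_,
    fun j m hm => ?_⟩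
  · rw [← hord _ (hγ.ne_zero t)]
    exact hγ.avoids t
  · have e : qShift q b l j * q ^ m = b j * q ^ (l j + m) := by
      rw [qShift, zpow_add₀ h.q_ne, mul_assoc]
    have hne : b j * q ^ (l j + m) ≠ 0 := mul_ne_zero (h.bb.1 j) (zpow_ne_zero _ h.q_ne)
    rw [e] at hm ⊢
    rw [← hord _ hne] at hm
    exact hγ.inside j _ hm
  · have e : (qShift q a k j)⁻¹ * q ^ m = (a j)⁻¹ * q ^ (-k j + m) := by
      rw [qShift, mul_inv, zpow_add₀ h.q_ne, zpow_neg, mul_assoc]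
    have hne : (a j)⁻¹ * q ^ (-k j + m) ≠ 0 :=
      mul_ne_zero (inv_ne_zero (h.aa.1 j)) (zpow_ne_zero _ h.q_ne)
    rw [e] at hm ⊢
    rw [← hord _ hne] at hm
    exact hγ.outside j _ hm

theorem Generic.qInf_ne_zero (h : Generic q a b) (i j : Fin 3) : qInf q (a i * b j) ≠ 0 :=
  AlSalamIsmail.qInf_ne_zero h.norm_q fun m => by
    have := h.mul_pow_ne_one ⟨j, 0, rfl⟩ i m
    rwa [zpow_zero, mul_one] at this

/-- The integral representation on the spanning functions. -/
theorem Generic.normFactor_mul_lineIntegral (h : Generic q a b)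
    (hlam : ∏ j, lam j = q * ∏ j, a j) (hD : normDenom q a b (lam 0) (lam 1) ≠ 0)
    {k l : Fin 3 → ℤ} {T : ℤ} (hk : ∑ j, k j = T) (hl' : ∑ j, l j = -T) {z₀ : ℂ} {γ : Path z₀ z₀}
    (hγ : IsContour q a b (integrand q a b lam (spanningFunction q a b k l T)) γ) :
    normFactor q a b (lam 0) (lam 1) *
      lineIntegral (integrand q a b lam (spanningFunction q a b k l T)) γ =
    spanningValue q a b k l T := by
  have hlb : (∏ j, lam j) * ∏ j, b j = q ^ 2 := by rw [hlam, mul_assoc, h.bal, sq]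
  have hl : ∀ j, lam j ≠ 0 := by
    have : ∏ j, lam j ≠ 0 := by
      rw [hlam]
      exact mul_ne_zero h.q_ne (Finset.prod_ne_zero_iff.2 fun i _ => h.aa.1 i)
    exact fun j => Finset.prod_ne_zero_iff.1 this j (Finset.mem_univ j)
  have h' : Generic q (qShift q a k) (qShift q b l) := h.shift (by rw [hl', hk])
  have hγ' := h.isContour_shift hl hlb hk hl' hγ
  have hl'' := shiftLam_ne_zero h.q_ne hl T
  have hlb' := h.prod_shiftLam hlb hl'
  have h1 := h'.lineIntegral_one hl'' hlb' hγ'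
  have hB' : ∏ j, qShift q b l j ≠ 0 := Finset.prod_ne_zero_iff.2 fun i _ => h'.bb.1 i
  have hlam' : ∏ j, shiftLam q lam T j = q * ∏ j, qShift q a k j := by
    refine mul_right_cancel₀ hB' ?_
    rw [hlb', mul_assoc, h'.bal, sq]
  have h2 := residueSum_eq h.q_ne h.norm_q h'.bb h'.aa.1 h'.bal hlam' (hl'' 0) (hl'' 1) (h'.ab 2)
  have h3 := residueSum_eq h.q_ne h.norm_q h.bb h.aa.1 h.bal hlam (hl 0) (hl 1) (h.ab 2)
  -- The evaluation for the unshifted parameters serves only to show this: if the theta factor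
  -- vanished, so would `normDenom`.
  have hθ : theta q (lam 0 / lam 1) ≠ 0 := by
    intro hθ
    rw [hθ, mul_zero, zero_mul] at h3
    exact hD h3.symm
  have h4 : shiftLam q lam T 0 = q ^ T * lam 0 := rfl
  have h5 : shiftLam q lam T 1 = lam 1 := rfl
  rw [h4, h5, normDenom_shift h.q_ne h.norm_q h.aa.1 h.bb.1 h.bal (hl 0) (hl 1) hk hl', mul_div_assoc,
    theta_zpow_mul h.q_ne h.norm_q T (div_ne_zero (hl 0) (hl 1)), ← h1] at h2
  have h6 : lineIntegral (integrand q a b lam (spanningFunction q a b k l T)) γ =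
      (-lam 0) ^ T * q ^ binomTwo T * lineIntegral
        (integrand q (qShift q a k) (qShift q b l) (shiftLam q lam T) 1) γ := by
    have := curveIntegral_congr (γ := γ)
      (F := integrand q a b lam (spanningFunction q a b k l T))
      (F' := fun z => (-lam 0) ^ T * q ^ binomTwo T *
        integrand q (qShift q a k) (qShift q b l) (shiftLam q lam T) 1 z)
      ⟨candidates q a b, h.countable_candidates, fun t ht =>
        h.integrand_spanningFunction (hl 0) hk hl' (hγ.ne_zero t) ht⟩
    rw [lineIntegral, lineIntegral, this, curveIntegral_oneForm_const_mul]
    ring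
  have h7 : ∏ i, ∏ j, qFactorial q (a i * b j) (k i + l j) =
      (∏ i, ∏ j, qInf q (a i * b j)) / ∏ i, ∏ j, qInf q (qShift q a k i * qShift q b l j) := by
    rw [← Finset.prod_div_distrib]
    refine Finset.prod_congr rfl fun i _ => ?_
    rw [← Finset.prod_div_distrib]
    refine Finset.prod_congr rfl fun j _ => ?_
    have e : qShift q a k i * qShift q b l j = a i * b j * q ^ (k i + l j) := by
      rw [qShift, qShift, zpow_add₀ h.q_ne]; ring
    rw [e]
    exact qFactorial_eq_div h.q_ne h.norm_q (e ▸ h'.qInf_ne_zero i j)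
  have hP' : ∏ i, ∏ j, qInf q (qShift q a k i * qShift q b l j) ≠ 0 :=
    Finset.prod_ne_zero_iff.2 fun i _ => Finset.prod_ne_zero_iff.2 fun j _ => h'.qInf_ne_zero i j
  have h8 : ∏ j, (q ^ (binomTwo (k j) + binomTwo (l j)) * a j ^ k j * b j ^ l j) =
      q ^ (∑ j, binomTwo (k j)) * q ^ (∑ j, binomTwo (l j)) * (∏ j, a j ^ k j) *
        ∏ j, b j ^ l j := by
    simp only [zpow_add₀ h.q_ne, Finset.prod_mul_distrib, prod_zpow_three h.q_ne]
  rw [h6, spanningValue, normFactor, h7, h8]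
  have hqq := qInf_q_ne_zero h.norm_q
  generalize lineIntegral (integrand q (qShift q a k) (qShift q b l) (shiftLam q lam T) 1) γ = L at *
  rw [shiftMultiplier] at h2
  have m1 : (∏ j, a j ^ (-k j)) = (∏ j, a j ^ k j)⁻¹ := by
    simp only [zpow_neg, Finset.prod_inv_distrib]
  have m2 : (∏ j, b j ^ (-l j)) = (∏ j, b j ^ l j)⁻¹ := by
    simp only [zpow_neg, Finset.prod_inv_distrib]
  have n0 : (-lam 0) ≠ 0 := neg_ne_zero.2 (hl 0)
  have n1 : (-lam 1) ≠ 0 := neg_ne_zero.2 (hl 1)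
  have m3 : (-lam 0) ^ (-2 * T) = ((-lam 0) ^ T * (-lam 0) ^ T)⁻¹ := by
    rw [← zpow_add₀ n0, ← zpow_neg]; congr 1; ring
  -- The normalizing theta factor is also shifted by `q^T`. Its multiplier, together with `m3`,
  -- removes all dependence on `λ` from the final value.
  have m4 : (-(lam 0 / lam 1)) ^ (-T) = (-1) ^ T * (-lam 1) ^ T * ((-lam 0) ^ T)⁻¹ := by
    rw [← mul_zpow, zpow_neg, ← inv_zpow, ← inv_zpow, ← mul_zpow]
    congr 1
    field_simp
  have m5 : (-(∏ j, a j)) ^ T = (-1) ^ T * (∏ j, a j) ^ T := by rw [← mul_zpow, neg_one_mul]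
  have m6 : q ^ (-(binomTwo T + ∑ j, binomTwo (k j) + ∑ j, binomTwo (l j))) =
      (q ^ binomTwo T * q ^ (∑ j, binomTwo (k j)) * q ^ (∑ j, binomTwo (l j)))⁻¹ := by
    rw [← zpow_add₀ h.q_ne, ← zpow_add₀ h.q_ne, zpow_neg]
  rw [m1, m2, m3, m4, m6, zpow_neg q] at h2
  rw [m5]
  have z1 : (∏ j, a j ^ k j) ≠ 0 := Finset.prod_ne_zero_iff.2 fun i _ => zpow_ne_zero _ (h.aa.1 i)
  have z2 : (∏ j, b j ^ l j) ≠ 0 := Finset.prod_ne_zero_iff.2 fun i _ => zpow_ne_zero _ (h.bb.1 i)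
  have z3 : (-lam 0) ^ T ≠ 0 := zpow_ne_zero _ n0
  have z4 : (-lam 1) ^ T ≠ 0 := zpow_ne_zero _ n1
  have z5 : q ^ binomTwo T ≠ 0 := zpow_ne_zero _ h.q_ne
  have z6 : q ^ (∑ j, binomTwo (k j)) ≠ 0 := zpow_ne_zero _ h.q_ne
  have z7 : q ^ (∑ j, binomTwo (l j)) ≠ 0 := zpow_ne_zero _ h.q_ne
  have z8 : ((-1 : ℂ)) ^ T ≠ 0 := zpow_ne_zero _ (by norm_num)
  have z9 : ((-1 : ℂ)) ^ T * (-1) ^ T = 1 := by rw [← mul_zpow]; norm_num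
  generalize (∏ i, ∏ j, qInf q (qShift q a k i * qShift q b l j)) = P' at *
  generalize (∏ i, ∏ j, qInf q (a i * b j)) = P at *
  generalize normDenom q a b (lam 0) (lam 1) = D at *
  generalize theta q (lam 0 / lam 1) = θ at *
  generalize (∏ j, a j ^ k j) = A1 at *
  generalize (∏ j, b j ^ l j) = B1 at *
  generalize (-lam 0) ^ T = x0 at *
  generalize (-lam 1) ^ T = x1 at *
  generalize q ^ binomTwo T = y0 at *
  generalize q ^ (∑ j, binomTwo (k j)) = y1 at *
  generalize q ^ (∑ j, binomTwo (l j)) = y2 at *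
  generalize (-1 : ℂ) ^ T = s at *
  generalize (∏ j, a j) ^ T = AT at *
  clear * - h2 hqq z1 z2 z3 z4 z5 z6 z7 z8 z9 hD hP' hθ
  field_simp at h2 ⊢
  linear_combination s * P * h2 - qInf q q * x0 * θ * P' * L * A1 * B1 * y1 * y2 * P * z9

end SpanningValue

/-! ### Partial fractions with simple poles. -/

section Fractions

/-- The rational function `f` has only simple poles, all in `s`, and degree at most `e`. -/
def IsFraction (s : Finset ℂ) (e : ℤ) (f : RatFunc ℂ) : Prop :=
  ∃ N : ℂ[X], f * algebraMap ℂ[X] (RatFunc ℂ) (∏ p ∈ s, (X - C p)) = algebraMap _ _ N ∧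
    (N.natDegree : ℤ) ≤ s.card + e

namespace IsFraction

variable {s t : Finset ℂ} {e e' : ℤ} {f g : RatFunc ℂ}

theorem of_polynomial {N : ℂ[X]} {n : ℕ} (h : N.natDegree ≤ n) :
    IsFraction ∅ n (algebraMap ℂ[X] (RatFunc ℂ) N) :=
  ⟨N, by simp, by simpa using h⟩

theorem mul (hf : IsFraction s e f) (hg : IsFraction t e' g) (hst : Disjoint s t) :
    IsFraction (s ∪ t) (e + e') (f * g) := by
  obtain ⟨N, hN, hd⟩ := hf
  obtain ⟨N', hN', hd'⟩ := hg
  refine ⟨N * N', ?_, ?_⟩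
  · rw [Finset.prod_union hst, map_mul, map_mul, ← hN, ← hN']
    ring
  · rw [Finset.card_union_of_disjoint hst]
    have := natDegree_mul_le (p := N) (q := N')
    push_cast
    zify at this
    linarith

theorem prod {ι : Type*} {u : Finset ι} {s : ι → Finset ℂ} {e : ι → ℤ} {f : ι → RatFunc ℂ}
    (h : ∀ i ∈ u, IsFraction (s i) (e i) (f i))
    (hs : (u : Set ι).PairwiseDisjoint s) :
    IsFraction (u.biUnion s) (∑ i ∈ u, e i) (∏ i ∈ u, f i) := by
  classical
  induction u using Finset.induction_on with
  | empty => simpa using of_polynomial (N := 1) (n := 0) (by simp)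
  | insert i u hi ih =>
    rw [Finset.biUnion_insert, Finset.sum_insert hi, Finset.prod_insert hi]
    refine (h i (by simp)).mul (ih (fun j hj => h j (by simp [hj]))
      (hs.subset (by simp))) ?_
    rw [Finset.disjoint_biUnion_right]
    exact fun j hj => hs (by simp) (by simp [hj]) fun hij => hi (hij ▸ hj)

theorem mem_W (h : IsFraction s 0 f) {q : ℂ} {a b : Fin 3 → ℂ} (hs : ∀ p ∈ s, p ∈ poleSet q a b) :
    f ∈ W q a b := by
  obtain ⟨N, hN, hd⟩ := h
  set P : ℂ[X] := ∏ p ∈ s, (X - C p) with hP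
  have hP0 : P ≠ 0 := Finset.prod_ne_zero_iff.2 fun p _ => X_sub_C_ne_zero p
  have hP0' : algebraMap ℂ[X] (RatFunc ℂ) P ≠ 0 := RatFunc.algebraMap_ne_zero hP0
  have hPd : P.natDegree = s.card := natDegree_finsetProd_X_sub_C_eq_card s fun p => p
  have hPs : Squarefree P := (separable_prod_X_sub_C_iff'.2 fun _ _ _ _ h => h).squarefree
  have hdvd : f.denom ∣ P := (RatFunc.denom_dvd hP0).2 ⟨N, by rw [← hN, mul_div_cancel_right₀ _ hP0']⟩
  refine ⟨?_, hPs.squarefree_of_dvd hdvd, fun z hz => hs z ?_⟩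
  · by_cases hf : f = 0
    · simp [hf]
    have h1 := RatFunc.intDegree_mul hf hP0'
    rw [hN, RatFunc.intDegree_polynomial, RatFunc.intDegree_polynomial, hPd] at h1
    linarith
  · have h1 := hz.dvd hdvd
    rw [IsRoot, hP, eval_prod, Finset.prod_eq_zero_iff] at h1
    obtain ⟨p, hp, h2⟩ := h1
    rw [eval_sub, eval_X, eval_C, sub_eq_zero] at h2
    rwa [h2]

/-- Over `ℂ` a squarefree monic denominator is the product of `X - p` over its distinct roots. -/
theorem of_mem_W {q : ℂ} {a b : Fin 3 → ℂ} (hf : f ∈ W q a b) :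
    ∃ s : Finset ℂ, (∀ p ∈ s, p ∈ poleSet q a b) ∧ IsFraction s 0 f := by
  obtain ⟨h1, h2, h3⟩ := hf
  have hsp : f.denom.Splits := IsAlgClosed.splits _
  have hnd : f.denom.roots.Nodup := nodup_roots (PerfectField.separable_iff_squarefree.2 h2)
  have hprod : ∏ p ∈ (⟨f.denom.roots, hnd⟩ : Finset ℂ), (X - C p) = f.denom :=
    (hsp.eq_prod_roots_of_monic (RatFunc.monic_denom f)).symm
  refine ⟨⟨f.denom.roots, hnd⟩, fun p hp => h3 p (isRoot_of_mem_roots hp), f.num, ?_, ?_⟩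
  · rw [hprod]
    exact (eq_div_iff (RatFunc.algebraMap_ne_zero f.denom_ne_zero)).1 (RatFunc.num_div_denom f).symm
  · have hcard : f.denom.natDegree = f.denom.roots.card := hsp.natDegree_eq_card_roots
    rw [RatFunc.intDegree, hcard] at h1
    rw [Finset.card_mk]
    linarith

/-- Subtracting the principal part at `p` makes the new numerator divisible by `X - p`; this removes
the pole and keeps the degree bound. -/
theorem sub_simple {N : ℂ[X]} {p : ℂ} (hp : p ∉ s)
    (hN : f * algebraMap ℂ[X] (RatFunc ℂ) (∏ p ∈ insert p s, (X - C p)) = algebraMap _ _ N)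
    (hd : N.natDegree ≤ s.card + 1) :
    IsFraction s 0 (f - RatFunc.C (N.eval p / ∏ p' ∈ s, (p - p')) *
      (algebraMap ℂ[X] (RatFunc ℂ) (X - C p))⁻¹) := by
  set P : ℂ[X] := ∏ p ∈ s, (X - C p) with hP
  have hPp : P.eval p = ∏ p' ∈ s, (p - p') := by simp [hP, eval_prod]
  have hPp0 : P.eval p ≠ 0 := by
    rw [hPp]
    exact Finset.prod_ne_zero_iff.2 fun p' hp' h => hp (by rwa [sub_eq_zero.1 h])
  have hPd : P.natDegree = s.card := natDegree_finsetProd_X_sub_C_eq_card s fun p => p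
  rw [← hPp]
  set c := N.eval p / P.eval p with hc
  have hroot : (N - C c * P).IsRoot p := by
    rw [IsRoot, eval_sub, eval_mul, eval_C, hc, div_mul_cancel₀ _ hPp0, sub_self]
  obtain ⟨N', hN'⟩ := dvd_iff_isRoot.2 hroot
  have hX : algebraMap ℂ[X] (RatFunc ℂ) (X - C p) ≠ 0 :=
    RatFunc.algebraMap_ne_zero (X_sub_C_ne_zero p)
  refine ⟨N', mul_left_cancel₀ hX ?_, ?_⟩
  · have e : algebraMap ℂ[X] (RatFunc ℂ) N =
        f * (algebraMap ℂ[X] (RatFunc ℂ) (X - C p) * algebraMap ℂ[X] (RatFunc ℂ) P) := by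
      rw [← hN, Finset.prod_insert hp, map_mul]
    rw [← map_mul, ← hN', map_sub _ N, e, map_mul, RatFunc.algebraMap_C, ← hP]
    field_simp
  · have h1 : (N - C c * P).natDegree ≤ s.card + 1 := by
      refine (natDegree_sub_le _ _).trans (max_le hd ?_)
      exact (natDegree_C_mul_le _ _).trans (by omega)
    by_cases h0 : N' = 0
    · simp [h0]
    rw [hN', natDegree_mul (X_sub_C_ne_zero p) h0, natDegree_X_sub_C] at h1
    omega

/-- Partial fractions. -/
theorem mem_submodule {S : Submodule ℂ (RatFunc ℂ)} (h1 : 1 ∈ S) (hf : IsFraction s 0 f)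
    (hs : ∀ p ∈ s, (algebraMap ℂ[X] (RatFunc ℂ) (X - C p))⁻¹ ∈ S) : f ∈ S := by
  classical
  induction s using Finset.induction_on generalizing f with
  | empty =>
    obtain ⟨N, hN, hd⟩ := hf
    have h0 : N.natDegree = 0 := by simpa using hd
    rw [Finset.prod_empty, map_one, mul_one] at hN
    rw [hN, eq_C_of_natDegree_eq_zero h0, RatFunc.algebraMap_C, ← mul_one (RatFunc.C _),
      ← RatFunc.smul_eq_C_mul]
    exact S.smul_mem _ h1
  | insert p s hp ih =>
    obtain ⟨N, hN, hd⟩ := hf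
    rw [Finset.card_insert_of_notMem hp] at hd
    have h2 := ih (sub_simple hp hN (by push_cast at hd; omega)) fun p' hp' => hs p' (by simp [hp'])
    have h3 := S.add_mem h2 (S.smul_mem (N.eval p / ∏ p' ∈ s, (p - p')) (hs p (by simp)))
    rwa [RatFunc.smul_eq_C_mul, sub_add_cancel] at h3

/-- A triangular elimination: `g n` has its poles among the first `n + 1` points and an actual pole
at the last of them, so its other principal parts can be removed inductively. -/
theorem inv_mem_submodule {S : Submodule ℂ (RatFunc ℂ)} (h1 : 1 ∈ S) {p : ℕ → ℂ}
    (hp : Function.Injective p) {g : ℕ → RatFunc ℂ} {N : ℕ → ℂ[X]} (hg : ∀ n, g n ∈ S)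
    (hN : ∀ n, g n * algebraMap ℂ[X] (RatFunc ℂ) (∏ i ∈ Finset.range (n + 1), (X - C (p i))) =
      algebraMap _ _ (N n))
    (hd : ∀ n, (N n).natDegree ≤ n + 1) (h0 : ∀ n, (N n).eval (p n) ≠ 0) (n : ℕ) :
    (algebraMap ℂ[X] (RatFunc ℂ) (X - C (p n)))⁻¹ ∈ S := by
  classical
  induction n using Nat.strong_induction_on with
  | _ n ih =>
    set s := (Finset.range n).image p with hs
    have hps : p n ∉ s := by
      rw [hs, Finset.mem_image]
      rintro ⟨i, hi, hin⟩
      exact absurd (hp hin) (Finset.mem_range.1 hi).ne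
    have hcard : s.card = n := by rw [hs, Finset.card_image_of_injective _ hp, Finset.card_range]
    have hprod : ∏ p' ∈ insert (p n) s, (X - C p') =
        ∏ i ∈ Finset.range (n + 1), (X - C (p i)) := by
      rw [Finset.prod_insert hps, Finset.prod_range_succ, mul_comm, hs,
        Finset.prod_image fun i _ j _ h => hp h]
    have h2 := mem_submodule h1 (sub_simple hps (by rw [hprod, hN]) (by rw [hcard]; exact hd n))
      fun p' hp' => by
        obtain ⟨i, hi, rfl⟩ := Finset.mem_image.1 hp'
        exact ih i (Finset.mem_range.1 hi)
    have hc : (N n).eval (p n) / ∏ p' ∈ s, (p n - p') ≠ 0 :=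
      div_ne_zero (h0 n) (Finset.prod_ne_zero_iff.2 fun p' hp' h =>
        hps (by rwa [sub_eq_zero.1 h]))
    have h3 := S.sub_mem (hg n) h2
    rw [sub_sub_cancel, ← RatFunc.smul_eq_C_mul] at h3
    exact (S.smul_mem_iff hc).1 h3

end IsFraction

end Fractions

/-! ### The spanning functions lie in `W` and span it. -/

section Spanning

variable {q : ℂ} {a b : Fin 3 → ℂ}

/-- The points `c r^i` with `1 ≤ i ≤ n`. -/
def geometricPoles (c r : ℂ) (n : ℕ) : Finset ℂ := (Finset.range n).image fun i => c * r ^ (i + 1)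

theorem pow_succ_injective (hq0 : q ≠ 0) (hq1 : ‖q‖ < 1) {c : ℂ} (hc : c ≠ 0) :
    Function.Injective fun i : ℕ => c * q ^ (i + 1) := by
  intro i j hij
  have h1 := mul_left_cancel₀ hc hij
  have h2 := zpow_injective hq0 hq1 (a₁ := (i + 1 : ℕ)) (a₂ := (j + 1 : ℕ))
    (by simp only [zpow_natCast]; exact h1)
  simp only [Nat.cast_inj] at h2
  omega

theorem inv_pow_succ_injective (hq0 : q ≠ 0) (hq1 : ‖q‖ < 1) {c : ℂ} (hc : c ≠ 0) :
    Function.Injective fun i : ℕ => c * q⁻¹ ^ (i + 1) := by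
  intro i j hij
  have h1 := mul_left_cancel₀ hc hij
  simp only [inv_pow, inv_inj] at h1
  exact pow_succ_injective hq0 hq1 one_ne_zero (by simpa using h1)

theorem natDegree_prod_range_le {n : ℕ} {f : ℕ → ℂ[X]} (h : ∀ i, (f i).natDegree ≤ 1) :
    (∏ i ∈ Finset.range n, f i).natDegree ≤ n := by
  refine (natDegree_prod_le _ _).trans ?_
  calc ∑ i ∈ Finset.range n, (f i).natDegree ≤ ∑ _i ∈ Finset.range n, 1 :=
        Finset.sum_le_sum fun i _ => h i
    _ = n := by simp

/-- The numerator of `(a z)_n`. -/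
def pochNumer (q a : ℂ) (n : ℕ) : ℂ[X] := ∏ i ∈ Finset.range n, (1 - C (a * q ^ i) * X)

/-- The numerator of `(b / z)_n`. -/
def pochNumer' (q b : ℂ) (n : ℕ) : ℂ[X] := ∏ i ∈ Finset.range n, (X - C (b * q ^ i))

theorem natDegree_pochNumer_le (q a : ℂ) (n : ℕ) : (pochNumer q a n).natDegree ≤ n :=
  natDegree_prod_range_le fun i => by compute_degree

theorem natDegree_pochNumer'_le (q a : ℂ) (n : ℕ) : (pochNumer' q a n).natDegree ≤ n :=
  natDegree_prod_range_le fun i => by compute_degree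

theorem qFactorial_C_mul_X (q a : ℂ) (n : ℕ) :
    qFactorial (RatFunc.C q) (RatFunc.C a * RatFunc.X) (n : ℤ) =
      algebraMap ℂ[X] (RatFunc ℂ) (pochNumer q a n) := by
  rw [← Int.ofNat_eq_natCast, qFactorial, pochNumer, map_prod]
  refine Finset.prod_congr rfl fun i _ => ?_
  simp only [map_sub, map_mul, map_one, RatFunc.algebraMap_C, RatFunc.algebraMap_X, map_pow]
  ring

theorem X_pow_mul_qFactorial_C_div_X (q b : ℂ) (n : ℕ) :
    RatFunc.X ^ n * qFactorial (RatFunc.C q) (RatFunc.C b / RatFunc.X) (n : ℤ) =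
      algebraMap ℂ[X] (RatFunc ℂ) (pochNumer' q b n) := by
  rw [← Int.ofNat_eq_natCast, qFactorial, pochNumer', map_prod]
  have e : (RatFunc.X : RatFunc ℂ) ^ n = ∏ _i ∈ Finset.range n, RatFunc.X := by simp
  rw [e, ← Finset.prod_mul_distrib]
  refine Finset.prod_congr rfl fun i _ => ?_
  have := RatFunc.X_ne_zero (K := ℂ)
  simp only [map_sub, map_mul, RatFunc.algebraMap_C, RatFunc.algebraMap_X, map_pow]
  field_simp

theorem qFactorial_C_mul_X_neg (hq0 : q ≠ 0) {a : ℂ} (ha : a ≠ 0) (n : ℕ) :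
    qFactorial (RatFunc.C q) (RatFunc.C a * RatFunc.X) (-n : ℤ) *
      algebraMap ℂ[X] (RatFunc ℂ) (∏ i ∈ Finset.range n, (X - C (a⁻¹ * q ^ (i + 1)))) =
      algebraMap ℂ[X] (RatFunc ℂ) (C (∏ i ∈ Finset.range n, -(a⁻¹ * q ^ (i + 1)))) := by
  rcases n with _ | n
  · simp [qFactorial]
  have e0 : (-(n + 1 : ℕ) : ℤ) = Int.negSucc n := rfl
  rw [e0, qFactorial, map_prod, map_prod, map_prod, ← Finset.prod_inv_distrib,
    ← Finset.prod_mul_distrib]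
  refine Finset.prod_congr rfl fun i _ => ?_
  have h1 := RatFunc.algebraMap_ne_zero (K := ℂ) (X_sub_C_ne_zero (a⁻¹ * q ^ (i + 1)))
  have h2 : RatFunc.C a ≠ 0 := by simpa using ha
  have h3 : RatFunc.C q ≠ 0 := by simpa using hq0
  have e1 : algebraMap ℂ[X] (RatFunc ℂ) (X - C (a⁻¹ * q ^ (i + 1))) =
      (1 - RatFunc.C a * RatFunc.X * (RatFunc.C q)⁻¹ ^ (i + 1)) *
        algebraMap ℂ[X] (RatFunc ℂ) (C (-(a⁻¹ * q ^ (i + 1)))) := by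
    simp only [map_sub, RatFunc.algebraMap_C, RatFunc.algebraMap_X, map_mul, map_neg, map_inv₀,
      map_pow, inv_pow]
    field_simp
    ring
  rw [e1] at h1 ⊢
  rw [inv_mul_cancel_left₀ (left_ne_zero_of_mul h1)]

theorem X_pow_mul_qFactorial_C_div_X_neg (hq0 : q ≠ 0) {b : ℂ} (n : ℕ) :
    RatFunc.X ^ (-n : ℤ) * qFactorial (RatFunc.C q) (RatFunc.C b / RatFunc.X) (-n : ℤ) *
      algebraMap ℂ[X] (RatFunc ℂ) (∏ i ∈ Finset.range n, (X - C (b * q⁻¹ ^ (i + 1)))) = 1 := by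
  rcases n with _ | n
  · simp [qFactorial]
  have e : (RatFunc.X : RatFunc ℂ) ^ (-(n + 1 : ℕ) : ℤ) =
      ∏ _i ∈ Finset.range (n + 1), RatFunc.X⁻¹ := by
    rw [zpow_neg, zpow_natCast]; simp
  have e0 : (-(n + 1 : ℕ) : ℤ) = Int.negSucc n := rfl
  rw [e, e0, qFactorial, map_prod, ← Finset.prod_inv_distrib,
    ← Finset.prod_mul_distrib, ← Finset.prod_mul_distrib]
  refine Finset.prod_eq_one fun i _ => ?_
  have h1 := RatFunc.algebraMap_ne_zero (K := ℂ) (X_sub_C_ne_zero (b * q⁻¹ ^ (i + 1)))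
  have hX := RatFunc.X_ne_zero (K := ℂ)
  have h3 : RatFunc.C q ≠ 0 := by simpa using hq0
  have e1 : algebraMap ℂ[X] (RatFunc ℂ) (X - C (b * q⁻¹ ^ (i + 1))) =
      RatFunc.X * (1 - RatFunc.C b / RatFunc.X * (RatFunc.C q)⁻¹ ^ (i + 1)) := by
    simp only [map_sub, RatFunc.algebraMap_C, RatFunc.algebraMap_X, map_mul, map_inv₀, map_pow]
    field_simp
  rw [e1] at h1 ⊢
  rw [← mul_inv, inv_mul_cancel₀ h1]

theorem isFraction_qFactorial (hq0 : q ≠ 0) (hq1 : ‖q‖ < 1) {a : ℂ} (ha : a ≠ 0) (k : ℤ) :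
    IsFraction (geometricPoles a⁻¹ q (-k).toNat) k
      (qFactorial (RatFunc.C q) (RatFunc.C a * RatFunc.X) k) := by
  rcases le_or_gt 0 k with hk | hk
  · obtain ⟨n, rfl⟩ := Int.eq_ofNat_of_zero_le hk
    have e : geometricPoles a⁻¹ q (-(n : ℤ)).toNat = ∅ := by simp [geometricPoles]
    rw [e, qFactorial_C_mul_X]
    exact .of_polynomial (natDegree_pochNumer_le q a n)
  · obtain ⟨n, hn⟩ := Int.eq_ofNat_of_zero_le (neg_nonneg.2 hk.le)
    obtain rfl : k = -n := by omega
    have hinj := pow_succ_injective hq0 hq1 (inv_ne_zero ha)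
    rw [neg_neg, Int.toNat_natCast]
    refine ⟨C (∏ i ∈ Finset.range n, -(a⁻¹ * q ^ (i + 1))), ?_, ?_⟩
    · rw [geometricPoles, Finset.prod_image fun i _ j _ h => hinj h]
      exact qFactorial_C_mul_X_neg hq0 ha n
    · rw [geometricPoles, Finset.card_image_of_injective _ hinj, natDegree_C]
      simp

/-- The factor `X ^ l` removes the pole or zero at the origin that comes from the powers of `1 / z`.
-/
theorem isFraction_qFactorial' (hq0 : q ≠ 0) (hq1 : ‖q‖ < 1) {b : ℂ} (hb : b ≠ 0) (l : ℤ) :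
    IsFraction (geometricPoles b q⁻¹ (-l).toNat) l
      (RatFunc.X ^ l * qFactorial (RatFunc.C q) (RatFunc.C b / RatFunc.X) l) := by
  rcases le_or_gt 0 l with hl | hl
  · obtain ⟨n, rfl⟩ := Int.eq_ofNat_of_zero_le hl
    have e : geometricPoles b q⁻¹ (-(n : ℤ)).toNat = ∅ := by simp [geometricPoles]
    rw [e, zpow_natCast, X_pow_mul_qFactorial_C_div_X]
    exact .of_polynomial (natDegree_pochNumer'_le q b n)
  · obtain ⟨n, hn⟩ := Int.eq_ofNat_of_zero_le (neg_nonneg.2 hl.le)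
    obtain rfl : l = -n := by omega
    have hinj := inv_pow_succ_injective hq0 hq1 hb
    rw [neg_neg, Int.toNat_natCast]
    refine ⟨1, ?_, ?_⟩
    · rw [geometricPoles, Finset.prod_image fun i _ j _ h => hinj h, map_one]
      exact X_pow_mul_qFactorial_C_div_X_neg hq0 n
    · rw [geometricPoles, Finset.card_image_of_injective _ hinj]
      simp

theorem mem_orbit_of_mem_geometricPoles (c : Fin 3 → ℂ) {j : Fin 3} {n : ℕ} {z : ℂ}
    (hz : z ∈ geometricPoles (c j) q n) : ∃ m : ℤ, z = c j * q ^ m := by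
  obtain ⟨i, -, rfl⟩ := Finset.mem_image.1 hz
  exact ⟨(i + 1 : ℕ), by rw [zpow_natCast]⟩

theorem mem_orbit_of_mem_geometricPoles_inv (c : Fin 3 → ℂ) {j : Fin 3} {n : ℕ} {z : ℂ}
    (hz : z ∈ geometricPoles (c j) q⁻¹ n) : ∃ m : ℤ, z = c j * q ^ m := by
  obtain ⟨i, -, rfl⟩ := Finset.mem_image.1 hz
  exact ⟨-(i + 1 : ℕ), by rw [zpow_neg, zpow_natCast, inv_pow]⟩

theorem Inequivalent.eq_of_mul_zpow_eq {c : Fin 3 → ℂ} (hc : Inequivalent q c) (hq0 : q ≠ 0)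
    {i j : Fin 3} {m n : ℤ} (h : c i * q ^ m = c j * q ^ n) : i = j := by
  by_contra hij
  refine hc.2 i j hij (n - m) ?_
  have := zpow_ne_zero m hq0
  rw [zpow_sub₀ hq0]
  field_simp
  linear_combination h

theorem Inequivalent.inv {c : Fin 3 → ℂ} (hc : Inequivalent q c) : Inequivalent q c⁻¹ := by
  refine ⟨fun i => inv_ne_zero (hc.1 i), fun i j hij n h => hc.2 j i hij.symm n ?_⟩
  have h1 := hc.1 i
  have h2 := hc.1 j
  rw [Pi.inv_apply, Pi.inv_apply] at h
  field_simp at h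
  linear_combination h

/-- Writing `z^(-T)` as the product of the `z^(l_j)` distributes it over the factors. Genericity
keeps the poles of different factors apart, so all poles are simple, and the degrees add up to `T -
T = 0`. -/
theorem Generic.spanningFunction_mem (h : Generic q a b) {k l : Fin 3 → ℤ} {T : ℤ}
    (hk : ∑ j, k j = T) (hl : ∑ j, l j = -T) : spanningFunction q a b k l T ∈ W q a b := by
  have hX := RatFunc.X_ne_zero (K := ℂ)
  have e : spanningFunction q a b k l T =
      (∏ j, qFactorial (RatFunc.C q) (RatFunc.C (a j) * RatFunc.X) (k j)) *
      ∏ j, (RatFunc.X ^ l j * qFactorial (RatFunc.C q) (RatFunc.C (b j) / RatFunc.X) (l j)) := by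
    have : (RatFunc.X : RatFunc ℂ) ^ (-T) = ∏ j, RatFunc.X ^ l j := by
      rw [← hl, Fin.sum_univ_three, Fin.prod_univ_three, zpow_add₀ hX, zpow_add₀ hX]
    rw [spanningFunction, this, Finset.prod_mul_distrib, Finset.prod_mul_distrib]
    ring
  have hA := IsFraction.prod (u := Finset.univ) (fun j _ =>
    isFraction_qFactorial h.q_ne h.norm_q (h.aa.1 j) (k j)) (fun i _ j _ hij => by
      refine Finset.disjoint_left.2 fun z hz hz' => hij ?_
      obtain ⟨m, hm⟩ := mem_orbit_of_mem_geometricPoles a⁻¹ hz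
      obtain ⟨n, hn⟩ := mem_orbit_of_mem_geometricPoles a⁻¹ hz'
      exact (h.aa.inv).eq_of_mul_zpow_eq h.q_ne (hm.symm.trans hn))
  have hB := IsFraction.prod (u := Finset.univ) (fun j _ =>
    isFraction_qFactorial' h.q_ne h.norm_q (h.bb.1 j) (l j)) (fun i _ j _ hij => by
      refine Finset.disjoint_left.2 fun z hz hz' => hij ?_
      obtain ⟨m, hm⟩ := mem_orbit_of_mem_geometricPoles_inv b hz
      obtain ⟨n, hn⟩ := mem_orbit_of_mem_geometricPoles_inv b hz'
      exact h.bb.eq_of_mul_zpow_eq h.q_ne (hm.symm.trans hn))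
  have hAB := hA.mul hB (by
    refine Finset.disjoint_left.2 fun z hz hz' => ?_
    rw [Finset.mem_biUnion] at hz hz'
    obtain ⟨i, -, hz⟩ := hz
    obtain ⟨j, -, hz'⟩ := hz'
    obtain ⟨m, hm⟩ := mem_orbit_of_mem_geometricPoles a⁻¹ hz
    obtain ⟨n, hn⟩ := mem_orbit_of_mem_geometricPoles_inv b hz'
    exact h.notMem_orbit_inv ⟨j, n, hn⟩ ⟨i, m, hm⟩)
  rw [← e, hk, hl, add_neg_cancel] at hAB
  refine hAB.mem_W fun p hp => ?_
  rw [Finset.mem_union, Finset.mem_biUnion, Finset.mem_biUnion] at hp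
  rcases hp with ⟨j, -, hp⟩ | ⟨j, -, hp⟩
  · obtain ⟨i, -, rfl⟩ := Finset.mem_image.1 hp
    exact ⟨j, i + 1, by omega, Or.inl rfl⟩
  · obtain ⟨i, -, rfl⟩ := Finset.mem_image.1 hp
    exact ⟨j, i + 1, by omega, Or.inr rfl⟩

/-- Exponents concentrated on two indices, with sum zero. -/
def dipole (j j' : Fin 3) (n : ℤ) (i : Fin 3) : ℤ := if i = j then -n else if i = j' then n else 0

theorem prod_dipole {M : Type*} [CommMonoid M] {j j' : Fin 3} (hj : j ≠ j') (n : ℤ)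
    (f : Fin 3 → ℤ → M) (hf : ∀ i, f i 0 = 1) :
    ∏ i, f i (dipole j j' n i) = f j (-n) * f j' n := by
  rw [Finset.prod_eq_mul j j' hj (fun i _ hi => by simp [dipole, hi.1, hi.2, hf]) (by simp)
    (by simp)]
  simp [dipole, hj.symm]

theorem sum_dipole {j j' : Fin 3} (hj : j ≠ j') (n : ℤ) : ∑ i, dipole j j' n i = 0 := by
  have := prod_dipole (M := Multiplicative ℤ) hj n (fun _ k => Multiplicative.ofAdd k)
    (fun _ => rfl)
  rw [← ofAdd_sum] at this
  simpa using congrArg Multiplicative.toAdd this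

theorem qFactorial_zero {F : Type*} [Field F] (q a : F) : qFactorial q a 0 = 1 := by
  change qFactorial q a (Int.ofNat 0) = 1
  simp [qFactorial]

theorem spanningFunction_dipole_a (q : ℂ) (a b : Fin 3 → ℂ) {j j' : Fin 3} (hj : j ≠ j') (n : ℤ) :
    spanningFunction q a b (dipole j j' n) 0 0 =
      qFactorial (RatFunc.C q) (RatFunc.C (a j) * RatFunc.X) (-n) *
        qFactorial (RatFunc.C q) (RatFunc.C (a j') * RatFunc.X) n := by
  simp only [spanningFunction, Pi.zero_apply, qFactorial_zero, mul_one, neg_zero, zpow_zero, one_mul]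
  exact prod_dipole hj n
    (fun i k => qFactorial (RatFunc.C q) (RatFunc.C (a i) * RatFunc.X) k)
    fun i => qFactorial_zero _ _

theorem spanningFunction_dipole_b (q : ℂ) (a b : Fin 3 → ℂ) {j j' : Fin 3} (hj : j ≠ j') (n : ℤ) :
    spanningFunction q a b 0 (dipole j j' n) 0 =
      qFactorial (RatFunc.C q) (RatFunc.C (b j) / RatFunc.X) (-n) *
        qFactorial (RatFunc.C q) (RatFunc.C (b j') / RatFunc.X) n := by
  simp only [spanningFunction, Pi.zero_apply, qFactorial_zero, neg_zero, zpow_zero, one_mul]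
  exact prod_dipole hj n
    (fun i k => qFactorial (RatFunc.C q) (RatFunc.C (b i) / RatFunc.X) k)
    fun i => qFactorial_zero _ _

/-- The spanning functions span `W`. -/
theorem Generic.W_le_span (h : Generic q a b) {S : Submodule ℂ (RatFunc ℂ)}
    (hS : ∀ (k l : Fin 3 → ℤ) (T : ℤ), ∑ j, k j = T → ∑ j, l j = -T →
      spanningFunction q a b k l T ∈ S) : W q a b ≤ S := by
  have h1 : (1 : RatFunc ℂ) ∈ S := by
    have := hS 0 0 0 (by simp) (by simp)
    simpa [spanningFunction, qFactorial_zero] using this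
  have ha : ∀ j (n : ℕ), (algebraMap ℂ[X] (RatFunc ℂ) (X - C ((a j)⁻¹ * q ^ (n + 1))))⁻¹ ∈ S := by
    intro j
    obtain ⟨j', hj⟩ : ∃ j', j ≠ j' := by revert j; decide
    -- The quotient-like function `(a_j z)_{-n-1} (a_{j'} z)_{n+1}` has degree at most zero, has its
    -- poles at the first `n + 1` points of one half-orbit, and its numerator does not vanish at the
    -- last one because `a_j / a_{j'}` is not a power of `q`.
    refine IsFraction.inv_mem_submodule (p := fun n => (a j)⁻¹ * q ^ (n + 1))
      (g := fun n => spanningFunction q a b (dipole j j' (n + 1 : ℕ)) 0 0)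
      (N := fun n => C (∏ i ∈ Finset.range (n + 1), -((a j)⁻¹ * q ^ (i + 1))) *
        pochNumer q (a j') (n + 1)) h1
      (pow_succ_injective h.q_ne h.norm_q (h.inv_ne j))
      (fun n => hS _ _ _ (sum_dipole hj _) (by simp)) (fun n => ?_) (fun n => ?_) fun n => ?_
    · rw [spanningFunction_dipole_a q a b hj, mul_right_comm,
        qFactorial_C_mul_X_neg h.q_ne (h.aa.1 j), qFactorial_C_mul_X, map_mul]
    · exact (natDegree_C_mul_le _ _).trans (natDegree_pochNumer_le _ _ _)
    · simp only [eval_mul, eval_C, pochNumer, eval_prod, eval_sub, eval_one, eval_X]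
      refine mul_ne_zero (Finset.prod_ne_zero_iff.2 fun i _ => neg_ne_zero.2
        (mul_ne_zero (h.inv_ne j) (pow_ne_zero _ h.q_ne)))
        (Finset.prod_ne_zero_iff.2 fun i _ => sub_ne_zero.2 fun h' =>
          h.mul_pow_ne_one_of_ne hj (n + 1 : ℕ) i ?_)
      rw [h', Pi.inv_apply, zpow_natCast]
      ring
  have hb : ∀ j (n : ℕ), (algebraMap ℂ[X] (RatFunc ℂ) (X - C (b j * q⁻¹ ^ (n + 1))))⁻¹ ∈ S := by
    intro j
    obtain ⟨j', hj⟩ : ∃ j', j ≠ j' := by revert j; decide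
    refine IsFraction.inv_mem_submodule (p := fun n => b j * q⁻¹ ^ (n + 1))
      (g := fun n => spanningFunction q a b 0 (dipole j j' (n + 1 : ℕ)) 0)
      (N := fun n => pochNumer' q (b j') (n + 1)) h1
      (inv_pow_succ_injective h.q_ne h.norm_q (h.bb.1 j))
      (fun n => hS _ _ _ (by simp) (by rw [sum_dipole hj]; simp)) (fun n => ?_) (fun n => ?_)
      fun n => ?_
    · have hX : (RatFunc.X : RatFunc ℂ) ^ (n + 1) ≠ 0 := pow_ne_zero _ RatFunc.X_ne_zero
      have k1 := X_pow_mul_qFactorial_C_div_X_neg h.q_ne (b := b j) (n + 1)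
      rw [spanningFunction_dipole_b q a b hj, ← X_pow_mul_qFactorial_C_div_X]
      rw [zpow_neg, zpow_natCast] at k1
      generalize qFactorial (RatFunc.C q) (RatFunc.C (b j) / RatFunc.X) (-(n + 1 : ℕ) : ℤ) = u at *
      rw [mul_assoc, inv_mul_eq_iff_eq_mul₀ hX, mul_one] at k1
      rw [mul_right_comm, k1]
    · exact natDegree_pochNumer'_le _ _ _
    · simp only [pochNumer', eval_prod, eval_sub, eval_C, eval_X]
      refine Finset.prod_ne_zero_iff.2 fun i _ => sub_ne_zero.2 fun h' =>
        h.div_mul_pow_ne_one_of_ne hj (-(n + 1 : ℕ)) i ?_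
      have hne : b j * q ^ (-(n + 1 : ℕ) : ℤ) ≠ 0 :=
        mul_ne_zero (h.bb.1 j) (zpow_ne_zero _ h.q_ne)
      rw [div_mul_eq_mul_div, div_eq_one_iff_eq hne, zpow_neg, zpow_natCast, ← inv_pow, h']
  intro f hf
  obtain ⟨s, hs, hfs⟩ := IsFraction.of_mem_W hf
  refine hfs.mem_submodule h1 fun p hp => ?_
  obtain ⟨j, n, hn, rfl | rfl⟩ := hs p hp
  · obtain ⟨m, rfl⟩ := Nat.exists_eq_add_of_le' hn
    exact ha j m
  · obtain ⟨m, rfl⟩ := Nat.exists_eq_add_of_le' hn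
    exact hb j m

end Spanning

/-! ### The set where the normalizing denominator does not vanish. -/

section NormDenom

variable {q : ℂ} {a b : Fin 3 → ℂ}

theorem Generic.analyticAt_normDenom (h : Generic q a b) {x y : ℂ} (hx : x ≠ 0) (hy : y ≠ 0) :
    AnalyticAt ℂ (fun p : ℂ × ℂ => normDenom q a b p.1 p.2) (x, y) := by
  have h1 : AnalyticAt ℂ (fun p : ℂ × ℂ => p.1) (x, y) := analyticAt_fst
  have h2 : AnalyticAt ℂ (fun p : ℂ × ℂ => p.2) (x, y) := analyticAt_snd
  have hm : ∀ (f : ℂ × ℂ → ℂ) (c : ℂ), AnalyticAt ℂ f (x, y) → f (x, y) ≠ 0 → c ≠ 0 →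
      AnalyticAt ℂ (fun p => theta q (f p * c)) (x, y) := fun f c hf hf0 hc =>
    AnalyticAt.fun_comp (f := fun p => f p * c)
      (analyticAt_theta h.norm_q (mul_ne_zero hf0 hc)) (hf.mul analyticAt_const)
  have hd : ∀ (f : ℂ × ℂ → ℂ) (c : ℂ), AnalyticAt ℂ f (x, y) → f (x, y) ≠ 0 → c ≠ 0 →
      AnalyticAt ℂ (fun p => theta q (f p / c)) (x, y) := fun f c hf hf0 hc =>
    AnalyticAt.fun_comp (f := fun p => f p / c)
      (analyticAt_theta h.norm_q (div_ne_zero hf0 hc)) (hf.fun_div analyticAt_const hc)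
  unfold normDenom
  refine AnalyticAt.fun_sub (Finset.analyticAt_fun_prod _ fun j _ => ?_)
    (AnalyticAt.fun_mul (h1.fun_div h2 hy) (Finset.analyticAt_fun_prod _ fun j _ => ?_))
  · exact (hd _ _ h1 hx (h.aa.1 j)).fun_mul (hm _ _ h2 hy (h.bb.1 j))
  · exact (hm _ _ h1 hx (h.bb.1 j)).fun_mul (hd _ _ h2 hy (h.aa.1 j))

theorem Generic.isOpen_normDenom (h : Generic q a b) :
    IsOpen {p : ℂ × ℂ | p.1 ≠ 0 ∧ p.2 ≠ 0 ∧ normDenom q a b p.1 p.2 ≠ 0} := by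
  rw [isOpen_iff_mem_nhds]
  rintro ⟨x, y⟩ ⟨hx, hy, hD⟩
  have h1 : ∀ᶠ p : ℂ × ℂ in 𝓝 (x, y), p.1 ≠ 0 := continuous_fst.continuousAt.eventually_ne hx
  have h2 : ∀ᶠ p : ℂ × ℂ in 𝓝 (x, y), p.2 ≠ 0 := continuous_snd.continuousAt.eventually_ne hy
  have h3 := (h.analyticAt_normDenom hx hy).continuousAt.eventually_ne hD
  filter_upwards [h1, h2, h3] with p k1 k2 k3
  exact ⟨k1, k2, k3⟩

/-- At `λ₁ = a₁` the first product contains `θ(1) = 0`, and genericity keeps every theta factor of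
the second away from zero. -/
theorem Generic.normDenom_ne_zero (h : Generic q a b) {y : ℂ} (hy : y ≠ 0) (hya : y ∉ orbit q a) :
    normDenom q a b (a 0) y ≠ 0 := by
  have h1 : ∏ j, (theta q (a 0 / a j) * theta q (y * b j)) = 0 := by
    refine Finset.prod_eq_zero (Finset.mem_univ 0) ?_
    rw [div_self (h.aa.1 0), theta_one h.q_ne h.norm_q, zero_mul]
  rw [normDenom, h1, zero_sub]
  refine neg_ne_zero.2 (mul_ne_zero (div_ne_zero (h.aa.1 0) hy)
    (Finset.prod_ne_zero_iff.2 fun j _ => mul_ne_zero ?_ ?_))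
  · exact theta_ne_zero h.q_ne h.norm_q (h.ab 0 j)
  · refine theta_ne_zero h.q_ne h.norm_q fun n hn => hya ⟨j, n, ?_⟩
    rw [div_eq_iff (h.aa.1 j)] at hn
    rw [hn, mul_comm]

/-- If `normDenom` vanished on an open box, then for some generic second coordinate the identity
theorem on the connected set of nonzero `λ₁` would force a zero at `λ₁ = a₁`. -/
theorem Generic.dense_normDenom (h : Generic q a b) :
    Dense {p : ℂ × ℂ | p.1 ≠ 0 ∧ p.2 ≠ 0 ∧ normDenom q a b p.1 p.2 ≠ 0} := by
  rw [dense_iff_inter_open]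
  rintro U hU ⟨⟨x₀, y₀⟩, hxy⟩
  obtain ⟨V, V', hV, hV', hx₀, hy₀, hVU⟩ := isOpen_prod_iff.1 hU x₀ y₀ hxy
  obtain ⟨y, hyV, hyc⟩ := (((countable_orbit q a).insert 0).dense_compl ℝ).inter_open_nonempty
    V' hV' ⟨y₀, hy₀⟩
  have hy0 : y ≠ 0 := fun h' => hyc (Or.inl h')
  have hya : y ∉ orbit q a := fun h' => hyc (Or.inr h')
  have han : AnalyticOnNhd ℂ (fun x => normDenom q a b x y) {0}ᶜ := fun x hx =>
    AnalyticAt.fun_comp (f := fun x : ℂ => (x, y)) (h.analyticAt_normDenom hx hy0)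
      (analyticAt_id.prod analyticAt_const)
  obtain ⟨x₁, hx₁V, hx₁0⟩ := (dense_compl_singleton (0 : ℂ)).inter_open_nonempty V hV ⟨x₀, hx₀⟩
  by_contra hne
  have hzero : (fun x => normDenom q a b x y) =ᶠ[𝓝 x₁] 0 := by
    filter_upwards [hV.mem_nhds hx₁V, isOpen_ne.mem_nhds (hx₁0 : x₁ ≠ 0)] with x hx hx0
    by_contra hD
    exact hne ⟨(x, y), hVU ⟨hx, hyV⟩, hx0, hy0, hD⟩
  have hconn : IsPreconnected ({0}ᶜ : Set ℂ) :=
    (isConnected_compl_singleton_of_one_lt_rank (by simp) 0).isPreconnected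
  exact h.normDenom_ne_zero hy0 hya
    (han.eqOn_zero_of_preconnected_of_eventuallyEq_zero hconn hx₁0 hzero (h.aa.1 0))

end NormDenom

/-! ### The functional defined by the integral, and its uniqueness. -/

section Functional

variable {q : ℂ} {a b lam : Fin 3 → ℂ}

/-- A curve with suitable winding numbers is a contour for all integrands that are regular at
the remaining candidates. -/
theorem Admissible.isContour {F : ℂ → ℂ} (hF : Admissible q a b F) {M : ℕ}
    (hb : ∀ j (m : ℤ), m < -M → HasSimplePole F (b j * q ^ m) 0)
    (ha : ∀ j (m : ℤ), M < m → HasSimplePole F (a⁻¹ j * q ^ m) 0) {z₀ : ℂ} {γ : Path z₀ z₀}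
    (h1 : IsPiecewiseC1 γ) (h2 : ∀ t, γ t ≠ 0 ∧ γ t ∉ candidates q a b) (h3 : winding γ 0 = 1)
    (h4 : ∀ j (m : ℤ), -M ≤ m → winding γ (b j * q ^ m) = 1)
    (h5 : ∀ j (m : ℤ), m ≤ M → winding γ (a⁻¹ j * q ^ m) = 0) : IsContour q a b F γ where
  piecewiseC1 := h1
  ne_zero t := (h2 t).1
  avoids t := (HasSimplePole.of_analyticAt (hF.analyticAt _ (h2 t).1 (h2 t).2)).not_order_neg
  winding_zero := h3
  inside j m hm := h4 j m (by
    by_contra! hlt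
    exact (hb j m hlt).not_order_neg hm)
  outside j m hm := h5 j m (by
    by_contra! hlt
    exact (ha j m hlt).not_order_neg hm)

/-- Contours depend on the integrand; additivity of the integral requires one that serves several
integrands at once. -/
theorem Generic.exists_common_contour (h : Generic q a b) {ι : Type*} [Fintype ι] {F : ι → ℂ → ℂ}
    (hF : ∀ i, Admissible q a b (F i)) : ∃ (z₀ : ℂ) (γ : Path z₀ z₀),
    (∀ t, γ t ∉ candidates q a b) ∧ ∀ i, IsContour q a b (F i) γ := by
  choose M hb ha using fun i => (hF i).regular
  have hM : ∀ i, M i ≤ ∑ i, M i := fun i =>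
    Finset.single_le_sum (fun _ _ => Nat.zero_le _) (Finset.mem_univ i)
  obtain ⟨z₀, γ, h1, h2, h3, h4, h5⟩ := h.exists_contour (∑ i, M i)
  refine ⟨z₀, γ, fun t => (h2 t).2, fun i => (hF i).isContour (M := ∑ i, M i)
    (fun j m hm => hb i j m ?_) (fun j m hm => ha i j m ?_) h1 h2 h3 h4 h5⟩
  · have := hM i
    omega
  · have := hM i
    omega

theorem Generic.exists_isContour (h : Generic q a b) {F : ℂ → ℂ} (hF : Admissible q a b F) :
    ∃ (z₀ : ℂ) (γ : Path z₀ z₀), IsContour q a b F γ := by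
  obtain ⟨z₀, γ, -, h1⟩ := h.exists_common_contour (ι := Unit) (F := fun _ => F) fun _ => hF
  exact ⟨z₀, γ, h1 ()⟩

theorem denom_eval_ne_zero {f : RatFunc ℂ} (hf : f ∈ W q a b) {z : ℂ}
    (hz : z ∉ candidates q a b) : f.denom.eval₂ (RingHom.id ℂ) z ≠ 0 := by
  rw [eval₂_id]
  exact fun h => hz (poleSet_subset q a b (hf.2.2 z h))

theorem integrand_add {f g : RatFunc ℂ} (hf : f ∈ W q a b) (hg : g ∈ W q a b) {z : ℂ}
    (hz : z ∉ candidates q a b) :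
    integrand q a b lam (f + g) z = integrand q a b lam f z + integrand q a b lam g z := by
  simp only [integrand]
  rw [RatFunc.eval_add (RingHom.id ℂ) (a := z) (denom_eval_ne_zero hf hz)
    (denom_eval_ne_zero hg hz)]
  ring

theorem integrand_smul (c : ℂ) {f : RatFunc ℂ} (hf : f ∈ W q a b) {z : ℂ}
    (hz : z ∉ candidates q a b) :
    integrand q a b lam (c • f) z = c * integrand q a b lam f z := by
  simp only [integrand]
  rw [RatFunc.smul_eq_C_mul, RatFunc.eval_mul (RingHom.id ℂ) (a := z) (by simp)
    (denom_eval_ne_zero hf hz), RatFunc.eval_C]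
  simp only [RingHom.id_apply]
  ring

/-- The linear functional given by the integral representation. -/
theorem Generic.exists_functional (h : Generic q a b) (hl : ∀ j, lam j ≠ 0)
    (hlb : (∏ j, lam j) * ∏ j, b j = q ^ 2) : ∃ K : W q a b →ₗ[ℂ] ℂ,
    ∀ (g : W q a b) (z₀ : ℂ) (γ : Path z₀ z₀), IsContour q a b (integrand q a b lam g) γ →
      K g = lineIntegral (integrand q a b lam g) γ := by
  have hF : ∀ g : W q a b, Admissible q a b (integrand q a b lam g) := fun g =>
    h.admissible_integrand hl hlb g.2
  -- The functional is defined with an arbitrary choice of contour for each `g`; by `key` any other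
  -- contour gives the same value.
  choose z₀ γ hγ using fun g => h.exists_isContour (hF g)
  have key : ∀ (g : W q a b) (z₁ : ℂ) (γ' : Path z₁ z₁),
      IsContour q a b (integrand q a b lam g) γ' →
      lineIntegral (integrand q a b lam g) (γ g) = lineIntegral (integrand q a b lam g) γ' :=
    fun g z₁ γ' hγ' => (h.curveIntegrable_and_lineIntegral_eq (hF g) (hγ g) hγ').2
  refine ⟨{ toFun := fun g => lineIntegral (integrand q a b lam g) (γ g)
            map_add' := fun f g => ?_
            map_smul' := fun c f => ?_ }, key⟩
  · obtain ⟨z₁, γ', hc, hγ'⟩ := h.exists_common_contour (F := ![integrand q a b lam f,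
      integrand q a b lam g, integrand q a b lam (f + g : W q a b)])
      (fun i => by fin_cases i; exacts [hF f, hF g, hF (f + g)])
    have c1 : IsContour q a b (integrand q a b lam f) γ' := hγ' 0
    have c2 : IsContour q a b (integrand q a b lam g) γ' := hγ' 1
    have c3 : IsContour q a b (integrand q a b lam (f + g : W q a b)) γ' := hγ' 2
    rw [key _ _ _ c1, key _ _ _ c2, key _ _ _ c3, lineIntegral, lineIntegral, lineIntegral,
      ← mul_add, ← curveIntegral_oneForm_add
        (h.curveIntegrable_and_lineIntegral_eq (hF f) c1 c1).1
        (h.curveIntegrable_and_lineIntegral_eq (hF g) c2 c2).1]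
    congr 1
    exact curveIntegral_congr ⟨candidates q a b, h.countable_candidates, fun t ht =>
      integrand_add f.2 g.2 ht⟩
  · obtain ⟨z₁, γ', hc, hγ'⟩ := h.exists_common_contour (F := ![integrand q a b lam f,
      integrand q a b lam (c • f : W q a b)])
      (fun i => by fin_cases i; exacts [hF f, hF (c • f)])
    have c1 : IsContour q a b (integrand q a b lam f) γ' := hγ' 0
    have c2 : IsContour q a b (integrand q a b lam (c • f : W q a b)) γ' := hγ' 1
    have e := curveIntegral_congr (γ := γ') (F := integrand q a b lam (c • f : W q a b))
      (F' := fun z => c * integrand q a b lam f z) ⟨candidates q a b, h.countable_candidates,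
        fun t ht => integrand_smul c f.2 ht⟩
    rw [key _ _ _ c1, key _ _ _ c2, lineIntegral, lineIntegral, e,
      curveIntegral_oneForm_const_mul, RingHom.id_apply, smul_eq_mul]
    ring

/-- The locus where the two functionals agree is a subspace containing all spanning functions, hence
all of `W`. -/
theorem Generic.functional_unique (h : Generic q a b) {K K' : W q a b →ₗ[ℂ] ℂ}
    (hK : IsFunctional q a b K) (hK' : IsFunctional q a b K') : K = K' := by
  have h1 : W q a b ≤ (LinearMap.eqLocus K K').map (W q a b).subtype := by
    refine h.W_le_span fun k l T hk hl => ?_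
    obtain ⟨hm, hv⟩ := hK k l T hk hl
    obtain ⟨hm', hv'⟩ := hK' k l T hk hl
    exact ⟨⟨_, hm⟩, hv.trans hv'.symm, rfl⟩
  ext g
  obtain ⟨g', hg', hgg'⟩ := h1 g.2
  obtain rfl : g' = g := Subtype.ext hgg'
  exact hg'

theorem Generic.exists_isFunctional (h : Generic q a b) (hlam : ∏ j, lam j = q * ∏ j, a j)
    (hD : normDenom q a b (lam 0) (lam 1) ≠ 0) : ∃ K : W q a b →ₗ[ℂ] ℂ, IsFunctional q a b K ∧
    ∀ (g : W q a b), (∃ (z₀ : ℂ) (γ : Path z₀ z₀), IsContour q a b (integrand q a b lam g) γ) ∧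
      ∀ (z₀ : ℂ) (γ : Path z₀ z₀), IsContour q a b (integrand q a b lam g) γ →
        CurveIntegrable (oneForm (integrand q a b lam g)) γ ∧
        K g = normFactor q a b (lam 0) (lam 1) * lineIntegral (integrand q a b lam g) γ := by
  have hlb : (∏ j, lam j) * ∏ j, b j = q ^ 2 := by rw [hlam, mul_assoc, h.bal, sq]
  have hl : ∀ j, lam j ≠ 0 := by
    have : ∏ j, lam j ≠ 0 := by
      rw [hlam]
      exact mul_ne_zero h.q_ne (Finset.prod_ne_zero_iff.2 fun i _ => h.aa.1 i)
    exact fun j => Finset.prod_ne_zero_iff.1 this j (Finset.mem_univ j)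
  obtain ⟨J, hJ⟩ := h.exists_functional hl hlb
  have hF : ∀ g : W q a b, Admissible q a b (integrand q a b lam g) := fun g =>
    h.admissible_integrand hl hlb g.2
  refine ⟨normFactor q a b (lam 0) (lam 1) • J, fun k l T hk hl' => ?_, fun g =>
    ⟨h.exists_isContour (hF g), fun z₀ γ hγ =>
      ⟨(h.curveIntegrable_and_lineIntegral_eq (hF g) hγ hγ).1, ?_⟩⟩⟩
  · refine ⟨h.spanningFunction_mem hk hl', ?_⟩
    obtain ⟨z₀, γ, hγ⟩ := h.exists_isContour (hF ⟨_, h.spanningFunction_mem hk hl'⟩)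
    rw [LinearMap.smul_apply, hJ _ _ _ hγ, smul_eq_mul]
    exact h.normFactor_mul_lineIntegral hlam hD hk hl' hγ
  · rw [LinearMap.smul_apply, hJ g _ _ hγ, smul_eq_mul]

end Functional

end AlSalamIsmail

end

theorem mainTheorem10 (q : ℂ) (hq0 : q ≠ 0) (hq1 : ‖q‖ < 1) (a b : Fin 3 → ℂ)
    (hbal : (∏ j, a j) * ∏ j, b j = q)
    (haa : ∀ i j : Fin 3, i ≠ j → ∀ n : ℤ, a i / a j ≠ q ^ n)
    (hbb : ∀ i j : Fin 3, i ≠ j → ∀ n : ℤ, b i / b j ≠ q ^ n)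
    (hab : ∀ (i j : Fin 3) (n : ℤ), a i * b j ≠ q ^ n) :
    (∃! K : AlSalamIsmail.W q a b →ₗ[ℂ] ℂ, AlSalamIsmail.IsFunctional q a b K) ∧
    (IsOpen {p : ℂ × ℂ | p.1 ≠ 0 ∧ p.2 ≠ 0 ∧ AlSalamIsmail.normDenom q a b p.1 p.2 ≠ 0} ∧
      Dense {p : ℂ × ℂ | p.1 ≠ 0 ∧ p.2 ≠ 0 ∧ AlSalamIsmail.normDenom q a b p.1 p.2 ≠ 0}) ∧
    ∀ K : AlSalamIsmail.W q a b →ₗ[ℂ] ℂ, AlSalamIsmail.IsFunctional q a b K →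
      ∀ lam : Fin 3 → ℂ, ∏ j, lam j = q * ∏ j, a j →
        AlSalamIsmail.normDenom q a b (lam 0) (lam 1) ≠ 0 →
        ∀ g : AlSalamIsmail.W q a b,
          (∃ (z₀ : ℂ) (γ : Path z₀ z₀),
            AlSalamIsmail.IsContour q a b (AlSalamIsmail.integrand q a b lam g) γ) ∧
          ∀ (z₀ : ℂ) (γ : Path z₀ z₀),
            AlSalamIsmail.IsContour q a b (AlSalamIsmail.integrand q a b lam g) γ →
            CurveIntegrable
              (AlSalamIsmail.oneForm (AlSalamIsmail.integrand q a b lam g)) γ ∧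
            K g = AlSalamIsmail.normFactor q a b (lam 0) (lam 1) *
              AlSalamIsmail.lineIntegral (AlSalamIsmail.integrand q a b lam g) γ := by
  -- The balancing condition with `q ≠ 0` already forces all parameters to be nonzero.
  have hprod : (∏ j, a j) * ∏ j, b j ≠ 0 := by rwa [hbal]
  have ha : ∀ j, a j ≠ 0 := fun j =>
    Finset.prod_ne_zero_iff.1 (left_ne_zero_of_mul hprod) j (Finset.mem_univ j)
  have hb : ∀ j, b j ≠ 0 := fun j =>
    Finset.prod_ne_zero_iff.1 (right_ne_zero_of_mul hprod) j (Finset.mem_univ j)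
  have h : AlSalamIsmail.Generic q a b :=
    { q_ne := hq0
      norm_q := hq1
      bal := hbal
      aa := ⟨ha, fun i j hij n hn => haa i j hij n (by rw [hn, mul_div_cancel_right₀ _ (ha j)])⟩
      bb := ⟨hb, fun i j hij n hn => hbb i j hij n (by rw [hn, mul_div_cancel_right₀ _ (hb j)])⟩
      ab := hab }
  refine ⟨?_, ⟨h.isOpen_normDenom, h.dense_normDenom⟩, fun K hK lam hlam hD => ?_⟩
  -- Density supplies one admissible pair `(λ₁, λ₂)`, and `λ₃` is then determined by the product
  -- condition.
  · obtain ⟨⟨x, y⟩, hx, hy, hD⟩ := h.dense_normDenom.nonempty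
    obtain ⟨K, hK, -⟩ := h.exists_isFunctional (lam := ![x, y, q * (∏ j, a j) / (x * y)])
      (by
        simp only at hx hy
        rw [Fin.prod_univ_three (f := ![x, y, q * (∏ j, a j) / (x * y)])]
        simp only [Matrix.cons_val_zero, Matrix.cons_val_one, Matrix.cons_val]
        field_simp) hD
    exact ⟨K, hK, fun K' hK' => h.functional_unique hK' hK⟩
  -- Each admissible `λ` gives its own integral functional; by uniqueness all of them coincide with
  -- `K`.
  · obtain ⟨K', hK', h'⟩ := h.exists_isFunctional hlam hD
    rw [h.functional_unique hK hK']
    exact h'
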